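/- Let $G$ be a finite group. Tambara functors are functors on finite $G$-sets, and modules over a Tambara functor $k$ are modules over its underlying Green functor, with box product $\boxtimes_k$. A $k$-algebra is a morphism of $G$-Tambara functors $k \to R$. It is \emph{finite} if $R$ is a finitely generated $k$-module. It is \emph{étale} if (a) $R$ is \emph{flat}, i.e. the functor $R \boxtimes_k -$ on $k$-modules is exact; (b) its genuine Kähler differentials vanish, i.e. $I/I^{>1} = 0$, where $I$ is the kernel of the multiplication map $R \boxtimes_k R \to R$ and $I^{>1} \subseteq I$ is the sub-ideal (of the Tambara functor $R\boxtimes_k R$) generated by all products $xy$ with $x,y \in I(G/H)$ and by all images of norms $I(G/K) \to I(G/H)$ with $K$ conjugate to a proper subgroup of $H$; and (c) $R$ is \emph{finitely presented}, i.e. isomorphic to a coequalizer, in $k$-algebras, of two $k$-algebra maps between free polynomial $k$-algebras on finitely many generators (where the free polynomial $k$-algebra on generators in levels $X_1, \dots, X_n$, for finite $G$-sets $X_i$, represents the functor $S \mapsto S(X_1) \times \cdots \times S(X_n)$). For a field $\mathbb{F}$ let $\underline{\mathbb{F}}$ be the constant $G$-Tambara functor: $\underline{\mathbb{F}}(X)$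 is the ring of $G$-invariant functions $X \to \mathbb{F}$, with restriction given by composition, transfer by summation over fibres and norm by multiplication over fibres (so $\underline{\mathbb{F}}(G/H) = \mathbb{F}$ for each $H$). For a subgroup $H \subseteq G$ let $\mathrm{CoInd}_H^G \underline{\mathbb{F}}$ be the coinduction of the constant $H$-Tambara functor, $(\mathrm{CoInd}_H^G \underline{\mathbb{F}})(X) = \underline{\mathbb{F}}(\mathrm{Res}_H^G X)$, regarded as an $\underline{\mathbb{F}}$-algebra through the canonical map $\underline{\mathbb{F}} \to \mathrm{CoInd}_H^G \mathrm{Res}_H^G \underline{\mathbb{F}} \cong \mathrm{CoInd}_H^G \underline{\mathbb{F}}$, which regards a $G$-invariant function as an $H$-invariant one. \textbf{Theorem.} Let $G$ be any finite group, let $\mathbb{F}$ be any algebraically closed field (of any characteristic), and let $\ell$ be a finite $\underline{\mathbb{F}}$-algebra. Then $\ell$ is étale over $\underline{\mathbb{F}}$ if and only if there are finitely many (possibly no) subgroups $H_1, \dots, H_n \subseteq G$, not necessarily distinct, and an isomorphism of $\underline{\mathbb{F}}$-algebras \[ \ell \;\cong\; \prod_{i=1}^n \mathrm{CoInd}_{H_i}^G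 \underline{\mathbb{F}} . \] -/

import Mathlib

universe u v w w'

/-- Finite `G`-sets. -/
structure FinGSet (G : Type u) [Group G] : Type (u + 1) where
  carrier : Type u
  [action : MulAction G carrier]
  [finite : Finite carrier]

namespace FinGSet

instance {G : Type u} [Group G] : CoeSort (FinGSet.{u} G) (Type u) := ⟨FinGSet.carrier⟩

attribute [instance] FinGSet.action FinGSet.finite

/-- A commutative square `f ∘ a = g ∘ b` of finite `G`-sets which is a pullback. -/
structure IsPB {G : Type u} [Group G] {W X Y Z : FinGSet G} (a : W →[G] X) (b : W →[G] Y)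
    (f : X →[G] Z) (g : Y →[G] Z) : Prop where
  comm : ∀ t, f (a t) = g (b t)
  inj : ∀ t t', a t = a t' → b t = b t' → t = t'
  surj : ∀ x y, f x = g y → ∃ t, a t = x ∧ b t = y

/-- `i : X → Z` and `j : Y → Z` exhibit `Z` as the disjoint union of `X` and `Y`. -/
structure IsCoprod {G : Type u} [Group G] {X Y Z : FinGSet G} (i : X →[G] Z) (j : Y →[G] Z) :
    Prop where
  inj_left : Function.Injective i
  inj_right : Function.Injective j
  disj : ∀ x y, i x ≠ j y
  surj : ∀ z, (∃ x, i x = z) ∨ ∃ y, j y = z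

/-- An exponential diagram
`X <-p- A <-e- E -r-> P -q-> Y`  over  `f : X → Y`:
the square with sides `p ∘ e`, `r`, `f`, `q` is a pullback, and the fibre of `q` over `y : Y` is,
through `e`, the set of sections of `p` over the fibre of `f` at `y`. So `q` is the dependent
product of `p` along `f`, and `e` is the evaluation map. -/
structure IsExp {G : Type u} [Group G] {X Y A P E : FinGSet G} (f : X →[G] Y) (p : A →[G] X)
    (q : P →[G] Y) (e : E →[G] A) (r : E →[G] P) : Prop where
  pb : IsPB (p.comp e) r f q
  inj : ∀ t t', q t = q t' →
    (∀ z z', r z = t → r z' = t' → p (e z) = p (e z') → e z = e z') → t = t'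
  surj : ∀ (y : Y) (s : {x : X // f x = y} → A), (∀ x, p (s x) = x) →
    ∃ t, q t = y ∧ ∀ z (x : {x : X // f x = y}), r z = t → p (e z) = x → e z = s x

end FinGSet

open FinGSet

/-- A `G`-Tambara functor: commutative rings `T(X)` for finite `G`-sets `X`, with restrictions,
transfers and norms along equivariant maps. -/
structure TambaraFunctor (G : Type u) [Group G] : Type (max (u + 1) (w + 1)) where
  obj : FinGSet.{u} G → Type w
  [ring : ∀ X, CommRing (obj X)]
  res : ∀ {X Y : FinGSet G}, (X →[G] Y) → obj Y →+* obj X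
  tr : ∀ {X Y : FinGSet G}, (X →[G] Y) → obj X →+ obj Y
  nm : ∀ {X Y : FinGSet G}, (X →[G] Y) → obj X →* obj Y
  res_id : ∀ {X : FinGSet G} (x : obj X), res (MulActionHom.id G) x = x
  tr_id : ∀ {X : FinGSet G} (x : obj X), tr (MulActionHom.id G) x = x
  nm_id : ∀ {X : FinGSet G} (x : obj X), nm (MulActionHom.id G) x = x
  res_comp : ∀ {X Y Z : FinGSet G} (g : Y →[G] Z) (f : X →[G] Y) (x : obj Z),
    res (g.comp f) x = res f (res g x)
  tr_comp : ∀ {X Y Z : FinGSet G} (g : Y →[G] Z) (f : X →[G] Y) (x : obj X),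
    tr (g.comp f) x = tr g (tr f x)
  nm_comp : ∀ {X Y Z : FinGSet G} (g : Y →[G] Z) (f : X →[G] Y) (x : obj X),
    nm (g.comp f) x = nm g (nm f x)
  /-- `T` turns finite disjoint unions into products. -/
  empty : ∀ X : FinGSet G, IsEmpty X → Subsingleton (obj X)
  coprod : ∀ {X Y Z : FinGSet G} {i : X →[G] Z} {j : Y →[G] Z}, IsCoprod i j →
    Function.Bijective fun z : obj Z => (res i z, res j z)
  /-- The double coset formulas. -/
  res_tr : ∀ {W X Y Z : FinGSet G} {a : W →[G] X} {b : W →[G] Y} {f : X →[G] Z} {g : Y →[G] Z},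
    IsPB a b f g → ∀ x, res g (tr f x) = tr b (res a x)
  res_nm : ∀ {W X Y Z : FinGSet G} {a : W →[G] X} {b : W →[G] Y} {f : X →[G] Z} {g : Y →[G] Z},
    IsPB a b f g → ∀ x, res g (nm f x) = nm b (res a x)
  /-- The distributive law of norms over transfers. -/
  nm_tr : ∀ {X Y A P E : FinGSet G} {f : X →[G] Y} {p : A →[G] X} {q : P →[G] Y}
    {e : E →[G] A} {r : E →[G] P}, IsExp f p q e r →
    ∀ x, nm f (tr p x) = tr q (nm r (res e x))
  /-- Frobenius reciprocity. -/
  tr_mul_res : ∀ {X Y : FinGSet G} (f : X →[G] Y) (x : obj X) (y : obj Y),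
    tr f (x * res f y) = tr f x * y

namespace TambaraFunctor

variable {G : Type u} [Group G]

attribute [instance] TambaraFunctor.ring

/-- A morphism of Tambara functors. -/
structure Hom (S : TambaraFunctor.{u, w} G) (T : TambaraFunctor.{u, w'} G) where
  app : ∀ X : FinGSet.{u} G, S.obj X →+* T.obj X
  app_res : ∀ {X Y : FinGSet G} (f : X →[G] Y) (x : S.obj Y), app X (S.res f x) = T.res f (app Y x)
  app_tr : ∀ {X Y : FinGSet G} (f : X →[G] Y) (x : S.obj X), app Y (S.tr f x) = T.tr f (app X x)
  app_nm : ∀ {X Y : FinGSet G} (f : X →[G] Y) (x : S.obj X), app Y (S.nm f x) = T.nm f (app X x)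

/-- Composition of morphisms of Tambara functors. -/
def Hom.comp {S : TambaraFunctor.{u, v} G} {T : TambaraFunctor.{u, w} G}
    {U : TambaraFunctor.{u, w'} G} (ψ : Hom T U) (φ : Hom S T) : Hom S U where
  app X := (ψ.app X).comp (φ.app X)
  app_res f x := by simp [φ.app_res, ψ.app_res]
  app_tr f x := by simp [φ.app_tr, ψ.app_tr]
  app_nm f x := by simp [φ.app_nm, ψ.app_nm]

/-- A morphism of Tambara functors is an isomorphism if and only if it is bijective at every
level (the inverse is then automatically a morphism). -/
def Hom.IsIso {S : TambaraFunctor.{u, w} G} {T : TambaraFunctor.{u, w'} G} (φ : Hom S T) : Prop :=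
  ∀ X, Function.Bijective (φ.app X)

/-- The product of a family of Tambara functors, formed levelwise. -/
def pi {ι : Type} (T : ι → TambaraFunctor.{u, w} G) : TambaraFunctor.{u, w} G where
  obj X := ∀ i, (T i).obj X
  res f := RingHom.pi fun i => ((T i).res f).comp (Pi.evalRingHom _ i)
  tr f := AddMonoidHom.pi fun i => ((T i).tr f).comp (Pi.evalAddMonoidHom _ i)
  nm f := MonoidHom.pi fun i => ((T i).nm f).comp (Pi.evalMonoidHom _ i)
  res_id x := funext fun i => (T i).res_id (x i)
  tr_id x := funext fun i => (T i).tr_id (x i)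
  nm_id x := funext fun i => (T i).nm_id (x i)
  res_comp g f x := funext fun i => (T i).res_comp g f (x i)
  tr_comp g f x := funext fun i => (T i).tr_comp g f (x i)
  nm_comp g f x := funext fun i => (T i).nm_comp g f (x i)
  empty X h := ⟨fun x y => funext fun i => ((T i).empty X h).elim (x i) (y i)⟩
  coprod {X Y Z i j} h := by
    constructor
    · intro x y hxy
      funext k
      refine ((T k).coprod h).1 (Prod.ext ?_ ?_)
      · exact congrFun (congrArg Prod.fst hxy) k
      · exact congrFun (congrArg Prod.snd hxy) k
    · intro ⟨x, y⟩
      choose z hz using fun k => ((T k).coprod h).2 (x k, y k)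
      refine ⟨z, Prod.ext ?_ ?_⟩
      · exact funext fun k => congrArg Prod.fst (hz k)
      · exact funext fun k => congrArg Prod.snd (hz k)
  res_tr h x := funext fun i => (T i).res_tr h (x i)
  res_nm h x := funext fun i => (T i).res_nm h (x i)
  nm_tr h x := funext fun i => (T i).nm_tr h (x i)
  tr_mul_res f x y := funext fun i => (T i).tr_mul_res f (x i) (y i)

/-- The morphism into a product with given components. -/
def Hom.toPi {ι : Type} {S : TambaraFunctor.{u, w} G} {T : ι → TambaraFunctor.{u, w'} G}
    (φ : ∀ i, Hom S (T i)) : Hom S (pi T) where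
  app X := RingHom.pi fun i => (φ i).app X
  app_res f x := funext fun i => (φ i).app_res f x
  app_tr f x := funext fun i => (φ i).app_tr f x
  app_nm f x := funext fun i => (φ i).app_nm f x

end TambaraFunctor

namespace FinGSet

variable {G : Type u} [Group G]

/-- A finite `G`-set, regarded as an `H`-set. -/
def restrict (H : Subgroup G) (X : FinGSet.{u} G) : FinGSet.{u} H where
  carrier := X.carrier
  action := MulAction.compHom X.carrier H.subtype
  finite := X.finite

/-- An equivariant map, regarded as an `H`-equivariant map. -/
def restrictMap (H : Subgroup G) {X Y : FinGSet.{u} G} (f : X →[G] Y) :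
    X.restrict H →[H] Y.restrict H where
  toFun := f
  map_smul' h x := f.map_smul' (h : G) x

theorem IsPB.restrict (H : Subgroup G) {W X Y Z : FinGSet G} {a : W →[G] X} {b : W →[G] Y}
    {f : X →[G] Z} {g : Y →[G] Z} (h : IsPB a b f g) :
    IsPB (restrictMap H a) (restrictMap H b) (restrictMap H f) (restrictMap H g) :=
  ⟨h.comm, h.inj, h.surj⟩

theorem IsCoprod.restrict (H : Subgroup G) {X Y Z : FinGSet G} {i : X →[G] Z} {j : Y →[G] Z}
    (h : IsCoprod i j) : IsCoprod (restrictMap H i) (restrictMap H j) :=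
  ⟨h.inj_left, h.inj_right, h.disj, h.surj⟩

theorem IsExp.restrict (H : Subgroup G) {X Y A P E : FinGSet G} {f : X →[G] Y} {p : A →[G] X}
    {q : P →[G] Y} {e : E →[G] A} {r : E →[G] P} (h : IsExp f p q e r) :
    IsExp (restrictMap H f) (restrictMap H p) (restrictMap H q) (restrictMap H e)
      (restrictMap H r) :=
  ⟨h.pb.restrict H, h.inj, h.surj⟩

end FinGSet

namespace TambaraFunctor

variable {G : Type u} [Group G]

/-- The coinduction of an `H`-Tambara functor: `(CoInd T)(X) = T(Res X)`. -/
def coind (H : Subgroup G) (T : TambaraFunctor.{u, w} H) : TambaraFunctor.{u, w} G where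
  obj X := T.obj (X.restrict H)
  res f := T.res (restrictMap H f)
  tr f := T.tr (restrictMap H f)
  nm f := T.nm (restrictMap H f)
  res_id x := T.res_id x
  tr_id x := T.tr_id x
  nm_id x := T.nm_id x
  res_comp g f x := T.res_comp (restrictMap H g) (restrictMap H f) x
  tr_comp g f x := T.tr_comp (restrictMap H g) (restrictMap H f) x
  nm_comp g f x := T.nm_comp (restrictMap H g) (restrictMap H f) x
  empty X h := T.empty (X.restrict H) h
  coprod h := T.coprod (h.restrict H)
  res_tr h x := T.res_tr (h.restrict H) x
  res_nm h x := T.res_nm (h.restrict H) x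
  nm_tr h x := T.nm_tr (h.restrict H) x
  tr_mul_res f x y := T.tr_mul_res (restrictMap H f) x y

end TambaraFunctor

section Constant

/-- Iterated products over fibres. -/
@[to_additive]
theorem finprod_fib_comp {X Y Z : Type u} {M : Type v} [CommMonoid M] [Finite X] [Finite Y]
    (f : X → Y) (g : Y → Z) (φ : X → M) (z : Z) :
    ∏ᶠ x : {x // g (f x) = z}, φ x = ∏ᶠ y : {y // g y = z}, ∏ᶠ x : {x // f x = y}, φ x := by
  classical
  have := Fintype.ofFinite X
  have := Fintype.ofFinite Y
  simp only [finprod_eq_prod_of_fintype]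
  rw [← Fintype.prod_sigma' (fun (y : {y // g y = z}) (x : {x // f x = (y : Y)}) => φ x)]
  refine Fintype.prod_equiv
    ⟨fun x => ⟨⟨f x, x.2⟩, ⟨x, rfl⟩⟩, fun s => ⟨s.2, by rw [s.2.2]; exact s.1.2⟩,
      fun x => rfl, ?_⟩ _ _ (fun x => rfl)
  rintro ⟨⟨y, hy⟩, ⟨x, hx⟩⟩
  change f x = y at hx
  subst hx
  rfl

variable {G : Type u} [Group G] {F : Type v} [CommRing F]

/-- The fibres of a pullback. -/
theorem fib_pb_bijective {W X Y Z : FinGSet.{u} G} {a : W →[G] X}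
    {b : W →[G] Y} {f : X →[G] Z} {g : Y →[G] Z} (h : IsPB a b f g) (y : Y) :
    Function.Bijective (fun t : {t // b t = y} =>
      (⟨a t, by rw [h.comm, t.2]⟩ : {x // f x = g y})) := by
  constructor
  · rintro ⟨t, ht⟩ ⟨t', ht'⟩ hh
    exact Subtype.ext (h.inj _ _ (congrArg Subtype.val hh) (ht.trans ht'.symm))
  · rintro ⟨x, hx⟩
    obtain ⟨t, rfl, ht⟩ := h.surj x y hx
    exact ⟨⟨t, ht⟩, rfl⟩

/-- The action permutes the fibres of an equivariant map. -/
theorem fib_smul_bijective {X Y : FinGSet.{u} G} (f : X →[G] Y) (g : G) (y : Y) :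
    Function.Bijective (fun x : {x // f x = y} =>
      (⟨g • (x : X), by rw [map_smul, x.2]⟩ : {x // f x = g • y})) := by
  constructor
  · rintro ⟨x, hx⟩ ⟨x', hx'⟩ hh
    exact Subtype.ext (MulAction.injective g (congrArg Subtype.val hh))
  · rintro ⟨x, hx⟩
    exact ⟨⟨g⁻¹ • x, by rw [map_smul, hx, inv_smul_smul]⟩, Subtype.ext (smul_inv_smul g x)⟩

/-- The distributive law for functions, along an exponential diagram. -/
theorem finprod_finsum_exp {X Y A P E : FinGSet.{u} G} {f : X →[G] Y} {p : A →[G] X}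
    {q : P →[G] Y} {e : E →[G] A} {r : E →[G] P} (h : IsExp f p q e r) (φ : A → F) (y : Y) :
    ∏ᶠ x : {x // f x = y}, ∑ᶠ a : {a // p a = x}, φ a =
      ∑ᶠ t : {t // q t = y}, ∏ᶠ z : {z // r z = t}, φ (e z) := by
  classical
  have := Fintype.ofFinite X
  have := Fintype.ofFinite A
  have key : ∏ᶠ x : {x // f x = y}, ∑ᶠ a : {a // p a = x}, φ a =
      ∑ᶠ s : (∀ x : {x // f x = y}, {a // p a = x}), ∏ᶠ x : {x // f x = y}, φ (s x) := by
    simp only [finprod_eq_prod_of_fintype, finsum_eq_sum_of_fintype]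
    rw [Finset.prod_univ_sum, Fintype.piFinset_univ]
  rw [key]
  have hx : ∀ (t : {t // q t = y}) (x : {x // f x = y}), ∃ z, p (e z) = x ∧ r z = t := by
    intro t x
    exact h.pb.surj x t (x.2.trans t.2.symm)
  choose z hz hz' using hx
  symm
  refine finsum_eq_of_bijective (fun t x => ⟨e (z t x), hz t x⟩) ⟨?_, ?_⟩ ?_
  · intro t t' htt
    refine Subtype.ext (h.inj _ _ (t.2.trans t'.2.symm) ?_)
    intro z1 z2 h1 h2 h12
    have hy : f (p (e z1)) = y := (h.pb.comm z1).trans ((congrArg q h1).trans t.2)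
    have e1 : z1 = z t ⟨_, hy⟩ := h.pb.inj _ _ (hz t ⟨_, hy⟩).symm (h1.trans (hz' t _).symm)
    have e2 : z2 = z t' ⟨_, hy⟩ :=
      h.pb.inj _ _ (h12.symm.trans (hz t' ⟨_, hy⟩).symm) (h2.trans (hz' t' _).symm)
    rw [e1, e2]
    exact congrArg Subtype.val (congrFun htt ⟨_, hy⟩)
  · intro s
    obtain ⟨t, ht, hs⟩ := h.surj y (fun x => s x) (fun x => (s x).2)
    refine ⟨⟨t, ht⟩, funext fun x => Subtype.ext ?_⟩
    exact hs _ x (hz' ⟨t, ht⟩ x) (hz ⟨t, ht⟩ x)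
  · intro t
    refine (finprod_eq_of_bijective
      (fun x => (⟨z t x, hz' t x⟩ : {w // r w = (t : P)})) ⟨?_, ?_⟩ (fun x => rfl)).symm
    · intro x x' hxx
      refine Subtype.ext ?_
      rw [← hz t x, ← hz t x']
      exact congrArg (fun w : {w // r w = t} => p (e w)) hxx
    · rintro ⟨w, hw⟩
      have hy : f (p (e w)) = y := (h.pb.comm w).trans ((congrArg q hw).trans t.2)
      exact ⟨⟨_, hy⟩, Subtype.ext (h.pb.inj _ _ (hz t ⟨_, hy⟩) ((hz' t _).trans hw.symm))⟩

variable (F) in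
/-- The ring of `G`-invariant functions `X → F`. -/
def invFun (X : FinGSet.{u} G) : Subring (X → F) where
  carrier := {φ | ∀ (g : G) x, φ (g • x) = φ x}
  mul_mem' h h' g x := by simp [h g x, h' g x]
  one_mem' g x := rfl
  add_mem' h h' g x := by simp [h g x, h' g x]
  zero_mem' g x := rfl
  neg_mem' h g x := by simp [h g x]

variable (G F) in
/-- The constant Tambara functor at `F`: its value at `X` is the ring of `G`-invariant functions
`X → F`, restrictions are given by composition, transfers by summing over fibres and norms by
multiplying over fibres. Its value at each orbit `G/H` is `F`. -/
noncomputable def TambaraFunctor.const : TambaraFunctor.{u, max u v} G where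
  obj X := invFun F X
  res {X Y} f :=
    { toFun := fun φ => ⟨fun x => φ.1 (f x), fun g x =>
        (congrArg φ.1 (map_smul f g x)).trans (φ.2 g (f x))⟩
      map_one' := rfl
      map_mul' := fun _ _ => rfl
      map_zero' := rfl
      map_add' := fun _ _ => rfl }
  tr {X Y} f :=
    { toFun := fun φ => ⟨fun y => ∑ᶠ x : {x // f x = y}, φ.1 x, fun g y =>
        (finsum_eq_of_bijective _ (fib_smul_bijective f g y) fun x => (φ.2 g x).symm).symm⟩
      map_zero' := Subtype.ext (funext fun y => finsum_zero)
      map_add' := fun φ ψ => Subtype.ext (funext fun y =>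
        finsum_add_distrib (Set.toFinite _) (Set.toFinite _)) }
  nm {X Y} f :=
    { toFun := fun φ => ⟨fun y => ∏ᶠ x : {x // f x = y}, φ.1 x, fun g y =>
        (finprod_eq_of_bijective _ (fib_smul_bijective f g y) fun x => (φ.2 g x).symm).symm⟩
      map_one' := Subtype.ext (funext fun y => finprod_one)
      map_mul' := fun φ ψ => Subtype.ext (funext fun y =>
        finprod_mul_distrib (Set.toFinite _) (Set.toFinite _)) }
  res_id φ := rfl
  tr_id {X} φ := Subtype.ext (funext fun y => by
    have : Unique {x : X // (MulActionHom.id G) x = y} := ⟨⟨⟨y, rfl⟩⟩, fun a => Subtype.ext a.2⟩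
    exact (finsum_unique fun x : {x : X // (MulActionHom.id G) x = y} => φ.1 x).trans
      (congrArg φ.1 (default : {x : X // (MulActionHom.id G) x = y}).2))
  nm_id {X} φ := Subtype.ext (funext fun y => by
    have : Unique {x : X // (MulActionHom.id G) x = y} := ⟨⟨⟨y, rfl⟩⟩, fun a => Subtype.ext a.2⟩
    exact (finprod_unique fun x : {x : X // (MulActionHom.id G) x = y} => φ.1 x).trans
      (congrArg φ.1 (default : {x : X // (MulActionHom.id G) x = y}).2))
  res_comp g f φ := rfl
  tr_comp g f φ := Subtype.ext (funext fun z => finsum_fib_comp f g φ.1 z)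
  nm_comp g f φ := Subtype.ext (funext fun z => finprod_fib_comp f g φ.1 z)
  empty X h := ⟨fun φ ψ => Subtype.ext (funext fun x => h.elim x)⟩
  coprod {X Y Z i j} h := by
    constructor
    · intro φ ψ hh
      refine Subtype.ext (funext fun z => ?_)
      obtain ⟨x, rfl⟩ | ⟨y, rfl⟩ := h.surj z
      · exact congrFun (congrArg (fun w => w.1.1) hh) x
      · exact congrFun (congrArg (fun w => w.2.1) hh) y
    · rintro ⟨φ, ψ⟩
      classical
      have hi : ∀ z, (∃ c : F, (∀ x, i x = z → c = φ.1 x) ∧ ∀ y, j y = z → c = ψ.1 y) := by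
        intro z
        obtain ⟨x, rfl⟩ | ⟨y, rfl⟩ := h.surj z
        · exact ⟨φ.1 x, fun x' hx => by rw [h.inj_left hx],
            fun y hy => (h.disj _ _ hy.symm).elim⟩
        · exact ⟨ψ.1 y, fun x hx => (h.disj _ _ hx).elim, fun y' hy => by rw [h.inj_right hy]⟩
      choose c hc hc' using hi
      refine ⟨⟨c, fun g z => ?_⟩, Prod.ext ?_ ?_⟩
      · obtain ⟨x, rfl⟩ | ⟨y, rfl⟩ := h.surj z
        · rw [hc (i x) x rfl, hc (g • i x) (g • x) (map_smul i g x)]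
          exact φ.2 g x
        · rw [hc' (j y) y rfl, hc' (g • j y) (g • y) (map_smul j g y)]
          exact ψ.2 g y
      · exact Subtype.ext (funext fun x => hc (i x) x rfl)
      · exact Subtype.ext (funext fun y => hc' (j y) y rfl)
  res_tr h φ := Subtype.ext (funext fun y => 
    (finsum_eq_of_bijective _ (fib_pb_bijective h y) fun t => rfl).symm)
  res_nm h φ := Subtype.ext (funext fun y => 
    (finprod_eq_of_bijective _ (fib_pb_bijective h y) fun t => rfl).symm)
  nm_tr h φ := Subtype.ext (funext fun y => finprod_finsum_exp h φ.1 y)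
  tr_mul_res {X Y} f φ ψ := Subtype.ext (funext fun y => by
    refine Eq.trans ?_ (finsum_mul' (fun x : {x // f x = y} => φ.1 x) (ψ.1 y)
      (Set.toFinite _)).symm
    exact finsum_congr fun x => congrArg (fun c => φ.1 x * ψ.1 c) x.2)

variable (G F) in
/-- The canonical map from the constant `G`-Tambara functor at `F` to the coinduction of the
constant `H`-Tambara functor at `F`: it regards a `G`-invariant function as an `H`-invariant one. -/
noncomputable def TambaraFunctor.constToCoind (H : Subgroup G) :
    TambaraFunctor.Hom (TambaraFunctor.const.{u, v} G F)
      (TambaraFunctor.coind H (TambaraFunctor.const.{u, v} H F)) where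
  app _ :=
    { toFun := fun φ => ⟨φ.1, fun h x => φ.2 (h : G) x⟩
      map_one' := rfl
      map_mul' := fun _ _ => rfl
      map_zero' := rfl
      map_add' := fun _ _ => rfl }
  app_res _ _ := rfl
  app_tr _ _ := rfl
  app_nm _ _ := rfl

end Constant

namespace TambaraFunctor

variable {G : Type u} [Group G]

/-- A module over a Tambara functor `k`, that is, over its underlying Green functor: a Mackey
functor `M` with `k(X)`-module structures on the groups `M(X)`, such that restrictions are
semilinear and transfers satisfy Frobenius reciprocity. -/
structure Mod (k : TambaraFunctor.{u, w} G) : Type (max (u + 1) w (w' + 1)) where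
  obj : FinGSet.{u} G → Type w'
  [grp : ∀ X, AddCommGroup (obj X)]
  [mod : ∀ X, Module (k.obj X) (obj X)]
  res : ∀ {X Y : FinGSet G}, (X →[G] Y) → obj Y →+ obj X
  tr : ∀ {X Y : FinGSet G}, (X →[G] Y) → obj X →+ obj Y
  res_id : ∀ {X : FinGSet G} (x : obj X), res (MulActionHom.id G) x = x
  tr_id : ∀ {X : FinGSet G} (x : obj X), tr (MulActionHom.id G) x = x
  res_comp : ∀ {X Y Z : FinGSet G} (g : Y →[G] Z) (f : X →[G] Y) (x : obj Z),
    res (g.comp f) x = res f (res g x)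
  tr_comp : ∀ {X Y Z : FinGSet G} (g : Y →[G] Z) (f : X →[G] Y) (x : obj X),
    tr (g.comp f) x = tr g (tr f x)
  empty : ∀ X : FinGSet G, IsEmpty X → Subsingleton (obj X)
  coprod : ∀ {X Y Z : FinGSet G} {i : X →[G] Z} {j : Y →[G] Z}, IsCoprod i j →
    Function.Bijective fun z : obj Z => (res i z, res j z)
  res_tr : ∀ {W X Y Z : FinGSet G} {a : W →[G] X} {b : W →[G] Y} {f : X →[G] Z} {g : Y →[G] Z},
    IsPB a b f g → ∀ x, res g (tr f x) = tr b (res a x)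
  res_smul : ∀ {X Y : FinGSet G} (f : X →[G] Y) (c : k.obj Y) (x : obj Y),
    res f (c • x) = k.res f c • res f x
  tr_res_smul : ∀ {X Y : FinGSet G} (f : X →[G] Y) (c : k.obj Y) (x : obj X),
    tr f (k.res f c • x) = c • tr f x
  tr_smul_res : ∀ {X Y : FinGSet G} (f : X →[G] Y) (c : k.obj X) (x : obj Y),
    tr f (c • res f x) = k.tr f c • x

attribute [instance] Mod.grp Mod.mod

/-- A morphism of modules. -/
structure Mod.Hom {k : TambaraFunctor.{u, w} G} (M : Mod.{u, w, v} k) (N : Mod.{u, w, w'} k) where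
  app : ∀ X : FinGSet.{u} G, M.obj X →ₗ[k.obj X] N.obj X
  app_res : ∀ {X Y : FinGSet G} (f : X →[G] Y) (x : M.obj Y), app X (M.res f x) = N.res f (app Y x)
  app_tr : ∀ {X Y : FinGSet G} (f : X →[G] Y) (x : M.obj X), app Y (M.tr f x) = N.tr f (app X x)

/-- A submodule. -/
structure Mod.Sub {k : TambaraFunctor.{u, w} G} (M : Mod.{u, w, w'} k) where
  carrier : ∀ X : FinGSet.{u} G, Submodule (k.obj X) (M.obj X)
  res_mem : ∀ {X Y : FinGSet G} (f : X →[G] Y) (x : M.obj Y), x ∈ carrier Y →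
    M.res f x ∈ carrier X
  tr_mem : ∀ {X Y : FinGSet G} (f : X →[G] Y) (x : M.obj X), x ∈ carrier X →
    M.tr f x ∈ carrier Y

/-- A module is finitely generated if there are finitely many elements `mᵢ ∈ M(Xᵢ)` which are not
all contained in a proper submodule. -/
def Mod.FG {k : TambaraFunctor.{u, w} G} (M : Mod.{u, w, w'} k) : Prop :=
  ∃ (n : ℕ) (X : Fin n → FinGSet.{u} G) (m : ∀ i, M.obj (X i)),
    ∀ N : M.Sub, (∀ i, m i ∈ N.carrier (X i)) → ∀ Y, N.carrier Y = ⊤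

/-- The `k`-module underlying a `k`-algebra `η : k → R`. -/
def Hom.toMod {k : TambaraFunctor.{u, w} G} {R : TambaraFunctor.{u, w'} G} (η : Hom k R) :
    Mod.{u, w, w'} k where
  obj := R.obj
  mod X := Module.compHom (R.obj X) (η.app X)
  res f := (R.res f).toAddMonoidHom
  tr f := R.tr f
  res_id := R.res_id
  tr_id := R.tr_id
  res_comp := R.res_comp
  tr_comp := R.tr_comp
  empty := R.empty
  coprod := R.coprod
  res_tr := R.res_tr
  res_smul f c x := by
    change R.res f (η.app _ c * x) = η.app _ (k.res f c) * R.res f x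
    rw [map_mul, η.app_res]
  tr_res_smul f c x := by
    change R.tr f (η.app _ (k.res f c) * x) = η.app _ c * R.tr f x
    rw [η.app_res, mul_comm, R.tr_mul_res, mul_comm]
  tr_smul_res f c x := by
    change R.tr f (η.app _ c * R.res f x) = η.app _ (k.tr f c) * x
    rw [η.app_tr, R.tr_mul_res]

/-- A morphism `k → R` is finite if `R` is a finitely generated `k`-module. -/
def Hom.IsFinite {k : TambaraFunctor.{u, w} G} {R : TambaraFunctor.{u, w'} G} (η : Hom k R) :
    Prop :=
  η.toMod.FG

/-- The `k`-algebra `P`, with elements `xᵢ ∈ P(Xᵢ)`, is a free polynomial `k`-algebra on the finite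
`G`-sets `Xᵢ`: it represents the functor which sends a `k`-algebra `S` to the set of families of
elements of the `S(Xᵢ)`. -/
def Hom.IsFreeOn {k P : TambaraFunctor.{u, w} G} (η : Hom k P) {n : ℕ}
    (X : Fin n → FinGSet.{u} G) (x : ∀ i, P.obj (X i)) : Prop :=
  ∀ (S : TambaraFunctor.{u, w} G) (σ : Hom k S) (s : ∀ i, S.obj (X i)),
    ∃! φ : Hom P S, φ.comp η = σ ∧ ∀ i, φ.app (X i) (x i) = s i

/-- The `k`-algebra `π : P → R` is a coequalizer of `α, β : Q → P` in the category of
`k`-algebras. -/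
def IsCoequalizer {k Q P R : TambaraFunctor.{u, w} G} (κ : Hom k P) (η : Hom k R)
    (α β : Hom Q P) (π : Hom P R) : Prop :=
  π.comp α = π.comp β ∧
    ∀ (S : TambaraFunctor.{u, w} G) (σ : Hom k S) (φ : Hom P S), φ.comp κ = σ →
      φ.comp α = φ.comp β → ∃! ψ : Hom R S, ψ.comp η = σ ∧ ψ.comp π = φ

/-- A `k`-algebra is finitely presented if it is a coequalizer of two morphisms of `k`-algebras
between free polynomial `k`-algebras on finitely many generators. -/
def Hom.IsFinPres {k R : TambaraFunctor.{u, w} G} (η : Hom k R) : Prop :=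
  ∃ (Q P : TambaraFunctor.{u, w} G) (ι : Hom k Q) (κ : Hom k P)
    (m : ℕ) (Y : Fin m → FinGSet.{u} G) (y : ∀ i, Q.obj (Y i))
    (n : ℕ) (X : Fin n → FinGSet.{u} G) (x : ∀ i, P.obj (X i))
    (α β : Hom Q P) (π : Hom P R),
    ι.IsFreeOn Y y ∧ κ.IsFreeOn X x ∧ α.comp ι = κ ∧ β.comp ι = κ ∧ π.comp κ = η ∧
      IsCoequalizer κ η α β π

end TambaraFunctor

namespace FinGSet

variable {G : Type u} [Group G]

/-- Disjoint unions of finite `G`-sets. -/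
def sum (X Y : FinGSet.{u} G) : FinGSet.{u} G where
  carrier := X ⊕ Y
  action :=
    { smul := fun g => Sum.map (g • ·) (g • ·)
      one_smul := by rintro (x | x) <;> exact congrArg _ (one_smul G x)
      mul_smul := by rintro g h (x | x) <;> exact congrArg _ (mul_smul g h x) }

/-- The left inclusion. -/
def inl (X Y : FinGSet.{u} G) : X →[G] sum X Y := ⟨Sum.inl, fun _ _ => rfl⟩

/-- The right inclusion. -/
def inr (X Y : FinGSet.{u} G) : Y →[G] sum X Y := ⟨Sum.inr, fun _ _ => rfl⟩

/-- The map out of a disjoint union. -/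
def desc {X Y Z : FinGSet.{u} G} (f : X →[G] Z) (g : Y →[G] Z) : sum X Y →[G] Z :=
  ⟨Sum.elim f g, by rintro m (x | x); exacts [map_smul f m x, map_smul g m x]⟩

theorem isCoprod_sum (X Y : FinGSet.{u} G) : IsCoprod (inl X Y) (inr X Y) where
  inj_left := Sum.inl_injective
  inj_right := Sum.inr_injective
  disj _ _ h := Sum.inl_ne_inr h
  surj := by rintro (x | y); exacts [Or.inl ⟨x, rfl⟩, Or.inr ⟨y, rfl⟩]

/-- The empty `G`-set. -/
def emp (G : Type u) [Group G] : FinGSet.{u} G where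
  carrier := PEmpty
  action :=
    { smul := fun _ x => x
      one_smul := fun x => x.elim
      mul_smul := fun _ _ x => x.elim }

instance : IsEmpty (emp G) := inferInstanceAs (IsEmpty PEmpty)

/-- The map out of the empty `G`-set. -/
def ofEmp (X : FinGSet.{u} G) : emp G →[G] X := ⟨PEmpty.elim, fun _ x => x.elim⟩

/-- Pullbacks of finite `G`-sets. -/
def pb {X Y Z : FinGSet.{u} G} (f : X →[G] Z) (g : Y →[G] Z) : FinGSet.{u} G where
  carrier := {t : X × Y // f t.1 = g t.2}
  action :=
    { smul := fun m t => ⟨(m • t.1.1, m • t.1.2), by rw [map_smul, map_smul, t.2]⟩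
      one_smul := fun t => Subtype.ext (Prod.ext (one_smul G _) (one_smul G _))
      mul_smul := fun m n t => Subtype.ext (Prod.ext (mul_smul m n _) (mul_smul m n _)) }

/-- The first projection. -/
def pbFst {X Y Z : FinGSet.{u} G} (f : X →[G] Z) (g : Y →[G] Z) : pb f g →[G] X :=
  ⟨fun t => t.1.1, fun _ _ => rfl⟩

/-- The second projection. -/
def pbSnd {X Y Z : FinGSet.{u} G} (f : X →[G] Z) (g : Y →[G] Z) : pb f g →[G] Y :=
  ⟨fun t => t.1.2, fun _ _ => rfl⟩

theorem isPB_pb {X Y Z : FinGSet.{u} G} (f : X →[G] Z) (g : Y →[G] Z) :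
    IsPB (pbFst f g) (pbSnd f g) f g where
  comm t := t.2
  inj _ _ h h' := Subtype.ext (Prod.ext h h')
  surj x y h := ⟨⟨(x, y), h⟩, rfl, rfl⟩

/-- The dependent product of `p : A → X` along `f : X → Y`: pairs of a point `y : Y` and a section
of `p` over the fibre of `f` at `y`, given by its image. The group acts by conjugation. -/
def dprod {X Y A : FinGSet.{u} G} (f : X →[G] Y) (p : A →[G] X) : FinGSet.{u} G where
  carrier := {t : Y × Set A // (∀ a ∈ t.2, f (p a) = t.1) ∧
    ∀ x, f x = t.1 → ∃! a, a ∈ t.2 ∧ p a = x}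
  action :=
    { smul := fun g t => ⟨(g • t.1.1, {a | g⁻¹ • a ∈ t.1.2}), by
        refine ⟨fun a ha => ?_, fun x hx => ?_⟩
        · have := t.2.1 _ ha
          rw [map_smul, map_smul, inv_smul_eq_iff] at this
          exact this
        · obtain ⟨a, ⟨ha, ha'⟩, hu⟩ := t.2.2 (g⁻¹ • x) (by rw [map_smul, inv_smul_eq_iff]; exact hx)
          refine ⟨g • a, ⟨by simpa using ha, by rw [map_smul, ha', smul_inv_smul]⟩, ?_⟩
          rintro b ⟨hb, hb'⟩
          rw [← hu (g⁻¹ • b) ⟨hb, by rw [map_smul, hb']⟩, smul_inv_smul]⟩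
      one_smul := fun t => Subtype.ext (Prod.ext (one_smul G _) (Set.ext fun a => by
        change (1 : G)⁻¹ • a ∈ t.1.2 ↔ _
        simp))
      mul_smul := fun g h t => Subtype.ext (Prod.ext (mul_smul g h _) (Set.ext fun a => by
        change (g * h)⁻¹ • a ∈ t.1.2 ↔ h⁻¹ • g⁻¹ • a ∈ t.1.2
        rw [mul_inv_rev, mul_smul])) }

/-- The projection of the dependent product. -/
def dprodMap {X Y A : FinGSet.{u} G} (f : X →[G] Y) (p : A →[G] X) : dprod f p →[G] Y :=
  ⟨fun t => t.1.1, fun _ _ => rfl⟩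

/-- Points of a dependent product together with a point of the section. -/
def dprodEv {X Y A : FinGSet.{u} G} (f : X →[G] Y) (p : A →[G] X) : FinGSet.{u} G where
  carrier := {z : A × dprod f p // z.1 ∈ z.2.1.2}
  action :=
    { smul := fun g z => ⟨(g • z.1.1, g • z.1.2), by
        change g⁻¹ • g • z.1.1 ∈ z.1.2.1.2
        rw [inv_smul_smul]
        exact z.2⟩
      one_smul := fun t => Subtype.ext (Prod.ext (one_smul G _) (one_smul G _))
      mul_smul := fun m n t => Subtype.ext (Prod.ext (mul_smul m n _) (mul_smul m n _)) }

/-- The evaluation map of a dependent product. -/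
def dprodE {X Y A : FinGSet.{u} G} (f : X →[G] Y) (p : A →[G] X) : dprodEv f p →[G] A :=
  ⟨fun z => z.1.1, fun _ _ => rfl⟩

/-- The projection of the evaluation set to the dependent product. -/
def dprodR {X Y A : FinGSet.{u} G} (f : X →[G] Y) (p : A →[G] X) : dprodEv f p →[G] dprod f p :=
  ⟨fun z => z.1.2, fun _ _ => rfl⟩

theorem isExp_dprod {X Y A : FinGSet.{u} G} (f : X →[G] Y) (p : A →[G] X) :
    IsExp f p (dprodMap f p) (dprodE f p) (dprodR f p) where
  pb :=
    { comm := fun z => z.1.2.2.1 _ z.2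
      inj := by
        rintro ⟨⟨a, t⟩, h⟩ ⟨⟨a', t'⟩, h'⟩ h1 h2
        change p a = p a' at h1
        change t = t' at h2
        subst h2
        have := (t.2.2 (p a) (t.2.1 _ h)).unique ⟨h, rfl⟩ ⟨h', h1.symm⟩
        exact Subtype.ext (Prod.ext this rfl)
      surj := by
        intro x t h
        obtain ⟨a, ⟨ha, hx⟩, -⟩ := t.2.2 x h
        exact ⟨⟨(a, t), ha⟩, hx, rfl⟩ }
  inj := by
    have key : ∀ t t' : dprod f p, dprodMap f p t = dprodMap f p t' →
        (∀ z z', dprodR f p z = t → dprodR f p z' = t' → p (dprodE f p z) = p (dprodE f p z') →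
          dprodE f p z = dprodE f p z') → ∀ a, a ∈ t.1.2 → a ∈ t'.1.2 := by
      intro t t' h1 h2 a ha
      obtain ⟨a', ⟨ha', hx⟩, -⟩ := t'.2.2 (p a) ((t.2.1 _ ha).trans h1)
      have := h2 ⟨(a, t), ha⟩ ⟨(a', t'), ha'⟩ rfl rfl hx.symm
      change a = a' at this
      rwa [this]
    intro t t' h1 h2
    refine Subtype.ext (Prod.ext h1 (Set.ext fun a => ⟨key t t' h1 h2 a, ?_⟩))
    exact key t' t h1.symm (fun z z' h h' h'' => (h2 z' z h' h h''.symm).symm) a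
  surj := by
    intro y s hs
    refine ⟨⟨(y, Set.range s), ?_, ?_⟩, rfl, ?_⟩
    · rintro _ ⟨x, rfl⟩
      rw [hs]
      exact x.2
    · intro x hx
      refine ⟨s ⟨x, hx⟩, ⟨⟨_, rfl⟩, hs _⟩, ?_⟩
      rintro _ ⟨⟨x', rfl⟩, h⟩
      rw [hs] at h
      exact congrArg s (Subtype.ext h)
    · rintro ⟨⟨a, t⟩, ha⟩ x h h'
      change t = _ at h
      subst h
      obtain ⟨x', hx'⟩ := ha
      change s x' = a at hx'
      subst hx'
      change p (s x') = x at h'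
      rw [hs] at h'
      exact congrArg s (Subtype.ext h')

end FinGSet

namespace FinGSet

variable {G : Type u} [Group G]

theorem IsCoprod.symm {X Y Z : FinGSet.{u} G} {i : X →[G] Z} {j : Y →[G] Z} (h : IsCoprod i j) :
    IsCoprod j i :=
  ⟨h.inj_right, h.inj_left, fun y x e => h.disj x y e.symm, fun z => (h.surj z).symm⟩

theorem IsPB.symm {W X Y Z : FinGSet.{u} G} {a : W →[G] X} {b : W →[G] Y} {f : X →[G] Z}
    {g : Y →[G] Z} (h : IsPB a b f g) : IsPB b a g f :=
  ⟨fun t => (h.comm t).symm, fun t t' e e' => h.inj t t' e' e, fun y x e => by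
    obtain ⟨t, ht, ht'⟩ := h.surj x y e.symm
    exact ⟨t, ht', ht⟩⟩

theorem isPB_id_id {X Z : FinGSet.{u} G} (f : X →[G] Z) :
    IsPB (MulActionHom.id G) f f (MulActionHom.id G) :=
  ⟨fun _ => rfl, fun _ _ h _ => h, fun x _ h => ⟨x, rfl, h⟩⟩

theorem isPB_inj {X Z : FinGSet.{u} G} {f : X →[G] Z} (hf : Function.Injective f) :
    IsPB (MulActionHom.id G) (MulActionHom.id G) f f :=
  ⟨fun _ => rfl, fun _ _ h _ => h, fun x _ h => ⟨x, rfl, hf h⟩⟩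

/-- Pasting of pullback squares. -/
theorem IsPB.paste {W X Y Z V U : FinGSet.{u} G} {a : W →[G] X} {b : W →[G] Y} {f : X →[G] Z}
    {g : Y →[G] Z} (h : IsPB a b f g) {c : V →[G] W} {d : V →[G] U} {k : U →[G] Y}
    (h' : IsPB c d b k) : IsPB (a.comp c) d f (g.comp k) :=
  ⟨fun t => (h.comm _).trans (congrArg g (h'.comm t)), fun t t' e e' =>
    h'.inj _ _ (h.inj _ _ e ((h'.comm t).trans ((congrArg k e').trans (h'.comm t').symm))) e',
    fun x y e => by
      obtain ⟨t, ht, ht'⟩ := h.surj x (k y) e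
      obtain ⟨s, hs, hs'⟩ := h'.surj t y ht'
      exact ⟨s, (congrArg a hs).trans ht, hs'⟩⟩

/-- Cancellation for pullback squares. -/
theorem IsPB.cancel {W X Y Z V U : FinGSet.{u} G} {a : W →[G] X} {b : W →[G] Y} {f : X →[G] Z}
    {g : Y →[G] Z} (h : IsPB a b f g) {c : V →[G] W} {d : V →[G] U} {k : U →[G] Y}
    {ac : V →[G] X} (hac : ∀ t, a (c t) = ac t) (hc : ∀ t, b (c t) = k (d t))
    (h' : IsPB ac d f (g.comp k)) : IsPB c d b k :=
  ⟨hc, fun t t' e e' => h'.inj _ _ (by rw [← hac, ← hac, e]) e', fun x y e => by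
    obtain ⟨t, ht, ht'⟩ := h'.surj (a x) y ((h.comm x).trans (congrArg g e))
    refine ⟨t, h.inj _ _ ((hac t).trans ht) ?_, ht'⟩
    rw [hc, ht', e]⟩

/-- The map induced on pullbacks. -/
def pbLift {W X Y Z : FinGSet.{u} G} {f : X →[G] Z} {g : Y →[G] Z} (a : W →[G] X) (b : W →[G] Y)
    (h : ∀ t, f (a t) = g (b t)) : W →[G] pb f g :=
  ⟨fun t => ⟨(a t, b t), h t⟩, fun m t =>
    Subtype.ext (Prod.ext (map_smul a m t) (map_smul b m t))⟩

theorem IsPB.pbLift_bijective {W X Y Z : FinGSet.{u} G} {a : W →[G] X} {b : W →[G] Y}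
    {f : X →[G] Z} {g : Y →[G] Z} (h : IsPB a b f g) :
    Function.Bijective (pbLift a b h.comm) := by
  constructor
  · intro t t' e
    exact h.inj _ _ (congrArg (fun s => s.1.1) e) (congrArg (fun s => s.1.2) e)
  · rintro ⟨⟨x, y⟩, e⟩
    obtain ⟨t, rfl, rfl⟩ := h.surj x y e
    exact ⟨t, rfl⟩

theorem IsCoprod.desc_bijective {X Y Z : FinGSet.{u} G} {i : X →[G] Z} {j : Y →[G] Z}
    (h : IsCoprod i j) : Function.Bijective (desc i j) := by
  constructor
  · rintro (x | y) (x' | y') e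
    · exact congrArg _ (h.inj_left e)
    · exact (h.disj _ _ e).elim
    · exact (h.disj _ _ (Eq.symm e)).elim
    · exact congrArg _ (h.inj_right e)
  · intro z
    obtain ⟨x, rfl⟩ | ⟨y, rfl⟩ := h.surj z
    · exact ⟨Sum.inl x, rfl⟩
    · exact ⟨Sum.inr y, rfl⟩

/-- Pullbacks preserve disjoint unions. -/
theorem IsCoprod.pullback {X Y Z T : FinGSet.{u} G} {i : X →[G] Z} {j : Y →[G] Z}
    (h : IsCoprod i j) {X' Y' : FinGSet.{u} G} {u : T →[G] Z} {a : X' →[G] X} {i' : X' →[G] T}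
    {b : Y' →[G] Y} {j' : Y' →[G] T} (hi : IsPB a i' i u) (hj : IsPB b j' j u) :
    IsCoprod i' j' where
  inj_left t t' e := hi.inj _ _ (h.inj_left (by rw [hi.comm, hi.comm, e])) e
  inj_right t t' e := hj.inj _ _ (h.inj_right (by rw [hj.comm, hj.comm, e])) e
  disj t t' e := h.disj (a t) (b t') (by rw [hi.comm, hj.comm, e])
  surj t := by
    obtain ⟨x, hx⟩ | ⟨y, hy⟩ := h.surj (u t)
    · obtain ⟨s, -, hs⟩ := hi.surj x t hx
      exact Or.inl ⟨s, hs⟩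
    · obtain ⟨s, -, hs⟩ := hj.surj y t hy
      exact Or.inr ⟨s, hs⟩

theorem exists_inverse {X Y : FinGSet.{u} G} {f : X →[G] Y} (hf : Function.Bijective f) :
    ∃ g : Y →[G] X, (∀ y, f (g y) = y) ∧ ∀ x, g (f x) = x := by
  obtain ⟨g, h1, h2⟩ := Function.bijective_iff_has_inverse.1 hf
  refine ⟨⟨g, fun m y => hf.1 ?_⟩, h2, h1⟩
  rw [h2, map_smul]
  exact congrArg _ (h2 y).symm

end FinGSet

namespace TambaraFunctor

variable {G : Type u} [Group G] {k : TambaraFunctor.{u, w} G}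

namespace Mod

variable (M : Mod.{u, w, v} k)

theorem res_res {X Y Z : FinGSet.{u} G} (g : Y →[G] Z) (f : X →[G] Y) (h : X →[G] Z)
    (e : ∀ t, h t = g (f t)) (x : M.obj Z) : M.res f (M.res g x) = M.res h x := by
  rw [← M.res_comp, show h = g.comp f from MulActionHom.ext e]

theorem tr_tr {X Y Z : FinGSet.{u} G} (g : Y →[G] Z) (f : X →[G] Y) (h : X →[G] Z)
    (e : ∀ t, h t = g (f t)) (x : M.obj X) : M.tr g (M.tr f x) = M.tr h x := by
  rw [← M.tr_comp, show h = g.comp f from MulActionHom.ext e]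

theorem res_id' {X : FinGSet.{u} G} (f : X →[G] X) (e : ∀ t, f t = t) (x : M.obj X) :
    M.res f x = x := by
  rw [show f = MulActionHom.id G from MulActionHom.ext e, M.res_id]

theorem ext {X Y Z : FinGSet.{u} G} {i : X →[G] Z} {j : Y →[G] Z} (h : IsCoprod i j)
    {x y : M.obj Z} (hi : M.res i x = M.res i y) (hj : M.res j x = M.res j y) : x = y :=
  (M.coprod h).1 (Prod.ext hi hj)

theorem exists_pair {X Y Z : FinGSet.{u} G} {i : X →[G] Z} {j : Y →[G] Z} (h : IsCoprod i j)
    (x : M.obj X) (y : M.obj Y) : ∃ z, M.res i z = x ∧ M.res j z = y := by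
  obtain ⟨z, hz⟩ := (M.coprod h).2 (x, y)
  exact ⟨z, congrArg Prod.fst hz, congrArg Prod.snd hz⟩

/-- The element of `M(X ⊔ Y)` with given restrictions. -/
noncomputable def pair {X Y : FinGSet.{u} G} (x : M.obj X) (y : M.obj Y) : M.obj (X.sum Y) :=
  (M.exists_pair (isCoprod_sum X Y) x y).choose

@[simp] theorem res_inl_pair {X Y : FinGSet.{u} G} (x : M.obj X) (y : M.obj Y) :
    M.res (inl X Y) (M.pair x y) = x :=
  (M.exists_pair (isCoprod_sum X Y) x y).choose_spec.1

@[simp] theorem res_inr_pair {X Y : FinGSet.{u} G} (x : M.obj X) (y : M.obj Y) :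
    M.res (inr X Y) (M.pair x y) = y :=
  (M.exists_pair (isCoprod_sum X Y) x y).choose_spec.2

theorem res_tr_inj {X Z : FinGSet.{u} G} {f : X →[G] Z} (hf : Function.Injective f)
    (x : M.obj X) : M.res f (M.tr f x) = x := by
  rw [M.res_tr (isPB_inj hf), M.res_id, M.tr_id]

theorem tr_res_bij {X Z : FinGSet.{u} G} {f : X →[G] Z} (hf : Function.Bijective f)
    (x : M.obj Z) : M.tr f (M.res f x) = x := by
  obtain ⟨g, h1, h2⟩ := exists_inverse hf
  have : M.res g (M.res f x) = x := by
    rw [← M.res_comp]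
    exact M.res_id' _ h1 x
  conv_rhs => rw [← this, ← M.res_tr_inj hf.1 (M.res f x), ← M.res_comp]
  exact (M.res_id' _ h1 _).symm

/-- Every element of `M(X ⊔ Y)` is the sum of the transfers of its restrictions. -/
theorem eq_tr_add_tr {X Y Z : FinGSet.{u} G} {i : X →[G] Z} {j : Y →[G] Z} (h : IsCoprod i j)
    (x : M.obj Z) : x = M.tr i (M.res i x) + M.tr j (M.res j x) := by
  have hij : IsPB (ofEmp X) (ofEmp Y) i j :=
    ⟨fun t => t.elim, fun t => t.elim, fun x y e => (h.disj x y e).elim⟩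
  have := M.empty (emp G) inferInstance
  refine M.ext h ?_ ?_
  · rw [map_add, M.res_tr_inj h.inj_left, M.res_tr hij.symm, Subsingleton.elim
      (M.res (ofEmp Y) (M.res j x)) 0, map_zero, add_zero]
  · rw [map_add, M.res_tr_inj h.inj_right, M.res_tr hij, Subsingleton.elim
      (M.res (ofEmp X) (M.res i x)) 0, map_zero, zero_add]

theorem tr_fold {Y : FinGSet.{u} G} (x y : M.obj Y) :
    M.tr (desc (MulActionHom.id G) (MulActionHom.id G)) (M.pair x y) = x + y := by
  rw [M.eq_tr_add_tr (isCoprod_sum Y Y) (M.pair x y), res_inl_pair, res_inr_pair, map_add,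
    M.tr_tr _ _ (MulActionHom.id G) (fun _ => rfl), M.tr_tr _ _ (MulActionHom.id G) (fun _ => rfl),
    M.tr_id, M.tr_id]

/-- A representative `(p : Y → X, a ∈ M(Y), b ∈ N(Y))` of the element `tr_p (a ⊗ b)` of
`(M ⊠ N)(X)`. -/
structure BoxRep (M : Mod.{u, w, v} k) (N : Mod.{u, w, w'} k) (X : FinGSet.{u} G) :
    Type (max (u + 1) v w') where
  dom : FinGSet.{u} G
  map : dom →[G] X
  fst : M.obj dom
  snd : N.obj dom

/-- The relations of the box product over `k`: Frobenius reciprocity in both variables, and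
`k`-balancedness. -/
inductive BoxRel (M : Mod.{u, w, v} k) (N : Mod.{u, w, w'} k) (X : FinGSet.{u} G) :
    BoxRep M N X → BoxRep M N X → Prop
  | left {Y Z : FinGSet.{u} G} (g : Y →[G] Z) (p : Z →[G] X) (a : M.obj Y) (b : N.obj Z) :
      BoxRel M N X ⟨Z, p, M.tr g a, b⟩ ⟨Y, p.comp g, a, N.res g b⟩
  | right {Y Z : FinGSet.{u} G} (g : Y →[G] Z) (p : Z →[G] X) (a : M.obj Z) (b : N.obj Y) :
      BoxRel M N X ⟨Z, p, a, N.tr g b⟩ ⟨Y, p.comp g, M.res g a, b⟩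
  | smul {Y : FinGSet.{u} G} (p : Y →[G] X) (c : k.obj Y) (a : M.obj Y) (b : N.obj Y) :
      BoxRel M N X ⟨Y, p, c • a, b⟩ ⟨Y, p, a, c • b⟩

/-- The value at `X` of the box product `M ⊠ N` over `k`.

The box product over `k` is generated by the elements `tr_p (a ⊗ b)` with `p : Y → X`, `a ∈ M(Y)`
and `b ∈ N(Y)`, subject to bilinearity, `k`-balancedness and Frobenius reciprocity. Since
`tr_p (a ⊗ b) + tr_q (c ⊗ d)` is the transfer of `(a, c) ⊗ (b, d)` from the disjoint union of the
sources of `p` and `q`, every element is of this form, and bilinearity is a consequence of Frobenius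
reciprocity for fold maps and for maps out of the empty set. So the underlying set of the
box product is the set of these expressions modulo the equivalence relation generated by `BoxRel`,
and the addition is induced by the disjoint union. -/
def Box (M : Mod.{u, w, v} k) (N : Mod.{u, w, w'} k) (X : FinGSet.{u} G) :
    Type (max (u + 1) v w') :=
  Quot (BoxRel M N X)

namespace Box

variable {M} {N : Mod.{u, w, w'} k} {X : FinGSet.{u} G}

/-- The element `tr_p (a ⊗ b)`. -/
def mk {Y : FinGSet.{u} G} (p : Y →[G] X) (a : M.obj Y) (b : N.obj Y) : Box M N X :=
  Quot.mk _ ⟨Y, p, a, b⟩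

theorem mk_left {Y Z : FinGSet.{u} G} (g : Y →[G] Z) (p : Z →[G] X) (a : M.obj Y) (b : N.obj Z) :
    mk p (M.tr g a) b = mk (p.comp g) a (N.res g b) :=
  Quot.sound (.left g p a b)

theorem mk_right {Y Z : FinGSet.{u} G} (g : Y →[G] Z) (p : Z →[G] X) (a : M.obj Z) (b : N.obj Y) :
    mk p a (N.tr g b) = mk (p.comp g) (M.res g a) b :=
  Quot.sound (.right g p a b)

theorem mk_smul {Y : FinGSet.{u} G} (p : Y →[G] X) (c : k.obj Y) (a : M.obj Y) (b : N.obj Y) :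
    mk p (c • a) b = mk p a (c • b) :=
  Quot.sound (.smul p c a b)

theorem ind {P : Box M N X → Prop}
    (h : ∀ (Y : FinGSet.{u} G) (p : Y →[G] X) (a : M.obj Y) (b : N.obj Y), P (mk p a b))
    (x : Box M N X) : P x :=
  Quot.ind (fun r => h r.dom r.map r.fst r.snd) x

theorem mk_congr {Y : FinGSet.{u} G} {p p' : Y →[G] X} {a a' : M.obj Y} {b b' : N.obj Y}
    (hp : ∀ t, p t = p' t) (ha : a = a') (hb : b = b') : mk p a b = mk p' a' b' := by
  rw [show p = p' from MulActionHom.ext hp, ha, hb]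

/-- Isomorphic representatives define the same element. -/
theorem mk_iso {Y Z : FinGSet.{u} G} {g : Y →[G] Z} (hg : Function.Bijective g) {p : Y →[G] X}
    {q : Z →[G] X} {a : M.obj Y} {b : N.obj Y} {c : M.obj Z} {d : N.obj Z}
    (hp : ∀ t, p t = q (g t)) (ha : a = M.res g c) (hb : b = N.res g d) :
    mk p a b = mk q c d := by
  rw [← M.tr_res_bij hg c, mk_left]
  exact mk_congr hp ha hb

/-- The sum of two representatives. -/
noncomputable def addRep (r s : BoxRep M N X) : Box M N X :=
  mk (desc r.map s.map) (M.pair r.fst s.fst) (N.pair r.snd s.snd)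

theorem addRep_eq (r s : BoxRep M N X) {T : FinGSet.{u} G} {i : r.dom →[G] T} {j : s.dom →[G] T}
    (h : IsCoprod i j) {q : T →[G] X} (hi : ∀ t, r.map t = q (i t)) (hj : ∀ t, s.map t = q (j t))
    {c : M.obj T} {d : N.obj T} (h1 : M.res i c = r.fst) (h2 : M.res j c = s.fst)
    (h3 : N.res i d = r.snd) (h4 : N.res j d = s.snd) : addRep r s = mk q c d := by
  refine mk_iso h.desc_bijective ?_ ?_ ?_
  · rintro (t | t)
    · exact hi t
    · exact hj t
  · refine M.ext (isCoprod_sum _ _) ?_ ?_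
    · rw [res_inl_pair, M.res_res _ _ i (fun _ => rfl), h1]
    · rw [res_inr_pair, M.res_res _ _ j (fun _ => rfl), h2]
  · refine N.ext (isCoprod_sum _ _) ?_ ?_
    · rw [res_inl_pair, N.res_res _ _ i (fun _ => rfl), h3]
    · rw [res_inr_pair, N.res_res _ _ j (fun _ => rfl), h4]

theorem addRep_comm (r s : BoxRep M N X) : addRep r s = addRep s r :=
  addRep_eq r s (isCoprod_sum s.dom r.dom).symm (fun _ => rfl) (fun _ => rfl)
    (res_inr_pair _ _ _) (res_inl_pair _ _ _) (res_inr_pair _ _ _) (res_inl_pair _ _ _)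

/-- The map induced on disjoint unions with a fixed `G`-set. -/
def _root_.FinGSet.mapLeft {Y Z : FinGSet.{u} G} (g : Y →[G] Z) (W : FinGSet.{u} G) :
    Y.sum W →[G] Z.sum W :=
  desc ((inl Z W).comp g) (inr Z W)

theorem res_mapLeft (M : Mod.{u, w, v} k) {Y Z W : FinGSet.{u} G} (g : Y →[G] Z) (a : M.obj Z)
    (b : M.obj W) : M.res (mapLeft g W) (M.pair a b) = M.pair (M.res g a) b := by
  refine M.ext (isCoprod_sum _ _) ?_ ?_
  · rw [res_inl_pair, M.res_res _ _ ((inl Z W).comp g) (fun _ => rfl), M.res_comp, res_inl_pair]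
  · rw [res_inr_pair, M.res_res _ _ (inr Z W) (fun _ => rfl), res_inr_pair]

theorem tr_mapLeft (M : Mod.{u, w, v} k) {Y Z W : FinGSet.{u} G} (g : Y →[G] Z) (a : M.obj Y)
    (b : M.obj W) : M.tr (mapLeft g W) (M.pair a b) = M.pair (M.tr g a) b := by
  refine M.ext (isCoprod_sum _ _) ?_ ?_
  · have h : IsPB (inl Y W) g (mapLeft g W) (inl Z W) :=
      ⟨fun _ => rfl, fun _ _ e _ => Sum.inl_injective e, by
        rintro (y | w) z e
        · exact ⟨y, rfl, Sum.inl_injective e⟩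
        · exact (Sum.inr_ne_inl e).elim⟩
    rw [res_inl_pair, M.res_tr h, res_inl_pair]
  · have h : IsPB (inr Y W) (MulActionHom.id G) (mapLeft g W) (inr Z W) :=
      ⟨fun _ => rfl, fun _ _ _ e => e, by
        rintro (y | w) z e
        · exact (Sum.inl_ne_inr e).elim
        · exact ⟨w, rfl, Sum.inr_injective e⟩⟩
    rw [res_inr_pair, M.res_tr h, res_inr_pair, M.tr_id]

theorem addRep_congr (r r' s : BoxRep M N X) (h : BoxRel M N X r r') :
    addRep r s = addRep r' s := by
  cases h with
  | left g p a b =>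
    unfold addRep
    rw [← tr_mapLeft, mk_left, res_mapLeft]
    exact mk_congr (by rintro (t | t) <;> rfl) rfl rfl
  | right g p a b =>
    unfold addRep
    rw [← tr_mapLeft, mk_right, res_mapLeft]
    exact mk_congr (by rintro (t | t) <;> rfl) rfl rfl
  | @smul Y p c a b =>
    obtain ⟨z, hz⟩ := (k.coprod (isCoprod_sum Y s.dom)).2 (c, 1)
    have h1 : k.res (inl Y s.dom) z = c := congrArg Prod.fst hz
    have h2 : k.res (inr Y s.dom) z = 1 := congrArg Prod.snd hz
    have e1 : M.pair (c • a) s.fst = z • M.pair a s.fst := by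
      refine M.ext (isCoprod_sum _ _) ?_ ?_ <;> simp [M.res_smul, h1, h2]
    have e2 : N.pair (c • b) s.snd = z • N.pair b s.snd := by
      refine N.ext (isCoprod_sum _ _) ?_ ?_ <;> simp [N.res_smul, h1, h2]
    unfold addRep
    dsimp only
    rw [e1, e2, mk_smul]

noncomputable instance : Add (Box M N X) where
  add x y := Quot.liftOn₂ x y addRep
    (fun r s s' h => by rw [addRep_comm, addRep_congr s s' r h, addRep_comm])
    (fun r r' s h => addRep_congr r r' s h)

theorem mk_add {Y Z T : FinGSet.{u} G} {p : Y →[G] X} {a : M.obj Y} {b : N.obj Y} {q : Z →[G] X}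
    {a' : M.obj Z} {b' : N.obj Z} {i : Y →[G] T} {j : Z →[G] T}
    (h : IsCoprod i j) {r : T →[G] X} (hi : ∀ t, p t = r (i t)) (hj : ∀ t, q t = r (j t))
    {c : M.obj T} {d : N.obj T} (h1 : M.res i c = a) (h2 : M.res j c = a')
    (h3 : N.res i d = b) (h4 : N.res j d = b') : mk p a b + mk q a' b' = mk r c d :=
  addRep_eq ⟨Y, p, a, b⟩ ⟨Z, q, a', b'⟩ h hi hj h1 h2 h3 h4

theorem mk_add_mk {Y Z : FinGSet.{u} G} (p : Y →[G] X) (a : M.obj Y) (b : N.obj Y) (q : Z →[G] X)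
    (a' : M.obj Z) (b' : N.obj Z) :
    mk p a b + mk q a' b' = mk (desc p q) (M.pair a a') (N.pair b b') :=
  rfl

noncomputable instance : Zero (Box M N X) := ⟨mk (ofEmp X) 0 0⟩

theorem eq_zero {Y : FinGSet.{u} G} (hY : IsEmpty Y) (p : Y →[G] X) (a : M.obj Y) (b : N.obj Y) :
    mk p a b = 0 := by
  have := M.empty Y hY
  have := N.empty Y hY
  refine (mk_iso (g := ofEmp Y) ⟨fun t => t.elim, fun y => hY.elim y⟩ (fun t => t.elim) ?_ ?_).symm
  · exact (M.empty (emp G) inferInstance).elim _ _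
  · exact (N.empty (emp G) inferInstance).elim _ _

theorem mk_zero_left {Y : FinGSet.{u} G} (p : Y →[G] X) (b : N.obj Y) :
    mk p (0 : M.obj Y) b = 0 := by
  rw [← map_zero (M.tr (ofEmp Y)), mk_left]
  exact eq_zero inferInstance _ _ _

theorem mk_zero_right {Y : FinGSet.{u} G} (p : Y →[G] X) (a : M.obj Y) :
    mk p a (0 : N.obj Y) = 0 := by
  rw [← map_zero (N.tr (ofEmp Y)), mk_right]
  exact eq_zero inferInstance _ _ _

theorem mk_add_left {Y : FinGSet.{u} G} (p : Y →[G] X) (a a' : M.obj Y) (b : N.obj Y) :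
    mk p (a + a') b = mk p a b + mk p a' b := by
  rw [← tr_fold, mk_left]
  refine (mk_add (isCoprod_sum Y Y) (fun _ => rfl) (fun _ => rfl) (res_inl_pair _ _ _)
    (res_inr_pair _ _ _) ?_ ?_).symm
  · rw [N.res_res _ _ (MulActionHom.id G) (fun _ => rfl), N.res_id]
  · rw [N.res_res _ _ (MulActionHom.id G) (fun _ => rfl), N.res_id]

theorem mk_add_right {Y : FinGSet.{u} G} (p : Y →[G] X) (a : M.obj Y) (b b' : N.obj Y) :
    mk p a (b + b') = mk p a b + mk p a b' := by
  rw [← tr_fold, mk_right]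
  refine (mk_add (isCoprod_sum Y Y) (fun _ => rfl) (fun _ => rfl) ?_ ?_ (res_inl_pair _ _ _)
    (res_inr_pair _ _ _)).symm
  · rw [M.res_res _ _ (MulActionHom.id G) (fun _ => rfl), M.res_id]
  · rw [M.res_res _ _ (MulActionHom.id G) (fun _ => rfl), M.res_id]

theorem isCoprod_emp (Y : FinGSet.{u} G) : IsCoprod (ofEmp Y) (MulActionHom.id G (X := Y)) :=
  ⟨fun t => t.elim, fun _ _ e => e, fun t => t.elim, fun y => Or.inr ⟨y, rfl⟩⟩

/-- Negation, through the first variable. -/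
def neg (x : Box M N X) : Box M N X :=
  Quot.liftOn x (fun r => mk r.map (-r.fst) r.snd) fun r r' h => by
    cases h with
    | left g p a b => exact (mk_congr (fun _ => rfl) (map_neg _ _).symm rfl).trans (mk_left ..)
    | right g p a b =>
      exact (mk_right ..).trans (mk_congr (fun _ => rfl) (map_neg _ _) rfl)
    | smul p c a b =>
      exact (mk_congr (fun _ => rfl) (smul_neg _ _).symm rfl).trans (mk_smul ..)

instance : Neg (Box M N X) := ⟨neg⟩

noncomputable instance : AddCommGroup (Box M N X) where
  add_assoc x y z := by
    induction x using ind with | h Y p a b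
    induction y using ind with | h Y' p' a' b'
    induction z using ind with | h Y'' p'' a'' b''
    rw [mk_add_mk p, mk_add_mk (desc p p'), mk_add_mk p']
    symm
    refine mk_add (i := (inl (Y.sum Y') Y'').comp (inl Y Y'))
      (j := desc ((inl (Y.sum Y') Y'').comp (inr Y Y')) (inr (Y.sum Y') Y''))
      ⟨?_, ?_, ?_, ?_⟩ (fun _ => rfl) ?_ ?_ ?_ ?_ ?_
    · exact Sum.inl_injective.comp Sum.inl_injective
    · rintro (t | t) (t' | t') e
      · exact congrArg _ (Sum.inr_injective (Sum.inl_injective e))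
      · exact (Sum.inl_ne_inr e).elim
      · exact (Sum.inr_ne_inl e).elim
      · exact congrArg _ (Sum.inr_injective e)
    · rintro t (t' | t') e
      · exact Sum.inl_ne_inr (Sum.inl_injective e)
      · exact Sum.inl_ne_inr e
    · rintro ((t | t) | t)
      · exact Or.inl ⟨t, rfl⟩
      · exact Or.inr ⟨Sum.inl t, rfl⟩
      · exact Or.inr ⟨Sum.inr t, rfl⟩
    · rintro (t | t) <;> rfl
    · rw [M.res_comp, res_inl_pair, res_inl_pair]
    · refine M.ext (isCoprod_sum _ _) ?_ ?_
      · rw [M.res_res _ _ ((inl (Y.sum Y') Y'').comp (inr Y Y')) (fun _ => rfl), M.res_comp]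
        simp
      · rw [M.res_res _ _ (inr (Y.sum Y') Y'') (fun _ => rfl)]
        simp
    · rw [N.res_comp, res_inl_pair, res_inl_pair]
    · refine N.ext (isCoprod_sum _ _) ?_ ?_
      · rw [N.res_res _ _ ((inl (Y.sum Y') Y'').comp (inr Y Y')) (fun _ => rfl), N.res_comp]
        simp
      · rw [N.res_res _ _ (inr (Y.sum Y') Y'') (fun _ => rfl)]
        simp
  zero_add x := by
    induction x using ind with | h Y p a b
    refine mk_add (isCoprod_emp Y) (fun t => t.elim) (fun _ => rfl) ?_ (M.res_id _) ?_ (N.res_id _)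
    · exact (M.empty (emp G) inferInstance).elim _ _
    · exact (N.empty (emp G) inferInstance).elim _ _
  add_zero x := by
    induction x using ind with | h Y p a b
    refine mk_add (isCoprod_emp Y).symm (fun _ => rfl) (fun t => t.elim) (M.res_id _) ?_
      (N.res_id _) ?_
    · exact (M.empty (emp G) inferInstance).elim _ _
    · exact (N.empty (emp G) inferInstance).elim _ _
  add_comm x y := by
    induction x using ind with | h Y p a b
    induction y using ind with | h Y' p' a' b'
    exact addRep_comm ⟨Y, p, a, b⟩ ⟨Y', p', a', b'⟩
  neg_add_cancel x := by
    induction x using ind with | h Y p a b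
    change mk p (-a) b + mk p a b = 0
    rw [← mk_add_left, neg_add_cancel, mk_zero_left]
  nsmul := nsmulRec
  zsmul := zsmulRec

theorem neg_mk {Y : FinGSet.{u} G} (p : Y →[G] X) (a : M.obj Y) (b : N.obj Y) :
    -mk p a b = mk p (-a) b :=
  rfl

/-- The restriction of a representative. -/
def resRep {X' : FinGSet.{u} G} (f : X' →[G] X) (r : BoxRep M N X) : Box M N X' :=
  mk (pbSnd r.map f) (M.res (pbFst r.map f) r.fst) (N.res (pbFst r.map f) r.snd)

theorem resRep_eq {X' : FinGSet.{u} G} {f : X' →[G] X} (r : BoxRep M N X) {W : FinGSet.{u} G}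
    {a : W →[G] r.dom} {b : W →[G] X'} (h : IsPB a b r.map f) :
    resRep f r = mk b (M.res a r.fst) (N.res a r.snd) := by
  refine (mk_iso h.pbLift_bijective (fun _ => rfl) ?_ ?_).symm
  · rw [M.res_res _ _ a (fun _ => rfl)]
  · rw [N.res_res _ _ a (fun _ => rfl)]

/-- The pullback square of a composite maps to the pullback square. -/
theorem isPB_comp_aux {X' Y Z : FinGSet.{u} G} (f : X' →[G] X) (p : Z →[G] X) (g : Y →[G] Z) :
    ∃ g' : pb (p.comp g) f →[G] pb p f, IsPB (pbFst (p.comp g) f) g' g (pbFst p f) ∧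
      ∀ t, pbSnd p f (g' t) = pbSnd (p.comp g) f t := by
  refine ⟨pbLift (g.comp (pbFst _ _)) (pbSnd _ _) fun t => t.2, ⟨fun _ => rfl, ?_, ?_⟩,
    fun _ => rfl⟩
  · intro t t' e e'
    exact (isPB_pb _ _).inj _ _ e (congrArg (fun s => s.1.2) e')
  · rintro y ⟨⟨z, x⟩, hz⟩ e
    change g y = z at e
    subst e
    exact ⟨⟨(y, x), hz⟩, rfl, rfl⟩

/-- Restrictions in the box product. -/
def resFun {X' : FinGSet.{u} G} (f : X' →[G] X) (x : Box M N X) : Box M N X' :=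
  Quot.liftOn x (resRep f) fun r r' h => by
    cases h with
    | left g p a b =>
      obtain ⟨g', h, h'⟩ := isPB_comp_aux f p g
      unfold resRep
      dsimp only
      rw [M.res_tr h, mk_left, N.res_res _ _ ((pbFst p f).comp g') (fun _ => rfl),
        N.res_res _ _ ((pbFst p f).comp g') (fun t => (h.comm t).symm)]
      exact mk_congr h' rfl rfl
    | right g p a b =>
      obtain ⟨g', h, h'⟩ := isPB_comp_aux f p g
      unfold resRep
      dsimp only
      rw [N.res_tr h, mk_right, M.res_res _ _ ((pbFst p f).comp g') (fun _ => rfl),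
        M.res_res _ _ ((pbFst p f).comp g') (fun t => (h.comm t).symm)]
      exact mk_congr h' rfl rfl
    | smul p c a b =>
      unfold resRep
      dsimp only
      rw [M.res_smul, N.res_smul, mk_smul]

theorem resFun_mk {X' Y W : FinGSet.{u} G} {f : X' →[G] X} {p : Y →[G] X} {u : W →[G] Y}
    {q : W →[G] X'} (h : IsPB u q p f) (a : M.obj Y) (b : N.obj Y) :
    resFun f (mk p a b) = mk q (M.res u a) (N.res u b) :=
  resRep_eq ⟨Y, p, a, b⟩ h

/-- Restrictions in the box product are additive. -/
noncomputable def res {X' : FinGSet.{u} G} (f : X' →[G] X) : Box M N X →+ Box M N X' :=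
  AddMonoidHom.mk' (resFun f) fun x y => by
    induction x using ind with | h Y p a b
    induction y using ind with | h Y' p' a' b'
    rw [mk_add_mk, resFun_mk (isPB_pb p f), resFun_mk (isPB_pb p' f),
      resFun_mk (isPB_pb (desc p p') f)]
    have h1 : IsPB (pbFst p f)
        (pbLift ((inl Y Y').comp (pbFst p f)) (pbSnd p f) fun t => t.2 :
          pb p f →[G] pb (desc p p') f) (inl Y Y') (pbFst (desc p p') f) :=
      (IsPB.cancel (isPB_pb (desc p p') f).symm (d := pbFst p f) (k := inl Y Y')
        (ac := pbSnd p f) (fun _ => rfl) (fun _ => rfl) (isPB_pb p f).symm).symm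
    have h2 : IsPB (pbFst p' f)
        (pbLift ((inr Y Y').comp (pbFst p' f)) (pbSnd p' f) fun t => t.2 :
          pb p' f →[G] pb (desc p p') f) (inr Y Y') (pbFst (desc p p') f) :=
      (IsPB.cancel (isPB_pb (desc p p') f).symm (d := pbFst p' f) (k := inr Y Y')
        (ac := pbSnd p' f) (fun _ => rfl) (fun _ => rfl) (isPB_pb p' f).symm).symm
    symm
    refine mk_add ((isCoprod_sum Y Y').pullback h1 h2) (fun _ => rfl) (fun _ => rfl) ?_ ?_ ?_ ?_
    · rw [M.res_res _ _ ((inl Y Y').comp (pbFst p f)) (fun _ => rfl), M.res_comp, res_inl_pair]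
    · rw [M.res_res _ _ ((inr Y Y').comp (pbFst p' f)) (fun _ => rfl), M.res_comp, res_inr_pair]
    · rw [N.res_res _ _ ((inl Y Y').comp (pbFst p f)) (fun _ => rfl), N.res_comp, res_inl_pair]
    · rw [N.res_res _ _ ((inr Y Y').comp (pbFst p' f)) (fun _ => rfl), N.res_comp, res_inr_pair]

theorem res_mk {X' Y W : FinGSet.{u} G} {f : X' →[G] X} {p : Y →[G] X} {u : W →[G] Y}
    {q : W →[G] X'} (h : IsPB u q p f) (a : M.obj Y) (b : N.obj Y) :
    res f (mk p a b) = mk q (M.res u a) (N.res u b) :=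
  resRep_eq ⟨Y, p, a, b⟩ h

/-- Transfers in the box product. -/
def trFun {X' : FinGSet.{u} G} (f : X →[G] X') (x : Box M N X) : Box M N X' :=
  Quot.liftOn x (fun r => mk (f.comp r.map) r.fst r.snd) fun r r' h => by
    cases h with
    | left g p a b => exact mk_left g (f.comp p) a b
    | right g p a b => exact mk_right g (f.comp p) a b
    | smul p c a b => exact mk_smul (f.comp p) c a b

/-- Transfers in the box product are additive. -/
noncomputable def tr {X' : FinGSet.{u} G} (f : X →[G] X') : Box M N X →+ Box M N X' :=
  AddMonoidHom.mk' (trFun f) fun x y => by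
    induction x using ind with | h Y p a b
    induction y using ind with | h Y' p' a' b'
    exact mk_congr (by rintro (t | t) <;> rfl) rfl rfl

theorem tr_mk {X' Y : FinGSet.{u} G} (f : X →[G] X') (p : Y →[G] X) (a : M.obj Y) (b : N.obj Y) :
    tr f (mk p a b) = mk (f.comp p) a b :=
  rfl

/-- The action of `k` on the box product. -/
def smulFun (c : k.obj X) (x : Box M N X) : Box M N X :=
  Quot.liftOn x (fun r => mk r.map (k.res r.map c • r.fst) r.snd) fun r r' h => by
    cases h with
    | left g p a b =>
      dsimp only
      rw [← M.tr_res_smul, mk_left, k.res_comp]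
    | right g p a b =>
      dsimp only
      rw [mk_right, k.res_comp, M.res_smul]
    | smul p c' a b =>
      dsimp only
      rw [smul_comm, mk_smul]

noncomputable instance : Module (k.obj X) (Box M N X) where
  smul := smulFun
  one_smul x := by
    induction x using ind with | h Y p a b
    change mk p (k.res p 1 • a) b = _
    rw [map_one, one_smul]
  mul_smul c d x := by
    induction x using ind with | h Y p a b
    change mk p (k.res p (c * d) • a) b = mk p (k.res p c • k.res p d • a) b
    rw [map_mul, mul_smul]
  smul_zero c := eq_zero inferInstance _ _ _
  smul_add c x y := by
    induction x using ind with | h Y p a b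
    induction y using ind with | h Y' p' a' b'
    rw [mk_add_mk]
    symm
    refine mk_add (isCoprod_sum Y Y') (fun _ => rfl) (fun _ => rfl) ?_ ?_ (res_inl_pair _ _ _)
      (res_inr_pair _ _ _)
    · rw [M.res_smul, res_inl_pair, ← k.res_comp]
      rfl
    · rw [M.res_smul, res_inr_pair, ← k.res_comp]
      rfl
  add_smul c d x := by
    induction x using ind with | h Y p a b
    change mk p (k.res p (c + d) • a) b = mk p (k.res p c • a) b + mk p (k.res p d • a) b
    rw [map_add, add_smul, mk_add_left]
  zero_smul x := by
    induction x using ind with | h Y p a b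
    change mk p (k.res p 0 • a) b = _
    rw [map_zero, zero_smul, mk_zero_left]

theorem smul_mk {Y : FinGSet.{u} G} (c : k.obj X) (p : Y →[G] X) (a : M.obj Y) (b : N.obj Y) :
    c • mk p a b = mk p (k.res p c • a) b :=
  rfl

theorem res_id (x : Box M N X) : res (MulActionHom.id G) x = x := by
  induction x using ind with | h Y p a b
  rw [res_mk (isPB_id_id p), M.res_id, N.res_id]

theorem tr_id (x : Box M N X) : tr (MulActionHom.id G) x = x := by
  induction x using ind with | h Y p a b
  rfl

theorem tr_comp {Y Z : FinGSet.{u} G} (g : Y →[G] Z) (f : X →[G] Y) (x : Box M N X) :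
    tr (g.comp f) x = tr g (tr f x) := by
  induction x using ind with | h Y p a b
  rfl

theorem res_comp {Y Z : FinGSet.{u} G} (g : Y →[G] Z) (f : X →[G] Y) (x : Box M N Z) :
    res (g.comp f) x = res f (res g x) := by
  induction x using ind with | h A p a b
  rw [res_mk (isPB_pb p g), res_mk (isPB_pb (pbSnd p g) f),
    res_mk ((isPB_pb p g).paste (isPB_pb (pbSnd p g) f)), M.res_comp, N.res_comp]

theorem res_tr {W X Y Z : FinGSet.{u} G} {a : W →[G] X} {b : W →[G] Y} {f : X →[G] Z}
    {g : Y →[G] Z} (h : IsPB a b f g) (x : Box M N X) : res g (tr f x) = tr b (res a x) := by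
  induction x using ind with | h A p c d
  rw [tr_mk, res_mk (isPB_pb p a), tr_mk, res_mk (h.symm.paste (isPB_pb p a).symm).symm]

theorem subsingleton (h : IsEmpty X) : Subsingleton (Box M N X) := by
  refine ⟨fun x y => ?_⟩
  have key : ∀ x : Box M N X, x = 0 := fun x => by
    induction x using ind with | h Y p a b
    exact eq_zero ⟨fun t => h.elim (p t)⟩ p a b
  rw [key x, key y]

theorem coprod {X Y Z : FinGSet.{u} G} {i : X →[G] Z} {j : Y →[G] Z} (h : IsCoprod i j) :
    Function.Bijective fun z : Box M N Z => (res i z, res j z) := by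
  have hij : IsPB (ofEmp X) (ofEmp Y) i j :=
    ⟨fun t => t.elim, fun t => t.elim, fun x y e => (h.disj x y e).elim⟩
  have hs : Subsingleton (Box M N (emp G)) := subsingleton inferInstance
  have key : ∀ x : Box M N Z, x = tr i (res i x) + tr j (res j x) := fun x => by
    induction x using ind with | h A p a b
    rw [res_mk (isPB_pb p i), res_mk (isPB_pb p j), tr_mk, tr_mk]
    symm
    refine mk_add (h.pullback (isPB_pb p i).symm (isPB_pb p j).symm) (fun t => t.2.symm)
      (fun t => t.2.symm) rfl rfl rfl rfl
  constructor
  · intro x y e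
    have e1 : res i x = res i y := congrArg Prod.fst e
    have e2 : res j x = res j y := congrArg Prod.snd e
    rw [key x, key y, e1, e2]
  · rintro ⟨x, y⟩
    refine ⟨tr i x + tr j y, Prod.ext ?_ ?_⟩
    · change res i (tr i x + tr j y) = x
      rw [map_add, res_tr (isPB_inj h.inj_left), res_id, tr_id, res_tr hij.symm,
        Subsingleton.elim (res (ofEmp Y) y) 0, map_zero, add_zero]
    · change res j (tr i x + tr j y) = y
      rw [map_add, res_tr (isPB_inj h.inj_right), res_id, tr_id, res_tr hij,
        Subsingleton.elim (res (ofEmp X) x) 0, map_zero, zero_add]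

end Box

/-- The box product of two `k`-modules over `k`. -/
noncomputable def box (M : Mod.{u, w, v} k) (N : Mod.{u, w, w'} k) :
    Mod.{u, w, max (u + 1) v w'} k where
  obj := Box M N
  res := Box.res
  tr := Box.tr
  res_id := Box.res_id
  tr_id := Box.tr_id
  res_comp := Box.res_comp
  tr_comp := Box.tr_comp
  empty _ := Box.subsingleton
  coprod := Box.coprod
  res_tr := Box.res_tr
  res_smul f c x := by
    induction x using Box.ind with | h Y p a b
    rw [Box.smul_mk, Box.res_mk (isPB_pb p f), Box.res_mk (isPB_pb p f), Box.smul_mk, M.res_smul,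
      ← k.res_comp, ← k.res_comp]
    refine Box.mk_congr (fun _ => rfl) ?_ rfl
    rw [show p.comp (pbFst p f) = f.comp (pbSnd p f) from MulActionHom.ext (isPB_pb p f).comm]
  tr_res_smul f c x := by
    induction x using Box.ind with | h Y p a b
    rw [Box.smul_mk, Box.tr_mk, Box.tr_mk, Box.smul_mk, k.res_comp]
  tr_smul_res f c x := by
    induction x using Box.ind with | h Y p a b
    have h := isPB_pb p f
    rw [Box.res_mk h, Box.smul_mk, Box.tr_mk, Box.smul_mk, k.res_tr h.symm, ← M.tr_smul_res,
      Box.mk_left]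
    exact Box.mk_congr (fun t => (h.comm t).symm) rfl rfl

/-- The map of box products induced by a morphism in the second variable. -/
noncomputable def boxMap (M : Mod.{u, w, v} k) {N N' : Mod.{u, w, w'} k} (φ : Mod.Hom N N') :
    Mod.Hom (box M N) (box M N') where
  app X :=
    { toFun := fun x => Quot.liftOn x (fun r => Box.mk r.map r.fst (φ.app _ r.snd)) fun r r' h => by
        cases h with
        | left g p a b =>
          dsimp only
          rw [Box.mk_left, φ.app_res]
        | right g p a b =>
          dsimp only
          rw [φ.app_tr, Box.mk_right]
        | smul p c a b =>
          dsimp only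
          rw [map_smul, Box.mk_smul]
      map_add' := fun x y => by
        induction x using Box.ind with | h Y p a b
        induction y using Box.ind with | h Y' p' a' b'
        refine (Box.mk_add (isCoprod_sum Y Y') (fun _ => rfl) (fun _ => rfl) (res_inl_pair _ _ _)
          (res_inr_pair _ _ _) ?_ ?_).symm
        · rw [← φ.app_res, res_inl_pair]
        · rw [← φ.app_res, res_inr_pair]
      map_smul' := fun c x => by
        induction x using Box.ind with | h Y p a b
        rfl }
  app_res f x := by
    induction x using Box.ind with | h Y p a b
    exact Box.mk_congr (fun _ => rfl) rfl (φ.app_res _ _)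
  app_tr f x := by
    induction x using Box.ind with | h Y p a b
    rfl

/-- A `k`-module `M` is flat if the functor `M ⊠ -` over `k` is exact. -/
def IsFlat {k : TambaraFunctor.{u, w} G} (M : Mod.{u, w, w} k) : Prop :=
  ∀ (N₁ N₂ N₃ : Mod.{u, w, w} k) (φ : Mod.Hom N₁ N₂) (ψ : Mod.Hom N₂ N₃),
    (∀ X, Function.Exact (φ.app X) (ψ.app X)) →
    ∀ X, Function.Exact ((boxMap M φ).app X) ((boxMap M ψ).app X)

end Mod
end TambaraFunctor

namespace FinGSet

variable {G : Type u} [Group G]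

theorem IsPB.exists_lift {W X Y Z V : FinGSet.{u} G} {a : W →[G] X} {b : W →[G] Y} {f : X →[G] Z}
    {g : Y →[G] Z} (h : IsPB a b f g) (α : V →[G] X) (β : V →[G] Y)
    (e : ∀ t, f (α t) = g (β t)) : ∃ γ : V →[G] W, (∀ t, a (γ t) = α t) ∧ ∀ t, b (γ t) = β t := by
  choose γ h1 h2 using fun t => h.surj (α t) (β t) (e t)
  refine ⟨⟨γ, fun m t => h.inj _ _ ?_ ?_⟩, h1, h2⟩
  · rw [h1, map_smul, map_smul]
    exact congrArg _ (h1 t).symm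
  · rw [h2, map_smul, map_smul]
    exact congrArg _ (h2 t).symm

/-- The universal property of dependent products. -/
theorem IsExp.exists_lift {X Y A P E P' E' : FinGSet.{u} G} {f : X →[G] Y} {p : A →[G] X}
    {q' : P' →[G] Y} {e' : E' →[G] A} {r' : E' →[G] P'} (h' : IsExp f p q' e' r')
    {q : P →[G] Y} {e : E →[G] A} {r : E →[G] P} (h : IsPB (p.comp e) r f q) :
    ∃ (g : P →[G] P') (g' : E →[G] E'), IsPB g' r r' g ∧ (∀ t, q' (g t) = q t) ∧
      ∀ z, e' (g' z) = e z := by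
  have hex : ∀ t : P, ∃ t' : P', q' t' = q t ∧
      ∀ z z', r z = t → r' z' = t' → p (e z) = p (e' z') → e' z' = e z := by
    intro t
    choose s hs hs' using fun x : {x // f x = q t} => h.surj x.1 t x.2
    obtain ⟨t', ht', hh⟩ := h'.surj (q t) (fun x => e (s x)) hs
    refine ⟨t', ht', fun z z' hz hz' hzz => ?_⟩
    have hx : f (p (e z)) = q t := (h.comm z).trans (congrArg q hz)
    rw [hh z' ⟨_, hx⟩ hz' hzz.symm]
    exact congrArg e (h.inj _ _ (hs ⟨_, hx⟩) ((hs' _).trans hz.symm))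
  have huniq : ∀ (t : P) (t₁ t₂ : P'), q' t₁ = q t →
      (∀ z z', r z = t → r' z' = t₁ → p (e z) = p (e' z') → e' z' = e z) → q' t₂ = q t →
      (∀ z z', r z = t → r' z' = t₂ → p (e z) = p (e' z') → e' z' = e z) → t₁ = t₂ := by
    intro t t₁ t₂ h1 h1' h2 h2'
    refine h'.inj _ _ (h1.trans h2.symm) fun z₁ z₂ hz₁ hz₂ hz => ?_
    obtain ⟨z, hz3, hz4⟩ := h.surj (p (e' z₁)) t
      (((h'.pb.comm z₁).trans (congrArg q' hz₁)).trans h1)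
    rw [h1' z z₁ hz4 hz₁ hz3, h2' z z₂ hz4 hz₂ (hz3.trans hz)]
  choose g hg hg' using hex
  let γ : P →[G] P' := ⟨g, fun m t => by
    refine huniq (m • t) _ _ (hg _) (hg' _) ?_ ?_
    · rw [map_smul, map_smul]
      exact congrArg _ (hg t)
    · intro z z' hz hz' hzz
      have := hg' t (m⁻¹ • z) (m⁻¹ • z') (by rw [map_smul, hz, inv_smul_smul])
        (by rw [map_smul, hz']; exact inv_smul_smul m _)
        (by simp only [map_smul, hzz])
      rw [map_smul, map_smul] at this
      exact MulAction.injective _ this⟩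
  obtain ⟨g', h1, h2⟩ := h'.pb.exists_lift (p.comp e) (γ.comp r)
    (fun z => (h.comm z).trans (hg (r z)).symm)
  have h3 : ∀ z, e' (g' z) = e z := fun z => hg' (r z) z (g' z) rfl (h2 z) (h1 z).symm
  refine ⟨γ, g', ⟨h2, ?_, ?_⟩, hg, h3⟩
  · intro z w hz hw
    exact h.inj _ _ (by rw [MulActionHom.comp_apply, MulActionHom.comp_apply, ← h3, ← h3, hz]) hw
  · intro z' t hz
    obtain ⟨z, hz1, hz2⟩ := h.surj (p (e' z')) t
      ((h'.pb.comm z').trans ((congrArg q' hz).trans (hg t)))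
    refine ⟨z, h'.pb.inj _ _ ((h1 z).trans hz1) ?_, hz2⟩
    rw [h2, hz]
    exact congrArg γ hz2

theorem IsExp.lift_injective {X Y A P E P' E' : FinGSet.{u} G} {f : X →[G] Y} {p : A →[G] X}
    {q' : P' →[G] Y} {e' : E' →[G] A} {r' : E' →[G] P'} (h' : IsExp f p q' e' r')
    {q : P →[G] Y} {e : E →[G] A} {r : E →[G] P} (h : IsExp f p q e r)
    {g : P →[G] P'} {g' : E →[G] E'} (hg : IsPB g' r r' g) (hq : ∀ t, q' (g t) = q t)
    (he : ∀ z, e' (g' z) = e z) : Function.Injective g := by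
  intro t₁ t₂ ht
  refine h.inj _ _ (by rw [← hq, ← hq, ht]) fun z₁ z₂ h1 h2 hz => ?_
  rw [← he, ← he]
  refine congrArg e' (h'.pb.inj _ _ ?_ ?_)
  · rw [MulActionHom.comp_apply, MulActionHom.comp_apply, he, he, hz]
  · rw [hg.comm, hg.comm, h1, h2, ht]

/-- Dependent products are unique up to isomorphism. -/
theorem IsExp.exists_iso {X Y A P E P' E' : FinGSet.{u} G} {f : X →[G] Y} {p : A →[G] X}
    {q' : P' →[G] Y} {e' : E' →[G] A} {r' : E' →[G] P'} (h' : IsExp f p q' e' r')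
    {q : P →[G] Y} {e : E →[G] A} {r : E →[G] P} (h : IsExp f p q e r) :
    ∃ (g : P →[G] P') (g' : E →[G] E'), Function.Bijective g ∧ IsPB g' r r' g ∧
      (∀ t, q' (g t) = q t) ∧ ∀ z, e' (g' z) = e z := by
  obtain ⟨g, g', hg, hq, he⟩ := h'.exists_lift h.pb
  obtain ⟨j, j', hj, hq', he'⟩ := h.exists_lift h'.pb
  have hi := h'.lift_injective h hg hq he
  have hi' := h.lift_injective h' hj hq' he'
  have := Nat.card_le_card_of_injective g hi
  have := Nat.card_le_card_of_injective j hi'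
  exact ⟨g, g', hi.bijective_of_nat_card_le ‹_›, hg, hq, he⟩

theorem isExp_id {X A : FinGSet.{u} G} (p : A →[G] X) :
    IsExp (MulActionHom.id G) p p (MulActionHom.id G) (MulActionHom.id G) where
  pb := ⟨fun _ => rfl, fun _ _ _ e => e, fun _ t e => ⟨t, e.symm, rfl⟩⟩
  inj t t' h h' := h' t t' rfl rfl h
  surj y s hs := by
    refine ⟨s ⟨y, rfl⟩, hs _, fun z x h1 h2 => ?_⟩
    obtain ⟨x, hx⟩ := x
    change x = y at hx
    subst hx
    exact h1

theorem isExp_one {X Y : FinGSet.{u} G} (f : X →[G] Y) :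
    IsExp f (MulActionHom.id G) (MulActionHom.id G) (MulActionHom.id G) f where
  pb := ⟨fun _ => rfl, fun _ _ e _ => e, fun x _ e => ⟨x, rfl, e⟩⟩
  inj _ _ h _ := h
  surj y _ hs := ⟨y, rfl, fun _ x _ h2 => h2.trans (hs x).symm⟩

/-- The dependent product of a composite, in terms of iterated dependent products. -/
theorem IsExp.comp_right {X Y A P E B D P' E' : FinGSet.{u} G} {f : X →[G] Y} {p : A →[G] X}
    {q : P →[G] Y} {e : E →[G] A} {r : E →[G] P} (h : IsExp f p q e r)
    {g : B →[G] A} {a : D →[G] B} {g' : D →[G] E} (hD : IsPB a g' g e)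
    {q' : P' →[G] P} {e' : E' →[G] D} {r' : E' →[G] P'} (h' : IsExp r g' q' e' r') :
    IsExp f (p.comp g) (q.comp q') (a.comp e') r' where
  pb := by
    have := h.pb.paste h'.pb
    refine ⟨fun t => ?_, fun t t' e1 e2 => this.inj _ _ ?_ e2, fun x y e1 => ?_⟩
    · rw [← this.comm]
      exact congrArg (fun s => f (p s)) (hD.comm _)
    · exact (congrArg p (hD.comm _)).symm.trans (Eq.trans e1 (congrArg p (hD.comm _)))
    · obtain ⟨t, h1, h2⟩ := this.surj x y e1
      exact ⟨t, (congrArg p (hD.comm _)).trans h1, h2⟩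
  inj := by
    intro t t' ht hc
    have hc' : ∀ z z', r' z = t → r' z' = t' → p (e (g' (e' z))) = p (e (g' (e' z'))) →
        a (e' z) = a (e' z') := fun z z' h1 h2 h3 => hc z z' h1 h2
          ((congrArg p (hD.comm _)).trans (h3.trans (congrArg p (hD.comm _)).symm))
    have hq : q' t = q' t' := by
      refine h.inj _ _ ht fun w w' hw hw' hww => ?_
      obtain ⟨z, rfl, hz⟩ := h'.pb.surj w t hw
      obtain ⟨z', rfl, hz'⟩ := h'.pb.surj w' t' hw'
      have := hc' z z' hz hz' hww
      rw [MulActionHom.comp_apply, MulActionHom.comp_apply, ← hD.comm, ← hD.comm, this]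
    refine h'.inj _ _ hq fun z z' hz hz' hzz => hD.inj _ _ (hc' z z' hz hz' ?_) hzz
    rw [hzz]
  surj := by
    intro y s hs
    obtain ⟨t₀, h0, h1⟩ := h.surj y (fun x => g (s x)) hs
    have hx : ∀ z : {z // r z = t₀}, f (p (e z)) = y := fun z =>
      (h.pb.comm z.1).trans ((congrArg q z.2).trans h0)
    choose s' h2 h3 using fun z : {z // r z = t₀} =>
      hD.surj (s ⟨_, hx z⟩) z.1 (h1 z.1 ⟨_, hx z⟩ z.2 rfl).symm
    obtain ⟨t, h4, h5⟩ := h'.surj t₀ s' h3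
    refine ⟨t, (congrArg q h4).trans h0, fun z x hz hzx => ?_⟩
    have h6 : r (g' (e' z)) = t₀ := (h'.pb.comm z).trans ((congrArg q' hz).trans h4)
    rw [MulActionHom.comp_apply, h5 z ⟨_, h6⟩ hz rfl, h2]
    exact congrArg s (Subtype.ext ((congrArg p (hD.comm _)).symm.trans hzx))

/-- The dependent product along a composite, in terms of iterated dependent products. -/
theorem IsExp.comp_left {X Y Z A P E P' E' D : FinGSet.{u} G} {f : X →[G] Y} {f' : Y →[G] Z}
    {p : A →[G] X} {q : P →[G] Y} {e : E →[G] A} {r : E →[G] P} (h : IsExp f p q e r)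
    {q' : P' →[G] Z} {e' : E' →[G] P} {r' : E' →[G] P'} (h' : IsExp f' q q' e' r')
    {a : D →[G] E} {b : D →[G] E'} (hD : IsPB a b r e') :
    IsExp (f'.comp f) p q' (e.comp a) (r'.comp b) where
  pb := (h'.pb.symm.paste (h.pb.paste hD).symm).symm
  inj := by
    intro t t' ht hc
    refine h'.inj _ _ ht fun w w' hw hw' hww => h.inj _ _ hww fun z z' hz hz' hzz => ?_
    obtain ⟨d, rfl, rfl⟩ := hD.surj z w hz
    obtain ⟨d', rfl, rfl⟩ := hD.surj z' w' hz'
    exact hc d d' hw hw' hzz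
  surj := by
    intro y s hs
    choose t h1 h2 using fun y' : {y' // f' y' = y} =>
      h.surj y'.1 (fun x => s ⟨x.1, (congrArg f' x.2).trans y'.2⟩) (fun x => hs _)
    obtain ⟨t', h3, h4⟩ := h'.surj y t h1
    refine ⟨t', h3, fun z x hz hzx => ?_⟩
    have h5 : q (e' (b z)) = f x := by
      rw [← hD.comm, ← hzx]
      exact (h.pb.comm (a z)).symm
    have h6 := h4 (b z) ⟨f x, x.2⟩ hz h5
    exact h2 ⟨f x, x.2⟩ (a z) ⟨x, rfl⟩ ((hD.comm z).trans h6) hzx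

/-- Base change for dependent products. -/
theorem IsExp.exists_base_change {X Y W Y' A A' P P' E : FinGSet.{u} G} {f : X →[G] Y}
    {p : A →[G] X} {q : P →[G] Y} {e : E →[G] A} {r : E →[G] P} (h : IsExp f p q e r)
    {a : W →[G] X} {b : W →[G] Y'} {g : Y' →[G] Y} (hW : IsPB a b f g)
    {a' : A' →[G] A} {p' : A' →[G] W} (hA : IsPB a' p' p a)
    {g' : P' →[G] P} {q' : P' →[G] Y'} (hP : IsPB g' q' q g) :
    ∃ (E' : FinGSet.{u} G) (c : E' →[G] E) (r' : E' →[G] P') (e' : E' →[G] A'),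
      IsPB c r' r g' ∧ IsExp b p' q' e' r' ∧ ∀ z, a' (e' z) = e (c z) := by
  have hE := isPB_pb r g'
  set c := pbFst r g'
  set r' := pbSnd r g'
  obtain ⟨w, hw1, hw2⟩ := hW.exists_lift (p.comp (e.comp c)) (q'.comp r') (fun z =>
    (h.pb.comm _).trans ((congrArg q (hE.comm z)).trans (hP.comm _)))
  obtain ⟨e', he1, he2⟩ := hA.exists_lift (e.comp c) w (fun z => (hw1 z).symm)
  have ha : ∀ z, a (p' (e' z)) = p (e (c z)) := fun z => (congrArg a (he2 z)).trans (hw1 z)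
  have hb : ∀ z, b (p' (e' z)) = q' (r' z) := fun z => (congrArg b (he2 z)).trans (hw2 z)
  refine ⟨_, c, r', e', hE, ⟨⟨hb, ?_, ?_⟩, ?_, ?_⟩, he1⟩
  · intro z z' h1 h2
    refine hE.inj _ _ (h.pb.inj _ _ ?_ ?_) h2
    · exact (ha z).symm.trans ((congrArg a h1).trans (ha z'))
    · rw [hE.comm, hE.comm]
      exact congrArg g' h2
  · intro x t hx
    obtain ⟨z₀, h1, h2⟩ := h.pb.surj (a x) (g' t)
      ((hW.comm x).trans ((congrArg g hx).trans (hP.comm t).symm))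
    obtain ⟨z, rfl, h3⟩ := hE.surj z₀ t h2
    exact ⟨z, hW.inj _ _ ((ha z).trans h1) ((hb z).trans ((congrArg q' h3).trans hx.symm)), h3⟩
  · intro t t' ht hc
    refine hP.inj _ _ (h.inj _ _ ?_ fun z z' hz hz' hzz => ?_) ht
    · rw [hP.comm, hP.comm, ht]
    · obtain ⟨z, rfl, rfl⟩ := hE.surj z t hz
      obtain ⟨z', rfl, rfl⟩ := hE.surj z' t' hz'
      have := hc z z' rfl rfl (hW.inj _ _ (by rw [ha, ha, hzz]) (by rw [hb, hb, ht]))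
      exact (he1 z).symm.trans ((congrArg a' this).trans (he1 z'))
  · intro y s hs
    choose x h1 h2 using fun x : {x // f x = g y} => hW.surj x.1 y x.2
    obtain ⟨t₀, h3, h4⟩ := h.surj (g y) (fun x' => a' (s ⟨x x', h2 x'⟩)) fun x' => by
      rw [hA.comm, hs, h1]
    obtain ⟨t, rfl, h5⟩ := hP.surj t₀ y h3
    refine ⟨t, h5, fun z w hz hzw => hA.inj _ _ ?_ (hzw.trans (hs w).symm)⟩
    have h6 : f (a w) = g y := (hW.comm w).trans (congrArg g w.2)
    refine (he1 z).trans ((h4 (c z) ⟨a w, h6⟩ ((hE.comm z).trans (congrArg g' hz)) ?_).trans ?_)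
    · rw [← ha, hzw]
    · refine congrArg (fun v => a' (s v)) (Subtype.ext (hW.inj _ _ (h1 _) ?_))
      exact (h2 _).trans w.2.symm

/-- Dependent products of fibre products. -/
theorem IsExp.exists_prod {X Y A A' B P P' Q E E' : FinGSet.{u} G} {f : X →[G] Y} {p : A →[G] X}
    {q : P →[G] Y} {e : E →[G] A} {r : E →[G] P} (h : IsExp f p q e r)
    {p' : A' →[G] X} {q' : P' →[G] Y} {e' : E' →[G] A'} {r' : E' →[G] P'}
    (h' : IsExp f p' q' e' r') {a : B →[G] A} {a' : B →[G] A'} (hB : IsPB a a' p p')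
    {m : Q →[G] P} {m' : Q →[G] P'} (hQ : IsPB m m' q q') :
    ∃ (D : FinGSet.{u} G) (c : D →[G] E) (c' : D →[G] E') (s : D →[G] Q) (d : D →[G] B),
      IsPB c s r m ∧ IsPB c' s r' m' ∧ IsExp f (p.comp a) (q.comp m) d s ∧
      (∀ z, a (d z) = e (c z)) ∧ ∀ z, a' (d z) = e' (c' z) := by
  have hD := isPB_pb r m
  set c := pbFst r m
  set s := pbSnd r m
  obtain ⟨c', hc1, hc2⟩ := h'.pb.exists_lift (p.comp (e.comp c)) (m'.comp s) (fun z =>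
    (h.pb.comm _).trans ((congrArg q (hD.comm z)).trans (hQ.comm _)))
  obtain ⟨d, hd1, hd2⟩ := hB.exists_lift (e.comp c) (e'.comp c') (fun z => (hc1 z).symm)
  have hD' : IsPB c' s r' m' := by
    refine ⟨hc2, fun z z' h1 h2 => hD.inj _ _ (h.pb.inj _ _ ?_ ?_) h2, fun z t hz => ?_⟩
    · exact (hc1 z).symm.trans ((congrArg (fun v => p' (e' v)) h1).trans (hc1 z'))
    · rw [hD.comm, hD.comm]
      exact congrArg m h2
    · obtain ⟨z₀, h1, h2⟩ := h.pb.surj (p' (e' z)) (m t)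
        ((h'.pb.comm z).trans ((congrArg q' hz).trans (hQ.comm t).symm))
      obtain ⟨w, rfl, h3⟩ := hD.surj z₀ t h2
      refine ⟨w, h'.pb.inj _ _ ((hc1 w).trans h1) ?_, h3⟩
      rw [hc2, hz]
      exact congrArg m' h3
  have key : ∀ z, p (a (d z)) = p' (e' (c' z)) := fun z =>
    (hB.comm _).trans (congrArg p' (hd2 z))
  have key' : ∀ z, p (a (d z)) = p (e (c z)) := fun z => congrArg p (hd1 z)
  refine ⟨_, c, c', s, d, hD, hD', ⟨?_, ?_, ?_⟩, hd1, hd2⟩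
  · have := h.pb.paste hD
    refine ⟨fun z => (congrArg f (key' z)).trans (this.comm z), fun z z' h1 h2 => ?_,
      fun x t ht => ?_⟩
    · exact this.inj _ _ ((key' z).symm.trans (Eq.trans h1 (key' z'))) h2
    · obtain ⟨z, h1, h2⟩ := this.surj x t ht
      exact ⟨z, (key' z).trans h1, h2⟩
  · intro t t' ht hc
    refine hQ.inj _ _ (h.inj _ _ ht fun z z' hz hz' hzz => ?_) (h'.inj _ _ ?_ fun z z' hz hz' hzz => ?_)
    · obtain ⟨z, rfl, rfl⟩ := hD.surj z t hz
      obtain ⟨z', rfl, rfl⟩ := hD.surj z' t' hz'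
      have := hc z z' rfl rfl ((key' z).trans (hzz.trans (key' z').symm))
      exact (hd1 z).symm.trans ((congrArg a this).trans (hd1 z'))
    · exact (hQ.comm t).symm.trans (Eq.trans ht (hQ.comm t'))
    · obtain ⟨z, rfl, rfl⟩ := hD'.surj z t hz
      obtain ⟨z', rfl, rfl⟩ := hD'.surj z' t' hz'
      have := hc z z' rfl rfl ((key z).trans (hzz.trans (key z').symm))
      exact (hd2 z).symm.trans ((congrArg a' this).trans (hd2 z'))
  · intro y v hv
    obtain ⟨t₁, h1, h2⟩ := h.surj y (fun x => a (v x)) hv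
    obtain ⟨t₂, h3, h4⟩ := h'.surj y (fun x => a' (v x)) fun x => (hB.comm _).symm.trans (hv x)
    obtain ⟨t, rfl, rfl⟩ := hQ.surj t₁ t₂ (h1.trans h3.symm)
    refine ⟨t, h1, fun z x hz hzx => hB.inj _ _ ?_ ?_⟩
    · rw [hd1]
      exact h2 (c z) x ((hD.comm z).trans (congrArg m hz)) ((key' z).symm.trans hzx)
    · rw [hd2]
      exact h4 (c' z) x ((hD'.comm z).trans (congrArg m' hz)) ((key z).symm.trans hzx)

end FinGSet

namespace TambaraFunctor

variable {G : Type u} [Group G]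

section

variable (T : TambaraFunctor.{u, w} G)

theorem res_res {X Y Z : FinGSet.{u} G} (g : Y →[G] Z) (f : X →[G] Y) (h : X →[G] Z)
    (e : ∀ t, h t = g (f t)) (x : T.obj Z) : T.res f (T.res g x) = T.res h x := by
  rw [← T.res_comp, show h = g.comp f from MulActionHom.ext e]

theorem nm_nm {X Y Z : FinGSet.{u} G} (g : Y →[G] Z) (f : X →[G] Y) (h : X →[G] Z)
    (e : ∀ t, h t = g (f t)) (x : T.obj X) : T.nm g (T.nm f x) = T.nm h x := by
  rw [← T.nm_comp, show h = g.comp f from MulActionHom.ext e]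

end

variable {k : TambaraFunctor.{u, w} G} {R : TambaraFunctor.{u, v} G}
  {S : TambaraFunctor.{u, w'} G} {η : Hom k R} {σ : Hom k S}

namespace AlgBox

/-- The value at `X` of the box product of two `k`-algebras over `k`. -/
abbrev Obj (η : Hom k R) (σ : Hom k S) (X : FinGSet.{u} G) : Type (max (u + 1) v w') :=
  Mod.Box η.toMod σ.toMod X

variable {X : FinGSet.{u} G}

/-- The element `tr_p (a ⊗ b)`. -/
def mk {Y : FinGSet.{u} G} (p : Y →[G] X) (a : R.obj Y) (b : S.obj Y) : Obj η σ X :=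
  Mod.Box.mk (M := η.toMod) (N := σ.toMod) p a b

theorem mk_left {Y Z : FinGSet.{u} G} (g : Y →[G] Z) (p : Z →[G] X) (a : R.obj Y) (b : S.obj Z) :
    (mk p (R.tr g a) b : Obj η σ X) = mk (p.comp g) a (S.res g b) :=
  Mod.Box.mk_left (M := η.toMod) (N := σ.toMod) g p a b

theorem mk_right {Y Z : FinGSet.{u} G} (g : Y →[G] Z) (p : Z →[G] X) (a : R.obj Z) (b : S.obj Y) :
    (mk p a (S.tr g b) : Obj η σ X) = mk (p.comp g) (R.res g a) b :=
  Mod.Box.mk_right (M := η.toMod) (N := σ.toMod) g p a b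

theorem mk_smul {Y : FinGSet.{u} G} (p : Y →[G] X) (c : k.obj Y) (a : R.obj Y) (b : S.obj Y) :
    (mk p (η.app Y c * a) b : Obj η σ X) = mk p a (σ.app Y c * b) :=
  Mod.Box.mk_smul (M := η.toMod) (N := σ.toMod) p c a b

theorem ind {P : Obj η σ X → Prop}
    (h : ∀ (Y : FinGSet.{u} G) (p : Y →[G] X) (a : R.obj Y) (b : S.obj Y), P (mk p a b))
    (x : Obj η σ X) : P x :=
  Mod.Box.ind h x

theorem mk_congr {Y : FinGSet.{u} G} {p p' : Y →[G] X} {a a' : R.obj Y} {b b' : S.obj Y}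
    (hp : ∀ t, p t = p' t) (ha : a = a') (hb : b = b') : (mk p a b : Obj η σ X) = mk p' a' b' := by
  rw [show p = p' from MulActionHom.ext hp, ha, hb]

theorem mk_iso {Y Z : FinGSet.{u} G} {g : Y →[G] Z} (hg : Function.Bijective g) {p : Y →[G] X}
    {q : Z →[G] X} {a : R.obj Y} {b : S.obj Y} {c : R.obj Z} {d : S.obj Z}
    (hp : ∀ t, p t = q (g t)) (ha : a = R.res g c) (hb : b = S.res g d) :
    (mk p a b : Obj η σ X) = mk q c d :=
  Mod.Box.mk_iso (M := η.toMod) (N := σ.toMod) hg hp ha hb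

theorem mk_eq_zero {Y : FinGSet.{u} G} (hY : IsEmpty Y) (p : Y →[G] X) (a : R.obj Y)
    (b : S.obj Y) : (mk p a b : Obj η σ X) = 0 :=
  Mod.Box.eq_zero (M := η.toMod) (N := σ.toMod) hY p a b

theorem mk_add {Y Z T : FinGSet.{u} G} {p : Y →[G] X} {a : R.obj Y} {b : S.obj Y} {q : Z →[G] X}
    {a' : R.obj Z} {b' : S.obj Z} {i : Y →[G] T} {j : Z →[G] T}
    (h : IsCoprod i j) {r : T →[G] X} (hi : ∀ t, p t = r (i t)) (hj : ∀ t, q t = r (j t))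
    {c : R.obj T} {d : S.obj T} (h1 : R.res i c = a) (h2 : R.res j c = a')
    (h3 : S.res i d = b) (h4 : S.res j d = b') :
    (mk p a b + mk q a' b' : Obj η σ X) = mk r c d :=
  Mod.Box.mk_add (M := η.toMod) (N := σ.toMod) h hi hj h1 h2 h3 h4

theorem exists_mk_add {Y Z : FinGSet.{u} G} (p : Y →[G] X) (a : R.obj Y) (b : S.obj Y)
    (q : Z →[G] X) (a' : R.obj Z) (b' : S.obj Z) :
    ∃ (c : R.obj (Y.sum Z)) (d : S.obj (Y.sum Z)), R.res (inl Y Z) c = a ∧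
      R.res (inr Y Z) c = a' ∧ S.res (inl Y Z) d = b ∧ S.res (inr Y Z) d = b' ∧
      (mk p a b + mk q a' b' : Obj η σ X) = mk (desc p q) c d := by
  obtain ⟨c, h1, h2⟩ := η.toMod.exists_pair (isCoprod_sum Y Z) a a'
  obtain ⟨d, h3, h4⟩ := σ.toMod.exists_pair (isCoprod_sum Y Z) b b'
  exact ⟨c, d, h1, h2, h3, h4, mk_add (isCoprod_sum Y Z) (fun _ => rfl) (fun _ => rfl) h1 h2 h3 h4⟩

theorem res_mk {X' Y W : FinGSet.{u} G} {f : X' →[G] X} {p : Y →[G] X} {u : W →[G] Y}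
    {q : W →[G] X'} (h : IsPB u q p f) (a : R.obj Y) (b : S.obj Y) :
    Mod.Box.res f (mk p a b : Obj η σ X) = mk q (R.res u a) (S.res u b) :=
  Mod.Box.res_mk (M := η.toMod) (N := σ.toMod) h a b

theorem tr_mk {X' Y : FinGSet.{u} G} (f : X →[G] X') (p : Y →[G] X) (a : R.obj Y) (b : S.obj Y) :
    Mod.Box.tr f (mk p a b : Obj η σ X) = mk (f.comp p) a b :=
  rfl

/-- The product of two representatives: their external product, restricted along the diagonal. -/
def mulRep (r s : Mod.BoxRep η.toMod σ.toMod X) : Obj η σ X :=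
  mk (r.map.comp (pbFst r.map s.map))
    (R.res (pbFst r.map s.map) r.fst * R.res (pbSnd r.map s.map) s.fst)
    (S.res (pbFst r.map s.map) r.snd * S.res (pbSnd r.map s.map) s.snd)

theorem mulRep_eq (r s : Mod.BoxRep η.toMod σ.toMod X) {W : FinGSet.{u} G} {u : W →[G] r.dom}
    {v : W →[G] s.dom} (h : IsPB u v r.map s.map) {q : W →[G] X} (hq : ∀ t, q t = r.map (u t)) :
    mulRep r s = mk q (R.res u r.fst * R.res v s.fst) (S.res u r.snd * S.res v s.snd) := by
  obtain ⟨A, p, a, a'⟩ := r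
  obtain ⟨B, p', b, b'⟩ := s
  change R.obj A at a
  change S.obj A at a'
  change R.obj B at b
  change S.obj B at b'
  refine (mk_iso h.pbLift_bijective hq ?_ ?_).symm
  · change R.res u a * R.res v b = R.res _ (R.res (pbFst p p') a * R.res (pbSnd p p') b)
    rw [map_mul, R.res_res _ _ u (fun _ => rfl), R.res_res _ _ v (fun _ => rfl)]
  · change S.res u a' * S.res v b' = S.res _ (S.res (pbFst p p') a' * S.res (pbSnd p p') b')
    rw [map_mul, S.res_res _ _ u (fun _ => rfl), S.res_res _ _ v (fun _ => rfl)]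

theorem mulRep_comm (r s : Mod.BoxRep η.toMod σ.toMod X) : mulRep r s = mulRep s r := by
  have h := isPB_pb s.map r.map
  rw [mulRep_eq r s h.symm (q := s.map.comp (pbFst _ _)) h.comm]
  exact mk_congr (fun _ => rfl) (mul_comm _ _) (mul_comm _ _)

theorem mulRep_congr (r r' s : Mod.BoxRep η.toMod σ.toMod X)
    (h : Mod.BoxRel η.toMod σ.toMod X r r') : mulRep r s = mulRep r' s := by
  obtain ⟨W, q, c, d⟩ := s
  change R.obj W at c
  change S.obj W at d
  cases h with
  | @left Y Z g p a b =>
    change R.obj Y at a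
    change S.obj Z at b
    obtain ⟨g', h, h'⟩ := Mod.Box.isPB_comp_aux q p g
    change mk (p.comp (pbFst p q)) (R.res (pbFst p q) (R.tr g a) * R.res (pbSnd p q) c)
      (S.res (pbFst p q) b * S.res (pbSnd p q) d) =
      mk ((p.comp g).comp (pbFst (p.comp g) q))
        (R.res (pbFst (p.comp g) q) a * R.res (pbSnd (p.comp g) q) c)
        (S.res (pbFst (p.comp g) q) (S.res g b) * S.res (pbSnd (p.comp g) q) d)
    rw [R.res_tr h, ← R.tr_mul_res, mk_left, map_mul,
      R.res_res _ _ (pbSnd (p.comp g) q) (fun t => (h' t).symm),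
      S.res_res _ _ (pbSnd (p.comp g) q) (fun t => (h' t).symm),
      S.res_res _ _ (g.comp (pbFst (p.comp g) q)) h.comm, ← S.res_comp]
    exact mk_congr (fun t => (congrArg p (h.comm t)).symm) rfl rfl
  | @right Y Z g p a b =>
    change R.obj Z at a
    change S.obj Y at b
    obtain ⟨g', h, h'⟩ := Mod.Box.isPB_comp_aux q p g
    change mk (p.comp (pbFst p q)) (R.res (pbFst p q) a * R.res (pbSnd p q) c)
      (S.res (pbFst p q) (S.tr g b) * S.res (pbSnd p q) d) =
      mk ((p.comp g).comp (pbFst (p.comp g) q))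
        (R.res (pbFst (p.comp g) q) (R.res g a) * R.res (pbSnd (p.comp g) q) c)
        (S.res (pbFst (p.comp g) q) b * S.res (pbSnd (p.comp g) q) d)
    rw [S.res_tr h, ← S.tr_mul_res, mk_right, map_mul,
      R.res_res _ _ (pbSnd (p.comp g) q) (fun t => (h' t).symm),
      S.res_res _ _ (pbSnd (p.comp g) q) (fun t => (h' t).symm),
      R.res_res _ _ (g.comp (pbFst (p.comp g) q)) h.comm, ← R.res_comp]
    exact mk_congr (fun t => (congrArg p (h.comm t)).symm) rfl rfl
  | @smul Y p z a b =>
    change R.obj Y at a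
    change S.obj Y at b
    change mk (p.comp (pbFst p q)) (R.res (pbFst p q) (η.app _ z * a) * R.res (pbSnd p q) c)
      (S.res (pbFst p q) b * S.res (pbSnd p q) d) =
      mk (p.comp (pbFst p q)) (R.res (pbFst p q) a * R.res (pbSnd p q) c)
        (S.res (pbFst p q) (σ.app _ z * b) * S.res (pbSnd p q) d)
    rw [map_mul, map_mul, ← η.app_res, ← σ.app_res, mul_assoc, mul_assoc, mk_smul]

instance : Mul (Obj η σ X) where
  mul x y := Quot.liftOn₂ x y mulRep
    (fun r s s' h => by rw [mulRep_comm, mulRep_congr s s' r h, mulRep_comm])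
    (fun r r' s h => mulRep_congr r r' s h)

theorem mk_mul {Y Z W : FinGSet.{u} G} {p : Y →[G] X} {q : Z →[G] X} {u : W →[G] Y}
    {v : W →[G] Z} (h : IsPB u v p q) {r : W →[G] X} (hr : ∀ t, r t = p (u t))
    (a : R.obj Y) (b : S.obj Y) (c : R.obj Z) (d : S.obj Z) :
    (mk p a b * mk q c d : Obj η σ X) = mk r (R.res u a * R.res v c) (S.res u b * S.res v d) :=
  mulRep_eq ⟨Y, p, a, b⟩ ⟨Z, q, c, d⟩ h hr

instance : One (Obj η σ X) := ⟨mk (MulActionHom.id G) 1 1⟩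

theorem one_def : (1 : Obj η σ X) = mk (MulActionHom.id G) 1 1 := rfl

theorem mul_comm' (x y : Obj η σ X) : x * y = y * x := by
  induction x using ind with | h Y p a b
  induction y using ind with | h Y' p' a' b'
  exact mulRep_comm ⟨Y, p, a, b⟩ ⟨Y', p', a', b'⟩

theorem one_mul' (x : Obj η σ X) : 1 * x = x := by
  induction x using ind with | h Y p a b
  rw [one_def, mk_mul (isPB_id_id p).symm (r := p) (fun _ => rfl)]
  simp [R.res_id, S.res_id]

theorem mul_add' (x y z : Obj η σ X) : x * (y + z) = x * y + x * z := by
  induction x using ind with | h Y p a b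
  induction y using ind with | h Z q c d
  induction z using ind with | h Z' q' c' d'
  obtain ⟨cc, dd, r1, r2, r3, r4, e⟩ := exists_mk_add (η := η) (σ := σ) q c d q' c' d'
  have hT := isPB_pb p (desc q q')
  rw [e, mk_mul (isPB_pb p q) (r := p.comp (pbFst p q)) (fun _ => rfl),
    mk_mul (isPB_pb p q') (r := p.comp (pbFst p q')) (fun _ => rfl),
    mk_mul hT (r := p.comp (pbFst p (desc q q'))) (fun _ => rfl)]
  have h1 : IsPB (pbSnd p q)
      (pbLift (pbFst p q) ((inl Z Z').comp (pbSnd p q)) fun t => t.2 :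
        pb p q →[G] pb p (desc q q')) (inl Z Z') (pbSnd p (desc q q')) :=
    (IsPB.cancel hT (d := pbSnd p q) (k := inl Z Z') (ac := pbFst p q) (fun _ => rfl)
      (fun _ => rfl) (isPB_pb p q)).symm
  have h2 : IsPB (pbSnd p q')
      (pbLift (pbFst p q') ((inr Z Z').comp (pbSnd p q')) fun t => t.2 :
        pb p q' →[G] pb p (desc q q')) (inr Z Z') (pbSnd p (desc q q')) :=
    (IsPB.cancel hT (d := pbSnd p q') (k := inr Z Z') (ac := pbFst p q') (fun _ => rfl)
      (fun _ => rfl) (isPB_pb p q')).symm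
  symm
  refine mk_add ((isCoprod_sum Z Z').pullback h1 h2) (fun _ => rfl) (fun _ => rfl) ?_ ?_ ?_ ?_
  · rw [map_mul, R.res_res _ _ (pbFst p q) (fun _ => rfl),
      R.res_res _ _ ((inl Z Z').comp (pbSnd p q)) (fun _ => rfl), R.res_comp, r1]
  · rw [map_mul, R.res_res _ _ (pbFst p q') (fun _ => rfl),
      R.res_res _ _ ((inr Z Z').comp (pbSnd p q')) (fun _ => rfl), R.res_comp, r2]
  · rw [map_mul, S.res_res _ _ (pbFst p q) (fun _ => rfl),
      S.res_res _ _ ((inl Z Z').comp (pbSnd p q)) (fun _ => rfl), S.res_comp, r3]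
  · rw [map_mul, S.res_res _ _ (pbFst p q') (fun _ => rfl),
      S.res_res _ _ ((inr Z Z').comp (pbSnd p q')) (fun _ => rfl), S.res_comp, r4]

theorem mul_assoc' (x y z : Obj η σ X) : x * y * z = x * (y * z) := by
  induction x using ind with | h A p a a'
  induction y using ind with | h B q b b'
  induction z using ind with | h C r c c'
  have h1 := isPB_pb p q
  have h2 := isPB_pb q r
  have h3 := isPB_pb (p.comp (pbFst p q)) r
  set D := pb (p.comp (pbFst p q)) r
  set α := pbFst (p.comp (pbFst p q)) r
  set β := pbSnd (p.comp (pbFst p q)) r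
  let γ : D →[G] pb q r := pbLift ((pbSnd p q).comp α) β fun t => (h1.comm _).symm.trans (h3.comm t)
  have h4 : IsPB ((pbFst p q).comp α) γ p (q.comp (pbFst q r)) := by
    refine ⟨fun t => h1.comm _, fun t t' e e' => ?_, fun x w e => ?_⟩
    · have e1 : pbSnd p q (α t) = pbSnd p q (α t') := congrArg (pbFst q r) e'
      have e2 : β t = β t' := congrArg (pbSnd q r) e'
      exact h3.inj _ _ (h1.inj _ _ e e1) e2
    · obtain ⟨s, hs, hs'⟩ := h1.surj x (pbFst q r w) e
      obtain ⟨t, rfl, ht⟩ := h3.surj s (pbSnd q r w) ((congrArg p hs).trans (e.trans (h2.comm w)))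
      exact ⟨t, hs, h2.inj _ _ hs' ht⟩
  rw [mk_mul h1 (r := p.comp (pbFst p q)) (fun _ => rfl),
    mk_mul h3 (r := (p.comp (pbFst p q)).comp α) (fun _ => rfl),
    mk_mul h2 (r := q.comp (pbFst q r)) (fun _ => rfl),
    mk_mul h4 (r := (p.comp (pbFst p q)).comp α) (fun _ => rfl)]
  refine mk_congr (fun _ => rfl) ?_ ?_
  · rw [map_mul, map_mul, ← mul_assoc, R.res_res _ _ ((pbFst p q).comp α) (fun _ => rfl),
      R.res_res _ _ ((pbSnd p q).comp α) (fun _ => rfl),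
      R.res_res _ _ ((pbSnd p q).comp α) (fun _ => rfl), R.res_res _ _ β (fun _ => rfl)]
  · rw [map_mul, map_mul, ← mul_assoc, S.res_res _ _ ((pbFst p q).comp α) (fun _ => rfl),
      S.res_res _ _ ((pbSnd p q).comp α) (fun _ => rfl),
      S.res_res _ _ ((pbSnd p q).comp α) (fun _ => rfl), S.res_res _ _ β (fun _ => rfl)]

theorem zero_mul' (x : Obj η σ X) : 0 * x = 0 := by
  induction x using ind with | h Y p a b
  have e : (0 : Obj η σ X) = mk (ofEmp X) 0 0 := rfl
  rw [e, mk_mul (isPB_pb (ofEmp X) p) (r := (ofEmp X).comp (pbFst _ _)) (fun _ => rfl), ← e]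
  exact mk_eq_zero ⟨fun t => (pbFst (ofEmp X) p t).elim⟩ _ _ _

noncomputable instance : CommRing (Obj η σ X) where
  __ := (inferInstance : AddCommGroup (Obj η σ X))
  mul_assoc := mul_assoc'
  one_mul := one_mul'
  mul_one x := (mul_comm' x 1).trans (one_mul' x)
  left_distrib := mul_add'
  right_distrib x y z := by rw [mul_comm', mul_add', mul_comm' z, mul_comm' z]
  zero_mul := zero_mul'
  mul_zero x := (mul_comm' x 0).trans (zero_mul' x)
  mul_comm := mul_comm'

/-- Restrictions are ring homomorphisms. -/
noncomputable def res {X' : FinGSet.{u} G} (f : X' →[G] X) : Obj η σ X →+* Obj η σ X' where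
  __ := (Mod.Box.res f : Obj η σ X →+ Obj η σ X')
  map_one' := by
    change Mod.Box.res f (1 : Obj η σ X) = 1
    rw [one_def, res_mk (isPB_id_id f).symm, map_one, map_one, one_def]
  map_mul' x y := by
    change Mod.Box.res f (x * y) = Mod.Box.res f x * Mod.Box.res f y
    induction x using ind with | h A p a a'
    induction y using ind with | h B q b b'
    have h1 := isPB_pb p q
    have h2 := isPB_pb p f
    have h3 := isPB_pb q f
    have h4 := isPB_pb (pbSnd p f) (pbSnd q f)
    set α := pbFst (pbSnd p f) (pbSnd q f)
    set β := pbSnd (pbSnd p f) (pbSnd q f)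
    let γ : pb (pbSnd p f) (pbSnd q f) →[G] pb p q :=
      pbLift ((pbFst p f).comp α) ((pbFst q f).comp β) fun t =>
        (h2.comm _).trans ((congrArg f (h4.comm t)).trans (h3.comm _).symm)
    have h5 : IsPB γ ((pbSnd p f).comp α) (p.comp (pbFst p q)) f := by
      refine ⟨fun t => h2.comm _, fun t t' e e' => ?_, fun w x e => ?_⟩
      · have e1 : pbFst p f (α t) = pbFst p f (α t') := congrArg (pbFst p q) e
        have e2 : pbFst q f (β t) = pbFst q f (β t') := congrArg (pbSnd p q) e
        refine h4.inj _ _ (h2.inj _ _ e1 e') (h3.inj _ _ e2 ?_)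
        exact (h4.comm t).symm.trans (Eq.trans e' (h4.comm t'))
      · obtain ⟨s, hs, hs'⟩ := h2.surj (pbFst p q w) x e
        obtain ⟨s', hs2, hs2'⟩ := h3.surj (pbSnd p q w) x ((h1.comm w).symm.trans e)
        obtain ⟨t, rfl, rfl⟩ := h4.surj s s' (hs'.trans hs2'.symm)
        exact ⟨t, h1.inj _ _ hs hs2, hs'⟩
    rw [mk_mul h1 (r := p.comp (pbFst p q)) (fun _ => rfl), res_mk h5, res_mk h2, res_mk h3,
      mk_mul h4 (r := (pbSnd p f).comp α) (fun _ => rfl)]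
    refine mk_congr (fun _ => rfl) ?_ ?_
    · rw [map_mul, R.res_res _ _ ((pbFst p f).comp α) (fun _ => rfl),
        R.res_res _ _ ((pbFst q f).comp β) (fun _ => rfl), ← R.res_comp, ← R.res_comp]
    · rw [map_mul, S.res_res _ _ ((pbFst p f).comp α) (fun _ => rfl),
        S.res_res _ _ ((pbFst q f).comp β) (fun _ => rfl), ← S.res_comp, ← S.res_comp]

/-- The norm of a representative: the norm of `tr_p (a ⊗ b)` along `f` is, by the distributive law,
`tr_q (nm_r (e^* a) ⊗ nm_r (e^* b))`, where `q`, `e` and `r` form the exponential diagram of `f`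
and `p`. -/
def nmRep {X' : FinGSet.{u} G} (f : X →[G] X') (r : Mod.BoxRep η.toMod σ.toMod X) : Obj η σ X' :=
  mk (dprodMap f r.map) (R.nm (dprodR f r.map) (R.res (dprodE f r.map) r.fst))
    (S.nm (dprodR f r.map) (S.res (dprodE f r.map) r.snd))

theorem nmRep_eq {X' : FinGSet.{u} G} {f : X →[G] X'} (x : Mod.BoxRep η.toMod σ.toMod X)
    {P E : FinGSet.{u} G} {q : P →[G] X'} {e : E →[G] x.dom} {r : E →[G] P}
    (h : IsExp f x.map q e r) :
    nmRep f x = mk q (R.nm r (R.res e x.fst)) (S.nm r (S.res e x.snd)) := by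
  obtain ⟨Y, p, a, b⟩ := x
  change R.obj Y at a
  change S.obj Y at b
  obtain ⟨g, g', hg, hpb, hq, he⟩ := (isExp_dprod f p).exists_iso h
  refine (mk_iso hg (fun t => (hq t).symm) ?_ ?_).symm
  · change R.nm r (R.res e a) = R.res g (R.nm (dprodR f p) (R.res (dprodE f p) a))
    rw [R.res_nm hpb, R.res_res _ _ e (fun z => (he z).symm)]
  · change S.nm r (S.res e b) = S.res g (S.nm (dprodR f p) (S.res (dprodE f p) b))
    rw [S.res_nm hpb, S.res_res _ _ e (fun z => (he z).symm)]

theorem nmRep_congr {X' : FinGSet.{u} G} (f : X →[G] X') (r r' : Mod.BoxRep η.toMod σ.toMod X)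
    (h : Mod.BoxRel η.toMod σ.toMod X r r') : nmRep f r = nmRep f r' := by
  cases h with
  | @left Y Z g p a b =>
    change R.obj Y at a
    change S.obj Z at b
    have h := isExp_dprod f p
    have hD := isPB_pb g (dprodE f p)
    have h' := isExp_dprod (dprodR f p) (pbSnd g (dprodE f p))
    rw [nmRep_eq _ h, nmRep_eq _ (h.comp_right hD h')]
    dsimp only
    change mk _ (R.nm _ (R.res _ (R.tr g a))) _ =
      mk _ _ (S.nm _ (S.res _ (S.res g b)))
    rw [R.res_tr hD, R.nm_tr h', mk_left, S.res_nm h'.pb, ← R.res_comp, ← S.res_comp,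
      ← S.res_comp]
    refine mk_congr (fun _ => rfl) rfl (congrArg _ ?_)
    exact congrArg (fun j => S.res j b) (MulActionHom.ext fun z => (hD.comm _).symm)
  | @right Y Z g p a b =>
    change R.obj Z at a
    change S.obj Y at b
    have h := isExp_dprod f p
    have hD := isPB_pb g (dprodE f p)
    have h' := isExp_dprod (dprodR f p) (pbSnd g (dprodE f p))
    rw [nmRep_eq _ h, nmRep_eq _ (h.comp_right hD h')]
    dsimp only
    change mk _ _ (S.nm _ (S.res _ (S.tr g b))) =
      mk _ (R.nm _ (R.res _ (R.res g a))) _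
    rw [S.res_tr hD, S.nm_tr h', mk_right, R.res_nm h'.pb, ← R.res_comp, ← S.res_comp,
      ← R.res_comp]
    refine mk_congr (fun _ => rfl) (congrArg _ ?_) rfl
    exact congrArg (fun j => R.res j a) (MulActionHom.ext fun z => (hD.comm _).symm)
  | @smul Y p z a b =>
    change R.obj Y at a
    change S.obj Y at b
    change mk _ (R.nm _ (R.res _ (η.app _ z * a))) _ = mk _ _ (S.nm _ (S.res _ (σ.app _ z * b)))
    rw [map_mul, map_mul, map_mul, map_mul, ← η.app_res, ← σ.app_res, ← η.app_nm, ← σ.app_nm,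
      mk_smul]

/-- The underlying map of the norm. -/
def nmFun {X' : FinGSet.{u} G} (f : X →[G] X') (x : Obj η σ X) : Obj η σ X' :=
  Quot.liftOn x (nmRep f) (nmRep_congr f)

theorem nmFun_mk {X' Y P E : FinGSet.{u} G} {f : X →[G] X'} {p : Y →[G] X} {q : P →[G] X'}
    {e : E →[G] Y} {r : E →[G] P} (h : IsExp f p q e r) (a : R.obj Y) (b : S.obj Y) :
    nmFun f (mk p a b : Obj η σ X) = mk q (R.nm r (R.res e a)) (S.nm r (S.res e b)) :=
  nmRep_eq ⟨Y, p, a, b⟩ h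

/-- Norms are multiplicative. -/
noncomputable def nm {X' : FinGSet.{u} G} (f : X →[G] X') : Obj η σ X →* Obj η σ X' where
  toFun := nmFun f
  map_one' := by
    rw [one_def, nmFun_mk (isExp_one f), R.res_id, S.res_id, map_one, map_one, one_def]
  map_mul' x y := by
    induction x using ind with | h A p a a'
    induction y using ind with | h B q b b'
    have h := isExp_dprod f p
    have h' := isExp_dprod f q
    have hB := isPB_pb p q
    have hQ := isPB_pb (dprodMap f p) (dprodMap f q)
    obtain ⟨D, c, c', s, d, h1, h2, h3, h4, h5⟩ := h.exists_prod h' hB hQ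
    rw [mk_mul hB (r := p.comp (pbFst p q)) (fun _ => rfl), nmFun_mk h3, nmFun_mk h, nmFun_mk h',
      mk_mul hQ (r := (dprodMap f p).comp (pbFst _ _)) (fun _ => rfl)]
    refine mk_congr (fun _ => rfl) ?_ ?_
    · rw [map_mul, map_mul, R.res_nm h1, R.res_nm h2,
        R.res_res _ _ ((dprodE f p).comp c) (fun z => (h4 z).symm), R.res_res _ _ ((dprodE f q).comp c') (fun z => (h5 z).symm),
        R.res_comp, R.res_comp]
    · rw [map_mul, map_mul, S.res_nm h1, S.res_nm h2,
        S.res_res _ _ ((dprodE f p).comp c) (fun z => (h4 z).symm), S.res_res _ _ ((dprodE f q).comp c') (fun z => (h5 z).symm),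
        S.res_comp, S.res_comp]

theorem nm_mk {X' Y P E : FinGSet.{u} G} {f : X →[G] X'} {p : Y →[G] X} {q : P →[G] X'}
    {e : E →[G] Y} {r : E →[G] P} (h : IsExp f p q e r) (a : R.obj Y) (b : S.obj Y) :
    nm f (mk p a b : Obj η σ X) = mk q (R.nm r (R.res e a)) (S.nm r (S.res e b)) :=
  nmRep_eq ⟨Y, p, a, b⟩ h

end AlgBox

/-- The box product of two `k`-algebras over `k`, as a Tambara functor. Its underlying Mackey
functor is the box product of the underlying modules, products are given by
`tr_p (a ⊗ b) * tr_q (c ⊗ d) = tr (a c ⊗ b d)` on the fibre product of `p` and `q`, and norms by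
`nm (a ⊗ b) = nm a ⊗ nm b` and the distributive law. -/
noncomputable def algBox (η : Hom k R) (σ : Hom k S) :
    TambaraFunctor.{u, max (u + 1) v w'} G where
  obj := AlgBox.Obj η σ
  res := AlgBox.res
  tr := Mod.Box.tr
  nm := AlgBox.nm
  res_id := Mod.Box.res_id
  tr_id := Mod.Box.tr_id
  nm_id x := by
    induction x using AlgBox.ind with | h A p a b
    rw [AlgBox.nm_mk (isExp_id p), R.res_id, S.res_id, R.nm_id, S.nm_id]
  res_comp := Mod.Box.res_comp
  tr_comp := Mod.Box.tr_comp
  nm_comp g f x := by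
    induction x using AlgBox.ind with | h A p a b
    have h := isExp_dprod f p
    have h' := isExp_dprod g (dprodMap f p)
    have hD := isPB_pb (dprodR f p) (dprodE g (dprodMap f p))
    rw [AlgBox.nm_mk (h.comp_left h' hD), AlgBox.nm_mk h, AlgBox.nm_mk h', R.res_nm hD,
      S.res_nm hD, R.res_comp, S.res_comp, R.nm_comp, S.nm_comp]
  empty _ := Mod.Box.subsingleton
  coprod := Mod.Box.coprod
  res_tr := Mod.Box.res_tr
  res_nm {W X Y Z a b f g} hW x := by
    induction x using AlgBox.ind with | h A p c d
    have h := isExp_dprod f p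
    have hA := isPB_pb p a
    have hP := isPB_pb (dprodMap f p) g
    obtain ⟨E', u, r', e', h1, h2, h3⟩ := h.exists_base_change hW hA hP
    change Mod.Box.res g (AlgBox.nm f (AlgBox.mk p c d)) =
      AlgBox.nm b (Mod.Box.res a (AlgBox.mk p c d))
    rw [AlgBox.nm_mk h, AlgBox.res_mk hP, AlgBox.res_mk hA, AlgBox.nm_mk h2, R.res_nm h1,
      S.res_nm h1, R.res_res _ _ ((dprodE f p).comp u) (fun z => (h3 z).symm),
      S.res_res _ _ ((dprodE f p).comp u) (fun z => (h3 z).symm), R.res_comp, S.res_comp]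
  nm_tr {X Y A P E f g q e r} h x := by
    induction x using AlgBox.ind with | h B p a b
    have hD := isPB_pb p e
    have h' := isExp_dprod r (pbSnd p e)
    change AlgBox.nm f (Mod.Box.tr g (AlgBox.mk p a b)) =
      Mod.Box.tr q (AlgBox.nm r (Mod.Box.res e (AlgBox.mk p a b)))
    rw [AlgBox.tr_mk, AlgBox.nm_mk (h.comp_right hD h'), AlgBox.res_mk hD, AlgBox.nm_mk h',
      AlgBox.tr_mk, R.res_comp, S.res_comp]
  tr_mul_res {X Y} f x y := by
    induction x using AlgBox.ind with | h A p a b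
    induction y using AlgBox.ind with | h B q c d
    change Mod.Box.tr f (AlgBox.mk p a b * Mod.Box.res f (AlgBox.mk q c d)) =
      Mod.Box.tr f (AlgBox.mk p a b) * AlgBox.mk q c d
    have h1 := isPB_pb q f
    have h2 := isPB_pb p (pbSnd q f)
    rw [AlgBox.res_mk h1, AlgBox.mk_mul h2 (r := p.comp (pbFst _ _)) (fun _ => rfl),
      AlgBox.tr_mk, AlgBox.tr_mk,
      AlgBox.mk_mul (h1.paste h2.symm).symm (r := f.comp (p.comp (pbFst _ _))) (fun _ => rfl),
      R.res_comp, S.res_comp]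

/-- The underlying map of the multiplication `R ⊠ R → R`. -/
def AlgBox.mulFun {η : Hom k R} {X : FinGSet.{u} G} (x : AlgBox.Obj η η X) : R.obj X :=
  Quot.liftOn x (fun r => R.tr r.map (HMul.hMul (α := R.obj r.dom) (β := R.obj r.dom) r.fst r.snd))
    fun r r' h => by
      cases h with
      | @left Y Z g p a b =>
        change R.obj Y at a
        change R.obj Z at b
        change R.tr p (R.tr g a * b) = R.tr (p.comp g) (a * R.res g b)
        rw [← R.tr_mul_res, R.tr_comp]
      | @right Y Z g p a b =>
        change R.obj Z at a
        change R.obj Y at b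
        change R.tr p (a * R.tr g b) = R.tr (p.comp g) (R.res g a * b)
        rw [mul_comm, ← R.tr_mul_res, R.tr_comp, mul_comm]
      | @smul Y p c a b =>
        change R.obj Y at a
        change R.obj Y at b
        change R.tr p (η.app Y c * a * b) = R.tr p (a * (η.app Y c * b))
        rw [mul_left_comm, mul_assoc]

theorem AlgBox.mulFun_mk {η : Hom k R} {X Y : FinGSet.{u} G} (p : Y →[G] X) (a b : R.obj Y) :
    AlgBox.mulFun (AlgBox.mk p a b : AlgBox.Obj η η X) = R.tr p (a * b) :=
  rfl

/-- The multiplication morphism `R ⊠ R → R` of a `k`-algebra, `tr_p (a ⊗ b) ↦ tr_p (a b)`. -/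
noncomputable def mulHom (η : Hom k R) : Hom (algBox η η) R where
  app X :=
    { toFun := AlgBox.mulFun (η := η)
      map_one' := by
        change R.tr (MulActionHom.id G) (1 * 1) = 1
        rw [R.tr_id, one_mul]
      map_mul' := fun (x y : AlgBox.Obj η η X) => by
        induction x using AlgBox.ind with | h A p a b
        induction y using AlgBox.ind with | h B q c d
        have h := isPB_pb p q
        rw [AlgBox.mulFun_mk, AlgBox.mulFun_mk]
        change R.tr (p.comp (pbFst p q)) ((R.res (pbFst p q) a * R.res (pbSnd p q) c) *
          (R.res (pbFst p q) b * R.res (pbSnd p q) d)) = R.tr p (a * b) * R.tr q (c * d)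
        rw [mul_mul_mul_comm, ← map_mul (R.res _), ← map_mul (R.res _), R.tr_comp,
          mul_comm (R.res _ _), R.tr_mul_res, ← R.res_tr h.symm, ← R.tr_mul_res, mul_comm]
      map_zero' := by
        change R.tr (ofEmp X) (0 * 0) = 0
        rw [mul_zero, map_zero]
      map_add' := fun (x y : AlgBox.Obj η η X) => by
        change AlgBox.mulFun (x + y) = AlgBox.mulFun x + AlgBox.mulFun y
        induction x using AlgBox.ind with | h A p a b
        induction y using AlgBox.ind with | h B q c d
        obtain ⟨u, v, r1, r2, r3, r4, e⟩ := AlgBox.exists_mk_add (η := η) (σ := η) p a b q c d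
        rw [e, AlgBox.mulFun_mk, AlgBox.mulFun_mk, AlgBox.mulFun_mk]
        have h : u * v = R.tr (inl A B) (R.res (inl A B) (u * v)) +
          R.tr (inr A B) (R.res (inr A B) (u * v)) :=
          η.toMod.eq_tr_add_tr (isCoprod_sum A B) (u * v)
        rw [h, map_mul (R.res (inl A B)), map_mul (R.res (inr A B)), r1, r2, r3, r4, map_add, ← R.tr_comp, ← R.tr_comp]
        rfl }
  app_res {X Y} f x := by
    induction x using AlgBox.ind with | h A p a b
    have h := isPB_pb p f
    change R.tr (pbSnd p f) (R.res (pbFst p f) a * R.res (pbFst p f) b) = R.res f (R.tr p (a * b))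
    rw [R.res_tr h, map_mul (R.res _)]
  app_tr f x := by
    induction x using AlgBox.ind with | h A p a b
    exact R.tr_comp f p (a * b)
  app_nm f x := by
    induction x using AlgBox.ind with | h A p a b
    change R.tr (dprodMap f p) (R.nm (dprodR f p) (R.res (dprodE f p) a) *
      R.nm (dprodR f p) (R.res (dprodE f p) b)) = R.nm f (R.tr p (a * b))
    rw [R.nm_tr (isExp_dprod f p), map_mul (R.res _), map_mul (R.nm _)]

/-- An ideal of a Tambara functor: a family of ideals which is closed under restrictions, transfers
and norms (along surjective maps, so that the norm of `0` is `0`). -/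
structure TIdeal (T : TambaraFunctor.{u, w} G) where
  carrier : ∀ X : FinGSet.{u} G, Ideal (T.obj X)
  res_mem : ∀ {X Y : FinGSet G} (f : X →[G] Y) (x : T.obj Y), x ∈ carrier Y →
    T.res f x ∈ carrier X
  tr_mem : ∀ {X Y : FinGSet G} (f : X →[G] Y) (x : T.obj X), x ∈ carrier X →
    T.tr f x ∈ carrier Y
  nm_mem : ∀ {X Y : FinGSet G} (f : X →[G] Y), Function.Surjective f → ∀ x : T.obj X,
    x ∈ carrier X → T.nm f x ∈ carrier Y

theorem nm_zero (T : TambaraFunctor.{u, w} G) {X Y : FinGSet.{u} G} (f : X →[G] Y)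
    (hf : Function.Surjective f) : T.nm f 0 = 0 := by
  have h : IsExp f (ofEmp X) (ofEmp Y) (MulActionHom.id G) (MulActionHom.id G) :=
    ⟨⟨fun t => t.elim, fun t => t.elim, fun _ t => t.elim⟩, fun t => t.elim, fun y s _ => by
      obtain ⟨x, hx⟩ := hf y
      exact (s ⟨x, hx⟩).elim⟩
  rw [← map_zero (T.tr (ofEmp X)), T.nm_tr h]
  have := T.empty (emp G) inferInstance
  rw [Subsingleton.elim (T.nm _ _) 0, map_zero]

/-- The kernel of a morphism of Tambara functors. -/
def Hom.ker {T : TambaraFunctor.{u, w} G} {U : TambaraFunctor.{u, w'} G} (φ : Hom T U) :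
    TIdeal T where
  carrier X := RingHom.ker (φ.app X)
  res_mem f x h := by
    rw [RingHom.mem_ker] at h ⊢
    rw [φ.app_res, h, map_zero]
  tr_mem f x h := by
    rw [RingHom.mem_ker] at h ⊢
    rw [φ.app_tr, h, map_zero]
  nm_mem f hf x h := by
    rw [RingHom.mem_ker] at h ⊢
    rw [φ.app_nm, h, U.nm_zero f hf]

/-- `J` contains all nontrivial norms of elements of `I`: all products of two elements of `I`, and
all norms of elements of `I` along a map of transitive `G`-sets which is not injective, that is,
along a map `G/K → G/H` with `K` conjugate to a proper subgroup of `H`. -/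
def TIdeal.ContainsNorms {T : TambaraFunctor.{u, w} G} (I J : TIdeal T) : Prop :=
  (∀ (X : FinGSet.{u} G) (x y : T.obj X), x ∈ I.carrier X → y ∈ I.carrier X →
    x * y ∈ J.carrier X) ∧
  ∀ (X Y : FinGSet.{u} G) (f : X →[G] Y), MulAction.IsPretransitive G X →
    MulAction.IsPretransitive G Y → ¬ Function.Injective f → ∀ x ∈ I.carrier X,
      T.nm f x ∈ J.carrier Y

/-- The ideal `I^{>1}` generated by all nontrivial norms (including products) of elements of `I`. -/
def TIdeal.gtOne {T : TambaraFunctor.{u, w} G} (I : TIdeal T) : TIdeal T where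
  carrier X := ⨅ (J : TIdeal T) (_ : I.ContainsNorms J), J.carrier X
  res_mem f x h := by
    simp only [Submodule.mem_iInf] at h ⊢
    exact fun J hJ => J.res_mem f x (h J hJ)
  tr_mem f x h := by
    simp only [Submodule.mem_iInf] at h ⊢
    exact fun J hJ => J.tr_mem f x (h J hJ)
  nm_mem f hf x h := by
    simp only [Submodule.mem_iInf] at h ⊢
    exact fun J hJ => J.nm_mem f hf x (h J hJ)

/-- The value at `X` of the genuine Kähler differentials `I / I^{>1}` of a `k`-algebra `R`, where `I`
is the kernel of the multiplication `R ⊠ R → R`. -/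
def Kaehler (η : Hom k R) (X : FinGSet.{u} G) : Type (max (u + 1) v) :=
  (mulHom η).ker.carrier X ⧸
    Submodule.comap ((mulHom η).ker.carrier X).subtype ((mulHom η).ker.gtOne.carrier X)

/-- A `k`-algebra is formally étale if it is flat as a `k`-module and its genuine Kähler
differentials vanish. -/
def Hom.IsFormallyEtale {k R : TambaraFunctor.{u, w} G} (η : Hom k R) : Prop :=
  (∀ X, Subsingleton (Kaehler η X)) ∧ η.toMod.IsFlat

/-- A `k`-algebra is étale if it is formally étale and finitely presented. -/
def Hom.IsEtale {k R : TambaraFunctor.{u, w} G} (η : Hom k R) : Prop :=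
  η.IsFormallyEtale ∧ η.IsFinPres

end TambaraFunctor

namespace FinGSet

variable {G : Type u} [Group G]

/-- Products of finite `G`-sets. -/
def prod (X Y : FinGSet.{u} G) : FinGSet.{u} G where
  carrier := X × Y

/-- The first projection. -/
def prodFst (X Y : FinGSet.{u} G) : prod X Y →[G] X := ⟨Prod.fst, fun _ _ => rfl⟩

/-- The second projection. -/
def prodSnd (X Y : FinGSet.{u} G) : prod X Y →[G] Y := ⟨Prod.snd, fun _ _ => rfl⟩

/-- The map into a product with given components. -/
def prodLift {W X Y : FinGSet.{u} G} (f : W →[G] X) (g : W →[G] Y) : W →[G] prod X Y :=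
  ⟨fun t => (f t, g t), fun m t => Prod.ext (map_smul f m t) (map_smul g m t)⟩

/-- The product of an equivariant map with a fixed `G`-set on the right. -/
def prodMap {X Y : FinGSet.{u} G} (f : X →[G] Y) (Z : FinGSet.{u} G) : prod X Z →[G] prod Y Z :=
  prodLift (f.comp (prodFst X Z)) (prodSnd X Z)

/-- The product of an equivariant map with a fixed `G`-set on the left. -/
def prodMapRight (X : FinGSet.{u} G) {Y Z : FinGSet.{u} G} (f : Y →[G] Z) :
    prod X Y →[G] prod X Z :=
  prodLift (prodFst X Y) (f.comp (prodSnd X Y))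

theorem isPB_prodFst {X Y : FinGSet.{u} G} (f : X →[G] Y) (Z : FinGSet.{u} G) :
    IsPB (prodFst X Z) (prodMap f Z) f (prodFst Y Z) where
  comm _ := rfl
  inj _ _ h h' := Prod.ext h (congrArg (fun t : Y × Z => t.2) h')
  surj := by
    rintro x ⟨y, z⟩ h
    exact ⟨(x, z), rfl, Prod.ext h rfl⟩

theorem IsPB.prodMap {W X Y Z : FinGSet.{u} G} {a : W →[G] X} {b : W →[G] Y} {f : X →[G] Z}
    {g : Y →[G] Z} (h : IsPB a b f g) (V : FinGSet.{u} G) :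
    IsPB (prodMap a V) (prodMap b V) (prodMap f V) (prodMap g V) where
  comm t := Prod.ext (h.comm t.1) rfl
  inj _ _ e e' := Prod.ext (h.inj _ _ (congrArg (fun t : X × V => t.1) e)
    (congrArg (fun t : Y × V => t.1) e')) (congrArg (fun t : X × V => t.2) e)
  surj := by
    rintro ⟨x, z⟩ ⟨y, z'⟩ e
    obtain ⟨t, rfl, rfl⟩ := h.surj x y (congrArg (fun t : Z × V => t.1) e)
    obtain rfl : z = z' := congrArg (fun t : Z × V => t.2) e
    exact ⟨(t, z), rfl, rfl⟩

theorem IsCoprod.prodMap {X Y Z : FinGSet.{u} G} {i : X →[G] Z} {j : Y →[G] Z}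
    (h : IsCoprod i j) (V : FinGSet.{u} G) :
    IsCoprod (FinGSet.prodMap i V) (FinGSet.prodMap j V) where
  inj_left _ _ e := Prod.ext (h.inj_left (congrArg (fun t : Z × V => t.1) e))
    (congrArg (fun t : Z × V => t.2) e)
  inj_right _ _ e := Prod.ext (h.inj_right (congrArg (fun t : Z × V => t.1) e))
    (congrArg (fun t : Z × V => t.2) e)
  disj _ _ e := h.disj _ _ (congrArg (fun t : Z × V => t.1) e)
  surj := by
    rintro ⟨z, v⟩
    obtain ⟨x, rfl⟩ | ⟨y, rfl⟩ := h.surj z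
    · exact Or.inl ⟨(x, v), rfl⟩
    · exact Or.inr ⟨(y, v), rfl⟩

theorem isPB_prodMapRight {X X' Y Z : FinGSet.{u} G} (f : X →[G] X') (g : Y →[G] Z) :
    IsPB (prodMapRight X g) (prodMap f Y) (prodMap f Z) (prodMapRight X' g) where
  comm _ := rfl
  inj _ _ e e' := Prod.ext (congrArg (fun t : X × Z => t.1) e)
    (congrArg (fun t : X' × Y => t.2) e')
  surj := by
    rintro ⟨x, z⟩ ⟨x', y⟩ e
    obtain rfl : f x = x' := congrArg (fun t : X' × Z => t.1) e
    obtain rfl : z = g y := congrArg (fun t : X' × Z => t.2) e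
    exact ⟨(x, y), rfl, rfl⟩

/-- The one-point `G`-set. -/
def pt (G : Type u) [Group G] : FinGSet.{u} G where
  carrier := PUnit
  action :=
    { smul := fun _ x => x
      one_smul := fun _ => rfl
      mul_smul := fun _ _ _ => rfl }

/-- The map to the point. -/
def toPt (X : FinGSet.{u} G) : X →[G] pt G := ⟨fun _ => PUnit.unit, fun _ _ => rfl⟩

/-- Transitive `G`-sets. -/
def quot [Finite G] (H : Subgroup G) : FinGSet.{u} G where
  carrier := G ⧸ H

variable (G) in
/-- The group `G`, with its action by left multiplication. -/
def reg [Finite G] : FinGSet.{u} G where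
  carrier := G

/-- An element of the `G`-set `G`, as an element of the group. -/
def regVal [Finite G] (g : reg G) : G := g

/-- An element of the group, as an element of the `G`-set `G`. -/
def toReg [Finite G] (g : G) : reg G := g

theorem regVal_smul_toReg_one [Finite G] (g : reg G) : regVal g • (toReg 1 : reg G) = g :=
  mul_one (regVal g)

/-- The base point of `G/H`. -/
def quotOne [Finite G] (H : Subgroup G) : quot H := (QuotientGroup.mk 1 : G ⧸ H)

theorem exists_smul_quotOne [Finite G] {H : Subgroup G} (x : quot H) :
    ∃ g : G, x = g • quotOne H := by
  obtain ⟨g, rfl⟩ := QuotientGroup.mk_surjective (s := H) x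
  exact ⟨g, congrArg QuotientGroup.mk (mul_one g).symm⟩

theorem smul_quotOne_eq_iff [Finite G] {H : Subgroup G} {g g' : G} :
    g • quotOne H = g' • quotOne H ↔ g⁻¹ * g' ∈ H := by
  have h : ∀ g : G, g • quotOne H = (QuotientGroup.mk g : G ⧸ H) := fun g =>
    congrArg QuotientGroup.mk (mul_one g)
  rw [h, h]
  exact QuotientGroup.eq

/-- The equivariant map `G → X` which sends `1` to `x`. -/
def orbitMap [Finite G] {X : FinGSet.{u} G} (x : X) : reg G →[G] X :=
  ⟨fun g : G => g • x, fun g h => mul_smul (g : G) (h : G) x⟩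

/-- An invariant subset of a finite `G`-set. -/
def subset (X : FinGSet.{u} G) (p : X → Prop) (hp : ∀ (g : G) x, p x → p (g • x)) :
    FinGSet.{u} G where
  carrier := {x // p x}
  action :=
    { smul := fun g x => ⟨g • x.1, hp g x.1 x.2⟩
      one_smul := fun _ => Subtype.ext (one_smul G _)
      mul_smul := fun g h _ => Subtype.ext (mul_smul g h _) }

/-- The inclusion of an invariant subset. -/
def subsetIncl (X : FinGSet.{u} G) (p : X → Prop) (hp : ∀ (g : G) x, p x → p (g • x)) :
    subset X p hp →[G] X :=
  ⟨Subtype.val, fun _ _ => rfl⟩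

/-- The map `G/H → X` which sends `1` to `x`, where `H` is the stabilizer of `x`. -/
def orbitIncl [Finite G] {X : FinGSet.{u} G} (x : X) : quot (MulAction.stabilizer G x) →[G] X :=
  ⟨MulAction.ofQuotientStabilizer G x, fun g y => MulAction.ofQuotientStabilizer_smul G x g y⟩

/-- Induction on finite `G`-sets. -/
theorem induction [Finite G] {P : FinGSet.{u} G → Prop} (empty : ∀ X : FinGSet G, IsEmpty X → P X)
    (coprod : ∀ (X Y Z : FinGSet G) (i : X →[G] Z) (j : Y →[G] Z), IsCoprod i j → P X → P Y → P Z)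
    (orbit : ∀ H : Subgroup G, P (quot H)) (X : FinGSet G) : P X := by
  induction h : Nat.card X using Nat.strong_induction_on generalizing X with
  | _ n ih =>
    subst h
    by_cases hX : IsEmpty X
    · exact empty X hX
    · rw [not_isEmpty_iff] at hX
      obtain ⟨x⟩ := hX
      have hp : ∀ (g : G) (y : X), y ∉ MulAction.orbit G x → g • y ∉ MulAction.orbit G x := by
        intro g y hy h
        obtain ⟨m, hm⟩ := h
        refine hy ⟨g⁻¹ * m, ?_⟩
        change (g⁻¹ * m) • x = y
        rw [mul_smul, show m • x = g • y from hm, inv_smul_smul]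
      refine coprod _ _ X (orbitIncl x) (subsetIncl X (· ∉ MulAction.orbit G x) hp)
        ⟨MulAction.injective_ofQuotientStabilizer G x, Subtype.val_injective, ?_, ?_⟩ (orbit _)
        (ih _ ?_ _ rfl)
      · rintro y ⟨z, hz⟩ e
        refine hz ?_
        obtain rfl : orbitIncl x y = z := e
        exact MulAction.ofQuotientStabilizer_mem_orbit G x y
      · intro z
        by_cases hz : z ∈ MulAction.orbit G x
        · obtain ⟨g, rfl⟩ := hz
          exact Or.inl ⟨(g : G ⧸ MulAction.stabilizer G x), rfl⟩
        · exact Or.inr ⟨⟨z, hz⟩, rfl⟩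
      · refine Finite.card_subtype_lt (x := x) ?_
        exact fun h => h (MulAction.mem_orbit_self x)

/-- Products over the fibres of a disjoint union. -/
@[to_additive /-- Sums over the fibres of a disjoint union. -/]
theorem finprod_fib_coprod {X Y Z : Type u} [Finite X] [Finite Y] [Finite Z] {i : X → Z} {j : Y → Z}
    (hij : Function.Bijective (Sum.elim i j)) {V : Type w} {M : Type v} [CommMonoid M]
    (f : Z → V) (c : V) (φ : Z → M) :
    ∏ᶠ z : {z // f z = c}, φ z =
      (∏ᶠ x : {x // f (i x) = c}, φ (i x)) * ∏ᶠ y : {y // f (j y) = c}, φ (j y) := by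
  classical
  let e : {x // f (i x) = c} ⊕ {y // f (j y) = c} ≃ {z // f z = c} :=
    Equiv.ofBijective (Sum.elim (fun x => ⟨i x, x.2⟩) (fun x => ⟨j x, x.2⟩)) (by
      constructor
      · rintro (⟨x, hx⟩ | ⟨x, hx⟩) (⟨y, hy⟩ | ⟨y, hy⟩) h <;>
          have h' := congrArg Subtype.val h
        · exact congrArg Sum.inl (Subtype.ext (Sum.inl_injective (@hij.1 (.inl x) (.inl y) h')))
        · exact (Sum.inl_ne_inr (@hij.1 (.inl x) (.inr y) h')).elim
        · exact (Sum.inr_ne_inl (@hij.1 (.inr x) (.inl y) h')).elim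
        · exact congrArg Sum.inr (Subtype.ext (Sum.inr_injective (@hij.1 (.inr x) (.inr y) h')))
      · rintro ⟨z, hz⟩
        obtain ⟨x | y, rfl⟩ := hij.2 z
        · exact ⟨Sum.inl ⟨x, hz⟩, rfl⟩
        · exact ⟨Sum.inr ⟨y, hz⟩, rfl⟩)
  have := Fintype.ofFinite X
  have := Fintype.ofFinite Y
  have := Fintype.ofFinite Z
  simp only [finprod_eq_prod_of_fintype]
  rw [← e.prod_comp, Fintype.prod_sum_type]
  rfl

end FinGSet

namespace TambaraFunctor

variable {G : Type u} [Group G] (T : TambaraFunctor.{u, w} G)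

theorem tr_tr {X Y Z : FinGSet.{u} G} (g : Y →[G] Z) (f : X →[G] Y) (h : X →[G] Z)
    (e : ∀ t, h t = g (f t)) (x : T.obj X) : T.tr g (T.tr f x) = T.tr h x := by
  rw [← T.tr_comp, show h = g.comp f from MulActionHom.ext e]

theorem res_id' {X : FinGSet.{u} G} (f : X →[G] X) (e : ∀ t, f t = t) (x : T.obj X) :
    T.res f x = x := by
  rw [show f = MulActionHom.id G from MulActionHom.ext e, T.res_id]

theorem obj_ext {X Y Z : FinGSet.{u} G} {i : X →[G] Z} {j : Y →[G] Z} (h : IsCoprod i j)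
    {x y : T.obj Z} (hi : T.res i x = T.res i y) (hj : T.res j x = T.res j y) : x = y :=
  (T.coprod h).1 (Prod.ext hi hj)

theorem res_tr_inj {X Z : FinGSet.{u} G} {f : X →[G] Z} (hf : Function.Injective f)
    (x : T.obj X) : T.res f (T.tr f x) = x := by
  rw [T.res_tr (isPB_inj hf), T.res_id, T.tr_id]

theorem res_nm_inj {X Z : FinGSet.{u} G} {f : X →[G] Z} (hf : Function.Injective f)
    (x : T.obj X) : T.res f (T.nm f x) = x := by
  rw [T.res_nm (isPB_inj hf), T.res_id, T.nm_id]

theorem isPB_disj {X Y Z : FinGSet.{u} G} {i : X →[G] Z} {j : Y →[G] Z} (h : IsCoprod i j) :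
    IsPB (ofEmp X) (ofEmp Y) i j :=
  ⟨fun t => t.elim, fun t => t.elim, fun x y e => (h.disj x y e).elim⟩

theorem res_tr_disj {X Y Z : FinGSet.{u} G} {i : X →[G] Z} {j : Y →[G] Z} (h : IsCoprod i j)
    (x : T.obj X) : T.res j (T.tr i x) = 0 := by
  have := T.empty (emp G) inferInstance
  rw [T.res_tr (isPB_disj h), Subsingleton.elim (T.res (ofEmp X) x) 0, map_zero]

theorem res_nm_disj {X Y Z : FinGSet.{u} G} {i : X →[G] Z} {j : Y →[G] Z} (h : IsCoprod i j)
    (x : T.obj X) : T.res j (T.nm i x) = 1 := by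
  have := T.empty (emp G) inferInstance
  rw [T.res_nm (isPB_disj h), Subsingleton.elim (T.res (ofEmp X) x) 1, map_one]

theorem tr_coprod {X Y Z V : FinGSet.{u} G} {i : X →[G] Z} {j : Y →[G] Z} (h : IsCoprod i j)
    (f : Z →[G] V) (z : T.obj Z) :
    T.tr f z = T.tr (f.comp i) (T.res i z) + T.tr (f.comp j) (T.res j z) := by
  rw [T.tr_comp, T.tr_comp, ← map_add]
  congr 1
  refine T.obj_ext h ?_ ?_
  · rw [map_add, T.res_tr_inj h.inj_left, T.res_tr_disj h.symm, add_zero]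
  · rw [map_add, T.res_tr_inj h.inj_right, T.res_tr_disj h, zero_add]

theorem nm_coprod {X Y Z V : FinGSet.{u} G} {i : X →[G] Z} {j : Y →[G] Z} (h : IsCoprod i j)
    (f : Z →[G] V) (z : T.obj Z) :
    T.nm f z = T.nm (f.comp i) (T.res i z) * T.nm (f.comp j) (T.res j z) := by
  rw [T.nm_comp, T.nm_comp, ← map_mul]
  congr 1
  refine T.obj_ext h ?_ ?_
  · rw [map_mul, T.res_nm_inj h.inj_left, T.res_nm_disj h.symm, mul_one]
  · rw [map_mul, T.res_nm_inj h.inj_right, T.res_nm_disj h, one_mul]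

theorem tr_inverse {X Y : FinGSet.{u} G} {f : X →[G] Y} {g : Y →[G] X} (h1 : ∀ y, f (g y) = y)
    (h2 : ∀ x, g (f x) = x) (x : T.obj X) : T.tr f x = T.res g x := by
  have h : IsPB g (MulActionHom.id G) f (MulActionHom.id G) :=
    ⟨h1, fun _ _ _ e => e, fun x y e => ⟨y, by rw [← h2 x, e]; rfl, rfl⟩⟩
  have := T.res_tr h x
  rwa [T.res_id, T.tr_id] at this

theorem nm_inverse {X Y : FinGSet.{u} G} {f : X →[G] Y} {g : Y →[G] X} (h1 : ∀ y, f (g y) = y)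
    (h2 : ∀ x, g (f x) = x) (x : T.obj X) : T.nm f x = T.res g x := by
  have h : IsPB g (MulActionHom.id G) f (MulActionHom.id G) :=
    ⟨h1, fun _ _ _ e => e, fun x y e => ⟨y, by rw [← h2 x, e]; rfl, rfl⟩⟩
  have := T.res_nm h x
  rwa [T.res_id, T.nm_id] at this

variable [Finite G]

/-- Elements are determined by their restrictions to orbits. -/
theorem ext_orbits {X : FinGSet.{u} G} {x y : T.obj X}
    (h : ∀ (H : Subgroup G) (f : quot H →[G] X), T.res f x = T.res f y) : x = y := by
  induction X using FinGSet.induction with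
  | empty X hX => exact (T.empty X hX).elim _ _
  | coprod X Y Z i j hij hX hY =>
    exact T.obj_ext hij (hX fun H f => by rw [← T.res_comp, h, T.res_comp])
      (hY fun H f => by rw [← T.res_comp, h, T.res_comp])
  | orbit H => simpa only [T.res_id] using h H (MulActionHom.id G)

/-- The restriction along the map `G → X` which sends `1` to `x`. -/
def ev {X : FinGSet.{u} G} (x : X) : T.obj X →+* T.obj (reg G) := T.res (orbitMap x)

theorem ev_res {X Y : FinGSet.{u} G} (f : X →[G] Y) (x : X) (z : T.obj Y) :
    T.ev x (T.res f z) = T.ev (f x) z :=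
  T.res_res _ _ _ (fun g => (map_smul f (g : G) x).symm) z

theorem ev_one (z : T.obj (reg G)) : T.ev (toReg 1) z = z :=
  T.res_id' _ (fun g => mul_one (g : G)) z

theorem ev_smul {X : FinGSet.{u} G} (g : G) (x : X) (z : T.obj X) :
    T.ev (g • x) z = T.ev (toReg g) (T.ev x z) :=
  (T.ev_res (orbitMap x) (toReg g) z).symm

theorem quot_to_reg {H : Subgroup G} (f : quot H →[G] reg G) :
    Function.Bijective f := by
  have key : ∀ c : G, regVal (f (c • quotOne H)) = c * regVal (f (quotOne H)) := fun c =>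
    congrArg regVal (map_smul f c (quotOne H))
  have hH : H = ⊥ := by
    rw [Subgroup.eq_bot_iff_forall]
    intro h hh
    have h1 : (1 : G) • quotOne H = h • quotOne H := smul_quotOne_eq_iff.2 (by simpa using hh)
    have h2 := congrArg (fun x => regVal (f x)) h1
    simp only [key] at h2
    exact (mul_right_cancel h2).symm
  subst hH
  constructor
  · intro a b hab
    obtain ⟨a, rfl⟩ := exists_smul_quotOne a
    obtain ⟨b, rfl⟩ := exists_smul_quotOne b
    have hab' := congrArg regVal hab
    rw [key, key] at hab'
    rw [mul_right_cancel hab']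
  · intro g
    refine ⟨(regVal g * (regVal (f (quotOne _)))⁻¹) • quotOne _, ?_⟩
    change regVal _ = regVal g
    rw [key, inv_mul_cancel_right]

/-- Elements at a free `G`-set are determined by their values at points. -/
theorem ext_free {X : FinGSet.{u} G} (q : X →[G] reg G) {z z' : T.obj X}
    (h : ∀ x : X, T.ev x z = T.ev x z') : z = z' := by
  refine T.ext_orbits fun H f => ?_
  obtain ⟨g, h1, h2⟩ := exists_inverse (quot_to_reg (q.comp f))
  have e : ∀ z, T.res f z = T.res (q.comp f) (T.ev (f (g (toReg 1))) z) := by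
    intro z
    refine (T.res_res _ _ _ (fun t => ?_) z).symm
    change f t = regVal (q.comp f t) • f (g (toReg 1))
    rw [← map_smul, ← map_smul, regVal_smul_toReg_one, h2]
  rw [e, e, h]

theorem ev_tr {X Y : FinGSet.{u} G} (f : X →[G] Y) (y : Y) (z : T.obj X) :
    T.ev y (T.tr f z) = ∑ᶠ x : {x // f x = y}, T.ev (x : X) z := by
  have key : ∀ (X : FinGSet.{u} G) (f : X →[G] reg G) (z : T.obj X),
      T.tr f z = ∑ᶠ x : {x // f x = toReg 1}, T.ev (x : X) z := by
    intro X
    induction X using FinGSet.induction with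
    | empty X hX =>
      intro f z
      rw [(T.empty X hX).elim z 0, map_zero]
      simp
    | coprod X Y Z i j hij hX hY =>
      intro f z
      rw [T.tr_coprod hij, hX, hY,
        finsum_fib_coprod hij.desc_bijective f (toReg 1) (fun x => T.ev x z)]
      simp only [T.ev_res]
      rfl
    | orbit H =>
      intro f z
      obtain ⟨g, h1, h2⟩ := exists_inverse (quot_to_reg f)
      have : Unique {x // f x = toReg 1} :=
        ⟨⟨⟨g (toReg 1), h1 _⟩⟩, fun a => Subtype.ext ((h2 a).symm.trans (congrArg g a.2))⟩
      rw [finsum_unique, T.tr_inverse h1 h2]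
      refine congrArg (fun j => T.res j z) (MulActionHom.ext fun t => ?_)
      change g t = regVal t • (default : {x // f x = toReg 1}).1
      rw [← h2 (default : {x // f x = toReg 1}).1, (default : {x // f x = toReg 1}).2, ← map_smul,
        regVal_smul_toReg_one]
  have h := isPB_pb f (orbitMap y)
  rw [ev, T.res_tr h, key]
  refine finsum_eq_of_bijective (fun t => ⟨pbFst f (orbitMap y) t, ?_⟩) ⟨?_, ?_⟩ ?_
  · rw [h.comm, t.2]
    exact one_smul G y
  · intro t t' e
    exact Subtype.ext (h.inj _ _ (congrArg Subtype.val e) (t.2.trans t'.2.symm))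
  · rintro ⟨x, hx⟩
    obtain ⟨t, rfl, ht⟩ := h.surj x (toReg 1) (hx.trans (one_smul G y).symm)
    exact ⟨⟨t, ht⟩, rfl⟩
  · intro t
    exact T.ev_res _ _ _

theorem ev_nm {X Y : FinGSet.{u} G} (f : X →[G] Y) (y : Y) (z : T.obj X) :
    T.ev y (T.nm f z) = ∏ᶠ x : {x // f x = y}, T.ev (x : X) z := by
  have key : ∀ (X : FinGSet.{u} G) (f : X →[G] reg G) (z : T.obj X),
      T.nm f z = ∏ᶠ x : {x // f x = toReg 1}, T.ev (x : X) z := by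
    intro X
    induction X using FinGSet.induction with
    | empty X hX =>
      intro f z
      rw [(T.empty X hX).elim z 1, map_one]
      simp
    | coprod X Y Z i j hij hX hY =>
      intro f z
      rw [T.nm_coprod hij, hX, hY,
        finprod_fib_coprod hij.desc_bijective f (toReg 1) (fun x => T.ev x z)]
      simp only [T.ev_res]
      rfl
    | orbit H =>
      intro f z
      obtain ⟨g, h1, h2⟩ := exists_inverse (quot_to_reg f)
      have : Unique {x // f x = toReg 1} :=
        ⟨⟨⟨g (toReg 1), h1 _⟩⟩, fun a => Subtype.ext ((h2 a).symm.trans (congrArg g a.2))⟩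
      rw [finprod_unique, T.nm_inverse h1 h2]
      refine congrArg (fun j => T.res j z) (MulActionHom.ext fun t => ?_)
      change g t = regVal t • (default : {x // f x = toReg 1}).1
      rw [← h2 (default : {x // f x = toReg 1}).1, (default : {x // f x = toReg 1}).2, ← map_smul,
        regVal_smul_toReg_one]
  have h := isPB_pb f (orbitMap y)
  rw [ev, T.res_nm h, key]
  refine finprod_eq_of_bijective (fun t => ⟨pbFst f (orbitMap y) t, ?_⟩) ⟨?_, ?_⟩ ?_
  · rw [h.comm, t.2]
    exact one_smul G y
  · intro t t' e
    exact Subtype.ext (h.inj _ _ (congrArg Subtype.val e) (t.2.trans t'.2.symm))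
  · rintro ⟨x, hx⟩
    obtain ⟨t, rfl, ht⟩ := h.surj x (toReg 1) (hx.trans (one_smul G y).symm)
    exact ⟨⟨t, ht⟩, rfl⟩
  · intro t
    exact T.ev_res _ _ _

/-- Ring homomorphisms which are compatible with restrictions are compatible with all norms if they
are compatible with norms along maps of orbits. -/
theorem nm_compat_of_orbits (S : TambaraFunctor.{u, w'} G) (φ : ∀ X, T.obj X →+* S.obj X)
    (hres : ∀ {X Y : FinGSet G} (f : X →[G] Y) (x : T.obj Y), φ X (T.res f x) = S.res f (φ Y x))
    (hnm : ∀ (K H : Subgroup G) (f : quot K →[G] quot H) (x : T.obj (quot K)),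
      φ _ (T.nm f x) = S.nm f (φ _ x)) {X Y : FinGSet.{u} G} (f : X →[G] Y) (x : T.obj X) :
    φ Y (T.nm f x) = S.nm f (φ X x) := by
  have key : ∀ (X : FinGSet.{u} G) (H : Subgroup G) (f : X →[G] quot H) (x : T.obj X),
      φ _ (T.nm f x) = S.nm f (φ X x) := by
    intro X
    induction X using FinGSet.induction with
    | empty X hX =>
      intro H f x
      rw [(T.empty X hX).elim x 1, map_one, map_one, map_one, map_one]
    | coprod X Y Z i j hij hX hY =>
      intro H f x
      rw [T.nm_coprod hij, S.nm_coprod hij, map_mul, hX, hY, hres, hres]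
    | orbit K => exact fun H f x => hnm K H f x
  refine S.ext_orbits fun H g => ?_
  have h := isPB_pb f g
  rw [← hres, T.res_nm h, S.res_nm h, key, hres]

end TambaraFunctor

namespace TambaraFunctor

variable {G : Type u} [Group G]

/-- The shift of `k`, regarded as a `k`-module: `X ↦ k(X × Z)`. -/
def shift (k : TambaraFunctor.{u, w} G) (Z : FinGSet.{u} G) : Mod.{u, w, w} k where
  obj X := k.obj (prod X Z)
  mod X := Module.compHom (k.obj (prod X Z)) (k.res (prodFst X Z))
  res f := (k.res (prodMap f Z)).toAddMonoidHom
  tr f := k.tr (prodMap f Z)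
  res_id := k.res_id
  tr_id := k.tr_id
  res_comp g f := k.res_comp (prodMap g Z) (prodMap f Z)
  tr_comp g f := k.tr_comp (prodMap g Z) (prodMap f Z)
  empty X h := k.empty (prod X Z) ⟨fun t => h.elim t.1⟩
  coprod h := k.coprod (h.prodMap Z)
  res_tr h := k.res_tr (h.prodMap Z)
  res_smul {X Y} f c x := by
    change k.res (prodMap f Z) (k.res (prodFst Y Z) c * x) =
      k.res (prodFst X Z) (k.res f c) * k.res (prodMap f Z) x
    rw [map_mul, ← k.res_comp, ← k.res_comp]
    rfl
  tr_res_smul {X Y} f c x := by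
    change k.tr (prodMap f Z) (k.res (prodFst X Z) (k.res f c) * x) =
      k.res (prodFst Y Z) c * k.tr (prodMap f Z) x
    rw [mul_comm _ (k.tr _ _), ← k.tr_mul_res, ← k.res_comp, ← k.res_comp, mul_comm]
    rfl
  tr_smul_res {X Y} f c x := by
    change k.tr (prodMap f Z) (k.res (prodFst X Z) c * k.res (prodMap f Z) x) =
      k.res (prodFst Y Z) (k.tr f c) * x
    rw [k.tr_mul_res, k.res_tr (isPB_prodFst f Z)]

variable {k : TambaraFunctor.{u, w} G}

namespace Mod

/-- The symmetry of the box product. -/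
def Box.swap {M : Mod.{u, w, v} k} {N : Mod.{u, w, w'} k} {X : FinGSet.{u} G} (x : Box M N X) :
    Box N M X :=
  Quot.liftOn x (fun r => Box.mk r.map r.snd r.fst) fun r r' h => by
    cases h with
    | left g p a b => exact Box.mk_right g p b a
    | right g p a b => exact Box.mk_left g p b a
    | smul p c a b => exact (Box.mk_smul p c b a).symm

theorem Box.swap_mk {M : Mod.{u, w, v} k} {N : Mod.{u, w, w'} k} {X Y : FinGSet.{u} G}
    (p : Y →[G] X) (a : M.obj Y) (b : N.obj Y) : (Box.mk p a b).swap = Box.mk p b a :=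
  rfl

/-- The map `M ⊠ k(- × Z) → M(- × Z)`, which is an isomorphism. -/
def Box.toShift {M : Mod.{u, w, v} k} {Z X : FinGSet.{u} G} (x : Box M (k.shift Z) X) :
    M.obj (prod X Z) :=
  Quot.liftOn x (fun r => M.tr (prodMap r.map Z)
      (HSMul.hSMul (α := k.obj (prod r.dom Z)) r.snd (M.res (prodFst r.dom Z) r.fst)))
    fun r r' h => by
      cases h with
      | @left V W g p a b =>
        change k.obj (prod W Z) at b
        change M.tr (prodMap p Z) (b • M.res (prodFst W Z) (M.tr g a)) =
          M.tr ((prodMap p Z).comp (prodMap g Z))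
            (k.res (prodMap g Z) b • M.res (prodFst V Z) a)
        rw [M.res_tr (isPB_prodFst g Z), M.tr_comp, M.tr_res_smul]
      | @right V W g p a b =>
        change k.obj (prod V Z) at b
        change M.tr (prodMap p Z) (k.tr (prodMap g Z) b • M.res (prodFst W Z) a) =
          M.tr ((prodMap p Z).comp (prodMap g Z)) (b • M.res (prodFst V Z) (M.res g a))
        rw [M.tr_comp, ← M.tr_smul_res, ← M.res_comp, ← M.res_comp]
        rfl
      | @smul V p c a b =>
        change k.obj (prod V Z) at b
        change M.tr (prodMap p Z) (b • M.res (prodFst V Z) (c • a)) =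
          M.tr (prodMap p Z) ((k.res (prodFst V Z) c * b) • M.res (prodFst V Z) a)
        rw [M.res_smul, smul_smul, mul_comm]

theorem Box.toShift_zero {M : Mod.{u, w, v} k} {Z X : FinGSet.{u} G} :
    (0 : Box M (k.shift Z) X).toShift = 0 := by
  change M.tr _ (HSMul.hSMul (α := k.obj (prod (emp G) Z)) 0 _) = 0
  rw [zero_smul, map_zero]

/-- The indicator function of the diagonal of `Z`, in `k(X × Z × Z)`. -/
def diagElt (k : TambaraFunctor.{u, w} G) (X Z : FinGSet.{u} G) :
    (k.shift Z).obj (prod X Z) :=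
  k.tr (prodLift (MulActionHom.id G) (prodSnd X Z)) 1

theorem isPB_diag {X Y : FinGSet.{u} G} (f : X →[G] Y) (Z : FinGSet.{u} G) :
    IsPB (prodMap f Z) (prodLift (MulActionHom.id G) (prodSnd X Z))
      (prodLift (MulActionHom.id G) (prodSnd Y Z)) (prodMap (prodMap f Z) Z) where
  comm _ := rfl
  inj _ _ _ e' := congrArg (fun t : (X × Z) × Z => t.1) e'
  surj := by
    rintro ⟨y, z⟩ ⟨⟨x, z'⟩, z''⟩ e
    obtain rfl : y = f x := congrArg (fun t : (Y × Z) × Z => t.1.1) e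
    obtain rfl : z = z' := congrArg (fun t : (Y × Z) × Z => t.1.2) e
    obtain rfl : z = z'' := congrArg (fun t : (Y × Z) × Z => t.2) e
    exact ⟨(x, z), rfl, rfl⟩

theorem Box.toShift_bijective (M : Mod.{u, w, v} k) (Z X : FinGSet.{u} G) :
    Function.Bijective (Box.toShift : Box M (k.shift Z) X → M.obj (prod X Z)) := by
  refine Function.bijective_iff_has_inverse.2
    ⟨fun m => Box.mk (N := k.shift Z) (prodFst X Z) m (diagElt k X Z), fun x => ?_, fun m => ?_⟩
  · induction x using Box.ind with | h Y p a b
    change k.obj (prod Y Z) at b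
    have e1 : (k.shift Z).res (prodMap p Z) (diagElt k X Z) = diagElt k Y Z := by
      change k.res (prodMap (prodMap p Z) Z) (k.tr _ 1) = k.tr _ 1
      rw [k.res_tr (isPB_diag p Z), map_one]
    have e2 : (k.shift Z).tr (prodFst Y Z)
        (HSMul.hSMul (α := k.obj (prod Y Z)) (β := (k.shift Z).obj (prod Y Z)) b
          (diagElt k Y Z)) = b := by
      change k.tr (prodMap (prodFst Y Z) Z) (k.res (prodFst (prod Y Z) Z) b * k.tr _ 1) = b
      rw [mul_comm, ← k.tr_mul_res, one_mul, k.tr_tr _ _ (MulActionHom.id G)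
        (fun _ => rfl), k.tr_id, k.res_res _ _ (MulActionHom.id G) (fun _ => rfl), k.res_id]
    change Box.mk (N := k.shift Z) (prodFst X Z) (M.tr (prodMap p Z) (b • M.res (prodFst Y Z) a))
      (diagElt k X Z) = _
    rw [Box.mk_left, e1, Box.mk_smul]
    rw [show (prodFst X Z).comp (prodMap p Z) = p.comp (prodFst Y Z) from rfl, ← Box.mk_right, e2]
  · change M.tr (prodMap (prodFst X Z) Z)
      (k.tr (prodLift (MulActionHom.id G) (prodSnd X Z)) 1 • M.res (prodFst (prod X Z) Z) m) = m
    rw [← M.tr_smul_res, one_smul, M.tr_tr _ _ (MulActionHom.id G) (fun _ => rfl), M.tr_id,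
      M.res_res _ _ (MulActionHom.id G) (fun _ => rfl), M.res_id]

/-- The map `N(- × Z) → N'(- × Z)` induced by `N → N'` is identified with `φ ⊠ k(- × Z)`. -/
theorem Box.toShift_swap_boxMap {N N' : Mod.{u, w, v} k} {Z X : FinGSet.{u} G}
    (φ : Mod.Hom N N') (x : Box (k.shift Z) N X) :
    ((boxMap (k.shift Z) φ).app X x : Box (k.shift Z) N' X).swap.toShift =
      φ.app (prod X Z) x.swap.toShift := by
  induction x using Box.ind with | h Y p a b
  change k.obj (prod Y Z) at a
  change N'.tr (prodMap p Z) (a • N'.res (prodFst Y Z) (φ.app Y b)) =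
    φ.app (prod X Z) (N.tr (prodMap p Z) (a • N.res (prodFst Y Z) b))
  rw [φ.app_tr, (φ.app _).map_smul, φ.app_res]

/-- The map of box products induced by a morphism in the first variable. -/
noncomputable def Box.mapLeft {M M' : Mod.{u, w, v} k} {N : Mod.{u, w, w'} k} (φ : Mod.Hom M M')
    {X : FinGSet.{u} G} (x : Box M N X) : Box M' N X :=
  ((boxMap N φ).app X x.swap : Box N M' X).swap

theorem Box.mapLeft_mk {M M' : Mod.{u, w, v} k} {N : Mod.{u, w, w'} k} (φ : Mod.Hom M M')
    {X Y : FinGSet.{u} G} (p : Y →[G] X) (a : M.obj Y) (b : N.obj Y) :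
    Box.mapLeft φ (Box.mk p a b) = Box.mk p (φ.app Y a) b :=
  rfl

/-- The inverse of a bijective morphism of modules. -/
noncomputable def Hom.inverse {M : Mod.{u, w, v} k} {N : Mod.{u, w, w'} k} (φ : Mod.Hom M N)
    (hφ : ∀ X, Function.Bijective (φ.app X)) : Mod.Hom N M where
  app X := (LinearEquiv.ofBijective (φ.app X) (hφ X)).symm
  app_res {X Y} f x := by
    apply (hφ X).1
    rw [φ.app_res]
    exact ((LinearEquiv.ofBijective (φ.app X) (hφ X)).apply_symm_apply _).trans
      (congrArg (N.res f) ((LinearEquiv.ofBijective (φ.app Y) (hφ Y)).apply_symm_apply x).symm)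
  app_tr {X Y} f x := by
    apply (hφ Y).1
    rw [φ.app_tr]
    exact ((LinearEquiv.ofBijective (φ.app Y) (hφ Y)).apply_symm_apply _).trans
      (congrArg (N.tr f) ((LinearEquiv.ofBijective (φ.app X) (hφ X)).apply_symm_apply x).symm)

theorem Hom.app_inverse {M : Mod.{u, w, v} k} {N : Mod.{u, w, w'} k} (φ : Mod.Hom M N)
    (hφ : ∀ X, Function.Bijective (φ.app X)) (X : FinGSet.{u} G) (x : N.obj X) :
    φ.app X ((φ.inverse hφ).app X x) = x :=
  (LinearEquiv.ofBijective (φ.app X) (hφ X)).apply_symm_apply x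

theorem Hom.inverse_app {M : Mod.{u, w, v} k} {N : Mod.{u, w, w'} k} (φ : Mod.Hom M N)
    (hφ : ∀ X, Function.Bijective (φ.app X)) (X : FinGSet.{u} G) (x : M.obj X) :
    (φ.inverse hφ).app X (φ.app X x) = x :=
  (LinearEquiv.ofBijective (φ.app X) (hφ X)).symm_apply_apply x

/-- Modules which are isomorphic to `k(- × Z)` are flat. -/
theorem isFlat_of_shift {D : Mod.{u, w, w} k} {Z : FinGSet.{u} G} (θ : Mod.Hom D (k.shift Z))
    (hθ : ∀ X, Function.Bijective (θ.app X)) : D.IsFlat := by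
  have bij : ∀ (N : Mod.{u, w, w} k) (X : FinGSet.{u} G), Function.Bijective
      (fun x : Box D N X => (Box.mapLeft θ x).swap.toShift) := by
    intro N X
    have h1 : Function.Bijective (fun x : Box D N X => Box.mapLeft θ x) := by
      refine Function.bijective_iff_has_inverse.2 ⟨Box.mapLeft (θ.inverse hθ), ?_, ?_⟩
      · intro x
        induction x using Box.ind with | h Y p a b
        simp only [Box.mapLeft_mk, Hom.inverse_app]
      · intro x
        induction x using Box.ind with | h Y p a b
        simp only [Box.mapLeft_mk, Hom.app_inverse]
    have h2 : Function.Bijective (Box.swap : Box (k.shift Z) N X → Box N (k.shift Z) X) :=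
      Function.bijective_iff_has_inverse.2 ⟨Box.swap, Box.ind fun _ _ _ _ => rfl,
        Box.ind fun _ _ _ _ => rfl⟩
    exact (Box.toShift_bijective N Z X).comp (h2.comp h1)
  have nat : ∀ (N N' : Mod.{u, w, w} k) (φ : Mod.Hom N N') (X : FinGSet.{u} G) (x : Box D N X),
      (Box.mapLeft θ ((boxMap D φ).app X x : Box D N' X)).swap.toShift =
        φ.app (prod X Z) (Box.mapLeft θ x).swap.toShift := by
    intro N N' φ X x
    rw [← Box.toShift_swap_boxMap]
    refine congrArg (fun y => (Box.swap y).toShift) ?_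
    induction x using Box.ind with | h Y p a b
    change Box.mapLeft θ (Box.mk p a (φ.app Y b)) =
      (boxMap (k.shift Z) φ).app X (Box.mapLeft θ (Box.mk p a b))
    rw [Box.mapLeft_mk, Box.mapLeft_mk]
    rfl
  have zero : ∀ (N : Mod.{u, w, w} k) (X : FinGSet.{u} G),
      (Box.mapLeft θ (0 : Box D N X)).swap.toShift = 0 := by
    intro N X
    have h : Box.mapLeft θ (0 : Box D N X) = 0 := by
      rw [← Box.mk_zero_right (MulActionHom.id G) 0, Box.mapLeft_mk, Box.mk_zero_right]
    rw [h, ← Box.mk_zero_right (MulActionHom.id G) 0, Box.swap_mk, Box.mk_zero_left,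
      Box.toShift_zero]
  intro N₁ N₂ N₃ φ ψ h X y
  refine (bij N₃ X).1.eq_iff.symm.trans ?_
  change (Box.mapLeft θ ((boxMap D ψ).app X y : Box D N₃ X)).swap.toShift =
    (Box.mapLeft θ (0 : Box D N₃ X)).swap.toShift ↔ _
  refine (Iff.of_eq (congrArg₂ Eq (nat N₂ N₃ ψ X y) (zero N₃ X))).trans ?_
  refine (h (prod X Z) (Box.mapLeft θ (y : Box D N₂ X)).swap.toShift).trans ?_
  constructor
  · rintro ⟨z, hz⟩
    obtain ⟨x, rfl⟩ := (bij N₁ X).2 z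
    exact ⟨x, (bij N₂ X).1 ((nat _ _ φ X x).trans hz)⟩
  · rintro ⟨x, rfl⟩
    exact ⟨_, (nat _ _ φ X x).symm⟩

/-- The morphism `k(- × Z) → k(- × Z')` induced by `Z' → Z`. -/
def shiftMap (k : TambaraFunctor.{u, w} G) {Z Z' : FinGSet.{u} G} (h : Z' →[G] Z) :
    Mod.Hom (k.shift Z) (k.shift Z') where
  app Y :=
    { toFun := fun y => k.res (prodMapRight Y h) y
      map_add' := fun x y => map_add (k.res (prodMapRight Y h)) x y
      map_smul' := fun c x => by
        change k.obj (prod Y Z) at x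
        change k.res (prodMapRight Y h) (k.res (prodFst Y Z) c * x) =
          k.res (prodFst Y Z') c * k.res (prodMapRight Y h) x
        rw [map_mul, ← k.res_comp]
        rfl }
  app_res {X Y} f x := by
    change k.obj (prod Y Z) at x
    change k.res (prodMapRight X h) (k.res (prodMap f Z) x) =
      k.res (prodMap f Z') (k.res (prodMapRight Y h) x)
    rw [← k.res_comp, ← k.res_comp]
    rfl
  app_tr {X Y} f x := k.res_tr (isPB_prodMapRight f h) x

/-- Differences of morphisms of modules. -/
def Hom.sub {M : Mod.{u, w, v} k} {N : Mod.{u, w, w'} k} (φ ψ : Mod.Hom M N) : Mod.Hom M N where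
  app X := φ.app X - ψ.app X
  app_res f x := by simp [φ.app_res, ψ.app_res]
  app_tr f x := by simp [φ.app_tr, ψ.app_tr]

/-- The zero morphism of modules. -/
def Hom.zero (M : Mod.{u, w, v} k) (N : Mod.{u, w, w'} k) : Mod.Hom M N where
  app X := 0
  app_res f x := by simp
  app_tr f x := by simp

theorem Box.toShift_shiftMap {M : Mod.{u, w, v} k} {Z Z' X : FinGSet.{u} G} (h : Z' →[G] Z)
    (x : Box M (k.shift Z) X) :
    ((boxMap M (shiftMap k h)).app X x : Box M (k.shift Z') X).toShift =
      M.res (prodMapRight X h) x.toShift := by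
  induction x using Box.ind with | h Y p a b
  change k.obj (prod Y Z) at b
  change M.tr (prodMap p Z') (k.res (prodMapRight Y h) b • M.res (prodFst Y Z') a) =
    M.res (prodMapRight X h) (M.tr (prodMap p Z) (b • M.res (prodFst Y Z) a))
  rw [M.res_tr (isPB_prodMapRight p h), M.res_smul, ← M.res_comp]
  rfl

theorem Box.toShift_shiftMap_sub {M : Mod.{u, w, v} k} {Z Z' X : FinGSet.{u} G}
    (h h' : Z' →[G] Z) (x : Box M (k.shift Z) X) :
    ((boxMap M ((shiftMap k h).sub (shiftMap k h'))).app X x : Box M (k.shift Z') X).toShift =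
      M.res (prodMapRight X h) x.toShift - M.res (prodMapRight X h') x.toShift := by
  rw [← toShift_shiftMap, ← toShift_shiftMap]
  induction x using Box.ind with | h Y p a b
  change k.obj (prod Y Z) at b
  change M.tr (prodMap p Z') ((k.res (prodMapRight Y h) b - k.res (prodMapRight Y h') b) •
    M.res (prodFst Y Z') a) = M.tr (prodMap p Z') (k.res (prodMapRight Y h) b •
    M.res (prodFst Y Z') a) - M.tr (prodMap p Z') (k.res (prodMapRight Y h') b •
    M.res (prodFst Y Z') a)
  rw [sub_smul, map_sub]

/-- A flat module satisfies descent along `Z → Z₀` if `k` does. -/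
theorem IsFlat.descent {M : Mod.{u, w, w} k} (hM : M.IsFlat) {Z Z₀ Z₁ : FinGSet.{u} G}
    (h : Z →[G] Z₀) (h₁ h₂ : Z₁ →[G] Z)
    (inj : ∀ X, Function.Injective (k.res (prodMapRight X h)))
    (exact : ∀ X (x : k.obj (prod X Z)),
      k.res (prodMapRight X h₁) x = k.res (prodMapRight X h₂) x ↔
        ∃ y, k.res (prodMapRight X h) y = x) (X : FinGSet.{u} G) :
    Function.Injective (M.res (prodMapRight X h)) ∧
      ∀ x : M.obj (prod X Z), M.res (prodMapRight X h₁) x = M.res (prodMapRight X h₂) x →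
        ∃ y, M.res (prodMapRight X h) y = x := by
  constructor
  · rw [injective_iff_map_eq_zero]
    intro y hy
    obtain ⟨x, rfl⟩ := (Box.toShift_bijective M Z₀ X).2 y
    rw [← Box.toShift_shiftMap] at hy
    have h0 := hM (k.shift Z₀) (k.shift Z₀) (k.shift Z) (Hom.zero _ _) (shiftMap k h) (fun Y y => by
      constructor
      · intro hy
        exact ⟨0, (inj Y (hy.trans (map_zero (k.res (prodMapRight Y h))).symm)).symm⟩
      · rintro ⟨_, rfl⟩
        exact map_zero (k.res (prodMapRight Y h))) X x
    obtain ⟨x', hx'⟩ := h0.1 ((Box.toShift_bijective M Z X).1 (hy.trans Box.toShift_zero.symm))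
    have hz : (boxMap M (Hom.zero (k.shift Z₀) (k.shift Z₀))).app X x' = 0 := by
      induction x' using Box.ind with | h Y p a b
      exact Box.mk_zero_right p a
    rw [← hx', hz]
    exact Box.toShift_zero
  · intro x' hx
    obtain ⟨x, rfl⟩ := (Box.toShift_bijective M Z X).2 x'
    have h0 := hM (k.shift Z₀) (k.shift Z) (k.shift Z₁) (shiftMap k h)
      ((shiftMap k h₁).sub (shiftMap k h₂)) (fun Y y =>
        (sub_eq_zero (a := k.res (prodMapRight Y h₁) y)).trans (exact Y y)) X x
    obtain ⟨y, hy⟩ := h0.1 ((Box.toShift_bijective M Z₁ X).1 (by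
      refine (Box.toShift_shiftMap_sub h₁ h₂ x).trans ?_
      rw [hx, sub_self]
      exact Box.toShift_zero.symm))
    refine ⟨Box.toShift y, ?_⟩
    exact (Box.toShift_shiftMap h y).symm.trans (congrArg Box.toShift hy)

end Mod
end TambaraFunctor

namespace TambaraFunctor

variable {G : Type u} [Group G] [Finite G] {F : Type v}

section Descent

variable [CommRing F] {ℓ : TambaraFunctor.{u, max u v} G} (η : Hom (const.{u, v} G F) ℓ)

/-- The constant Tambara functor satisfies descent along `G → pt`. -/
theorem descent_of_isFlat (hη : η.toMod.IsFlat) (X : FinGSet.{u} G) :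
    Function.Injective (ℓ.res (prodMapRight X (toPt (reg G)))) ∧
      ∀ x, ℓ.res (prodMapRight X (prodFst (reg G) (reg G))) x =
        ℓ.res (prodMapRight X (prodSnd (reg G) (reg G))) x →
        ∃ y, ℓ.res (prodMapRight X (toPt (reg G))) y = x := by
  refine Mod.IsFlat.descent hη (toPt (reg G)) (prodFst (reg G) (reg G)) (prodSnd (reg G) (reg G))
    ?_ ?_ X
  · intro X φ ψ h
    refine Subtype.ext (funext fun t => ?_)
    exact congrFun (congrArg Subtype.val h) (t.1, toReg 1)
  · intro X φ
    constructor
    · intro h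
      have h' : ∀ (x : X) (g g' : reg G), φ.1 (x, g) = φ.1 (x, g') := fun x g g' =>
        congrFun (congrArg Subtype.val h) (x, (g, g'))
      refine ⟨⟨fun t => φ.1 (t.1, toReg 1), fun g t => ?_⟩, ?_⟩
      · exact (h' (g • t.1) (toReg 1) (g • toReg 1)).trans (φ.2 g (t.1, toReg 1))
      · exact Subtype.ext (funext fun t => h' _ _ _)
    · rintro ⟨y, rfl⟩
      rfl

theorem ext_of_isFlat (hη : η.toMod.IsFlat) {X : FinGSet.{u} G} {z z' : ℓ.obj X}
    (h : ∀ x : X, ℓ.ev x z = ℓ.ev x z') : z = z' := by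
  have h1 : ℓ.res (prodFst X (pt G)) z = ℓ.res (prodFst X (pt G)) z' := by
    apply (descent_of_isFlat η hη X).1
    refine ℓ.ext_free (prodSnd X (reg G)) fun t => ?_
    rw [ev_res, ev_res, ev_res, ev_res]
    exact h t.1
  let s : X →[G] prod X (pt G) := prodLift (MulActionHom.id G) (toPt X)
  have h2 : ∀ z : ℓ.obj X, ℓ.res s (ℓ.res (prodFst X (pt G)) z) = z := fun z => by
    rw [ℓ.res_res _ _ (MulActionHom.id G) (fun _ => rfl), ℓ.res_id]
  rw [← h2 z, h1, h2]

theorem ev_tr_orbitMap (T : TambaraFunctor.{u, w} G) {X : FinGSet.{u} G} (q : X →[G] reg G)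
    (x : X) (a : T.obj (reg G)) : T.ev x (T.tr (orbitMap x) a) = a := by
  have hinj : ∀ g : reg G, orbitMap x g = x → g = toReg 1 := by
    intro g hg
    have h1 := congrArg (fun y => regVal (q y)) hg
    have h2 : regVal g * regVal (q x) = regVal (q x) :=
      (congrArg regVal (map_smul q (regVal g) x)).symm.trans h1
    have h3 : regVal g = 1 := mul_eq_right.1 h2
    exact h3
  rw [T.ev_tr]
  have : Unique {g // orbitMap x g = x} :=
    ⟨⟨⟨toReg 1, one_smul G x⟩⟩, fun g => Subtype.ext (hinj g.1 g.2)⟩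
  rw [finsum_unique, hinj _ (default : {g // orbitMap x g = x}).2, ev_one]

theorem ev_tr_orbitMap_of_ne (T : TambaraFunctor.{u, w} G) {X : FinGSet.{u} G}
    {x y : X} (h : ∀ g : reg G, orbitMap x g ≠ y) (a : T.obj (reg G)) :
    T.ev y (T.tr (orbitMap x) a) = 0 := by
  rw [T.ev_tr]
  have : IsEmpty {g // orbitMap x g = y} := ⟨fun g => h g.1 g.2⟩
  exact finsum_of_isEmpty _

/-- Compatible families of values define an element, if `ℓ` is flat. -/
theorem exists_of_isFlat (hη : η.toMod.IsFlat) {X : FinGSet.{u} G} (a : X → ℓ.obj (reg G))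
    (ha : ∀ (g : G) x, ℓ.ev (toReg g) (a x) = a (g • x)) : ∃ z : ℓ.obj X, ∀ x, ℓ.ev x z = a x := by
  classical
  have := Fintype.ofFinite X
  let p : X → prod X (reg G) := fun x => (x, toReg 1)
  let w : ℓ.obj (prod X (reg G)) := ∑ x : X, ℓ.tr (orbitMap (p x)) (a x)
  have hw1 : ∀ x, ℓ.ev (p x) w = a x := by
    intro x
    rw [map_sum, Finset.sum_eq_single x]
    · exact ℓ.ev_tr_orbitMap (prodSnd X (reg G)) (p x) (a x)
    · intro y _ hy
      refine ℓ.ev_tr_orbitMap_of_ne (fun g hg => hy ?_) (a y)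
      have h1 : regVal g • y = x := congrArg (fun t : X × reg G => t.1) hg
      have h2 : regVal g * 1 = 1 := congrArg (fun t : X × reg G => regVal t.2) hg
      rw [mul_one] at h2
      rw [← h1, h2, one_smul]
    · exact fun h => (h (Finset.mem_univ x)).elim
  have hw : ∀ (x : X) (g : reg G), ℓ.ev (X := prod X (reg G)) (x, g) w = a x := by
    intro x g
    have h : ((x, g) : prod X (reg G)) = regVal g • p ((regVal g)⁻¹ • x) :=
      Prod.ext (smul_inv_smul _ _).symm (regVal_smul_toReg_one g).symm
    rw [h, ℓ.ev_smul, hw1, ha, smul_inv_smul]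
  obtain ⟨y, hy⟩ := (descent_of_isFlat η hη X).2 w (by
    refine ℓ.ext_free ((prodFst _ _).comp (prodSnd X (prod (reg G) (reg G)))) fun t => ?_
    rw [ev_res, ev_res]
    exact (hw _ _).trans (hw _ _).symm)
  refine ⟨ℓ.res (prodLift (MulActionHom.id G) (toPt X)) y, fun x => ?_⟩
  rw [ev_res, ← hw x (toReg 1), ← hy]
  exact (ℓ.ev_res (prodMapRight X (toPt (reg G))) (show prod X (reg G) from (x, toReg 1)) y).symm

end Descent

section Fiber

variable [Field F] {ℓ : TambaraFunctor.{u, max u v} G} (η : Hom (const.{u, v} G F) ℓ)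

/-- The value of an algebra at the orbit `G`, as an `F`-algebra. -/
def Fiber (_ : Hom (const.{u, v} G F) ℓ) : Type (max u v) := ℓ.obj (reg G)

instance : CommRing (Fiber η) := inferInstanceAs (CommRing (ℓ.obj (reg G)))

/-- Constant functions. -/
def constFun (X : FinGSet.{u} G) : F →+* (const.{u, v} G F).obj X where
  toFun c := ⟨fun _ => c, fun _ _ => rfl⟩
  map_one' := rfl
  map_mul' _ _ := rfl
  map_zero' := rfl
  map_add' _ _ := rfl

noncomputable instance : Algebra F (Fiber η) :=
  RingHom.toAlgebra (S := Fiber η) ((η.app (reg G)).comp (constFun (reg G)))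

/-- The value at a point. -/
def evFiber {X : FinGSet.{u} G} (x : X) : ℓ.obj X →+* Fiber η := ℓ.ev x

theorem evFiber_res {X Y : FinGSet.{u} G} (f : X →[G] Y) (x : X) (z : ℓ.obj Y) :
    evFiber η x (ℓ.res f z) = evFiber η (f x) z :=
  ℓ.ev_res f x z

theorem evFiber_tr {X Y : FinGSet.{u} G} (f : X →[G] Y) (y : Y) (z : ℓ.obj X) :
    evFiber η y (ℓ.tr f z) = ∑ᶠ x : {x // f x = y}, evFiber η (x : X) z :=
  ℓ.ev_tr f y z

theorem evFiber_nm {X Y : FinGSet.{u} G} (f : X →[G] Y) (y : Y) (z : ℓ.obj X) :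
    evFiber η y (ℓ.nm f z) = ∏ᶠ x : {x // f x = y}, evFiber η (x : X) z :=
  ℓ.ev_nm f y z

theorem evFiber_app {X : FinGSet.{u} G} (x : X) (c : (const.{u, v} G F).obj X) :
    evFiber η x (η.app X c) = algebraMap F (Fiber η) (c.1 x) := by
  refine (η.app_res (orbitMap x) c).symm.trans (congrArg (η.app (reg G)) ?_)
  exact Subtype.ext (funext fun g => c.2 _ x)

/-- The action of the group on the value at the orbit `G`. -/
def actFiber (g : G) : Fiber η →ₐ[F] Fiber η where
  __ := (ℓ.ev (toReg g) : Fiber η →+* Fiber η)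
  commutes' c := evFiber_app η (toReg g) (constFun (reg G) c)

theorem evFiber_smul {X : FinGSet.{u} G} (g : G) (x : X) (z : ℓ.obj X) :
    evFiber η (g • x) z = actFiber η g (evFiber η x z) :=
  ℓ.ev_smul g x z

theorem actFiber_one (a : Fiber η) : actFiber η 1 a = a :=
  ℓ.ev_one a

theorem actFiber_mul (g h : G) (a : Fiber η) :
    actFiber η (g * h) a = actFiber η g (actFiber η h a) :=
  ℓ.ev_smul g (toReg h) a

theorem evFiber_toReg_one (a : ℓ.obj (reg G)) : evFiber η (toReg 1) a = a :=
  ℓ.ev_one a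

theorem finite_fiber (hη : η.IsFinite) : Module.Finite F (Fiber η) := by
  obtain ⟨n, X, m, hm⟩ := hη
  let s : Set (Fiber η) := Set.range fun t : Σ i, X i => evFiber η t.2 (m t.1)
  let V : Submodule F (Fiber η) := Submodule.span F s
  let N : η.toMod.Sub :=
    { carrier := fun X =>
        { carrier := {z : ℓ.obj X | ∀ x : X, evFiber η x z ∈ V}
          add_mem' := fun {z z'} h h' x => by
            have h2 : evFiber η x (z + z' : ℓ.obj X) = _ := map_add (evFiber η x) z z'
            exact h2 ▸ V.add_mem (h x) (h' x)
          zero_mem' := fun x => by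
            have h2 : evFiber η x (0 : ℓ.obj X) = 0 := map_zero (evFiber η x)
            exact h2 ▸ V.zero_mem
          smul_mem' := fun c z h x => by
            have h2 : evFiber η x (η.app X c * show ℓ.obj X from z) = c.1 x • evFiber η x z := by
              rw [map_mul, evFiber_app, Algebra.smul_def]
            exact h2 ▸ V.smul_mem (c.1 x) (h x) }
      res_mem := fun f z h x => by
        exact (evFiber_res η f x z).symm ▸ h (f x)
      tr_mem := fun {X Y} f z h y => by
        refine (evFiber_tr η f y z).symm ▸ ?_
        exact finsum_induction (· ∈ V) V.zero_mem (fun _ _ => V.add_mem) fun x => h x }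
  have hN : ∀ i, m i ∈ N.carrier (X i) := fun i x => Submodule.subset_span ⟨⟨i, x⟩, rfl⟩
  have hV : V = ⊤ := by
    rw [eq_top_iff]
    intro a _
    have h : (a : ℓ.obj (reg G)) ∈ N.carrier (reg G) := by
      rw [hm N hN]
      trivial
    exact evFiber_toReg_one η a ▸ h (toReg 1)
  exact ⟨⟨(Set.finite_range _).toFinset, by simpa using hV⟩⟩

end Fiber

end TambaraFunctor

namespace TambaraFunctor

variable {G : Type u} [Group G] [Finite G]

/-- The elements all of whose values at points lie in the square of the ideal `I(G)`. -/
def TIdeal.pointSq {T : TambaraFunctor.{u, w} G} (I : TIdeal T) : TIdeal T where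
  carrier X := ⨅ x : X, Ideal.comap (T.ev x) (I.carrier (reg G) ^ 2)
  res_mem {X Y} f z h := by
    simp only [Submodule.mem_iInf, Ideal.mem_comap] at h ⊢
    intro x
    rw [T.ev_res]
    exact h (f x)
  tr_mem {X Y} f z h := by
    simp only [Submodule.mem_iInf, Ideal.mem_comap] at h ⊢
    intro y
    rw [T.ev_tr]
    exact finsum_induction (· ∈ I.carrier (reg G) ^ 2) (zero_mem _) (fun _ _ => add_mem)
      fun x => h x
  nm_mem {X Y} f hf z h := by
    classical
    simp only [Submodule.mem_iInf, Ideal.mem_comap] at h ⊢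
    intro y
    obtain ⟨x, hx⟩ := hf y
    have := Fintype.ofFinite X
    rw [T.ev_nm, finprod_eq_prod_of_fintype,
      ← Finset.mul_prod_erase _ _ (Finset.mem_univ ⟨x, hx⟩)]
    exact Ideal.mul_mem_right _ _ (h x)

theorem TIdeal.gtOne_reg_le {T : TambaraFunctor.{u, w} G} (I : TIdeal T) :
    I.gtOne.carrier (reg G) ≤ I.carrier (reg G) ^ 2 := by
  intro z hz
  have hI : I.ContainsNorms I.pointSq := by
    constructor
    · intro X x y hx hy
      simp only [pointSq, Submodule.mem_iInf, Ideal.mem_comap]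
      intro t
      rw [map_mul, pow_two]
      exact Ideal.mul_mem_mul (I.res_mem _ _ hx) (I.res_mem _ _ hy)
    · intro X Y f hX hY hf z hz
      classical
      simp only [pointSq, Submodule.mem_iInf, Ideal.mem_comap]
      intro y
      simp only [Function.Injective, not_forall] at hf
      obtain ⟨a, b, hab, hne⟩ := hf
      obtain ⟨g, hg⟩ := MulAction.exists_smul_eq G (f a) y
      have ha : f (g • a) = y := by rw [map_smul, hg]
      have hb : f (g • b) = y := by rw [map_smul, ← hab, hg]
      have hne' : (⟨g • b, hb⟩ : {x // f x = y}) ≠ ⟨g • a, ha⟩ := fun h =>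
        hne (MulAction.injective g (congrArg Subtype.val h)).symm
      have := Fintype.ofFinite X
      rw [T.ev_nm, finprod_eq_prod_of_fintype,
        ← Finset.mul_prod_erase _ _ (Finset.mem_univ ⟨g • a, ha⟩),
        ← Finset.mul_prod_erase _ _ (Finset.mem_erase.2 ⟨hne', Finset.mem_univ _⟩), ← mul_assoc,
        pow_two]
      exact Ideal.mul_mem_right _ _
        (Ideal.mul_mem_mul (I.res_mem _ _ hz) (I.res_mem _ _ hz))
  have h : z ∈ I.pointSq.carrier (reg G) := by
    have h1 : z ∈ ⨅ (J : TIdeal T) (_ : I.ContainsNorms J), J.carrier (reg G) := hz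
    simp only [Submodule.mem_iInf] at h1
    exact h1 _ hI
  have h2 : ∀ x : reg G, T.ev x z ∈ I.carrier (reg G) ^ 2 := by
    simpa only [pointSq, Submodule.mem_iInf, Ideal.mem_comap] using h
  simpa only [ev_one] using h2 (toReg 1)

variable {F : Type v} [Field F] {ℓ : TambaraFunctor.{u, max u v} G}
  (η : Hom (const.{u, v} G F) ℓ)

open scoped TensorProduct

/-- The underlying map of `AlgBox.toTensor`. -/
noncomputable def AlgBox.toTensorFun (x : AlgBox.Obj η η (reg G)) : Fiber η ⊗[F] Fiber η :=
  Quot.liftOn x (fun r => ∑ᶠ z : {z // r.map z = toReg 1},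
      (evFiber η (z : r.dom) r.fst) ⊗ₜ[F] (evFiber η (z : r.dom) r.snd)) fun r r' h => by
    cases h with
    | @left Y Z g p a b =>
      change ℓ.obj Y at a
      change ℓ.obj Z at b
      change ∑ᶠ z : {z // p z = toReg 1}, evFiber η (z : Z) (ℓ.tr g a) ⊗ₜ[F] evFiber η (z : Z) b =
        ∑ᶠ y : {y // p (g y) = toReg 1}, evFiber η (y : Y) a ⊗ₜ[F] evFiber η (y : Y) (ℓ.res g b)
      rw [finsum_fib_comp (M := Fiber η ⊗[F] Fiber η) g p
        (fun y => evFiber η y a ⊗ₜ[F] evFiber η y (ℓ.res g b))]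
      refine finsum_congr fun z => ?_
      rw [evFiber_tr]
      refine (map_finsum ((TensorProduct.mk F (Fiber η) (Fiber η)).flip _)
        (Set.toFinite _)).trans (finsum_congr fun y => ?_)
      rw [evFiber_res, y.2]
      rfl
    | @right Y Z g p a b =>
      change ℓ.obj Z at a
      change ℓ.obj Y at b
      change ∑ᶠ z : {z // p z = toReg 1}, evFiber η (z : Z) a ⊗ₜ[F] evFiber η (z : Z) (ℓ.tr g b) =
        ∑ᶠ y : {y // p (g y) = toReg 1}, evFiber η (y : Y) (ℓ.res g a) ⊗ₜ[F] evFiber η (y : Y) b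
      rw [finsum_fib_comp (M := Fiber η ⊗[F] Fiber η) g p
        (fun y => evFiber η y (ℓ.res g a) ⊗ₜ[F] evFiber η y b)]
      refine finsum_congr fun z => ?_
      rw [evFiber_tr]
      refine (map_finsum (TensorProduct.mk F (Fiber η) (Fiber η) _)
        (Set.toFinite _)).trans (finsum_congr fun y => ?_)
      rw [evFiber_res, y.2]
      rfl
    | @smul Y p c a b =>
      refine finsum_congr fun y => ?_
      change evFiber η (y : Y) (η.app Y c * show ℓ.obj Y from a) ⊗ₜ[F] _ =
        _ ⊗ₜ[F] evFiber η (y : Y) (η.app Y c * show ℓ.obj Y from b)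
      rw [map_mul, map_mul, evFiber_app, ← Algebra.smul_def, ← Algebra.smul_def,
        TensorProduct.smul_tmul]

theorem AlgBox.toTensorFun_mk {Y : FinGSet.{u} G} (p : Y →[G] reg G) (a b : ℓ.obj Y) :
    toTensorFun η (AlgBox.mk p a b) = ∑ᶠ z : {z // p z = toReg 1},
      (evFiber η (z : Y) a) ⊗ₜ[F] (evFiber η (z : Y) b) :=
  rfl

/-- The identification of `(ℓ ⊠ ℓ)(G)` with `ℓ(G) ⊗ ℓ(G)`, as an additive map. -/
noncomputable def AlgBox.toTensor : AlgBox.Obj η η (reg G) →+ Fiber η ⊗[F] Fiber η :=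
  AddMonoidHom.mk' (toTensorFun η) fun x y => by
    induction x using AlgBox.ind with | h A p a b
    induction y using AlgBox.ind with | h B q c d
    obtain ⟨s, t, h1, h2, h3, h4, h⟩ := exists_mk_add (η := η) (σ := η) p a b q c d
    rw [h, toTensorFun_mk, toTensorFun_mk, toTensorFun_mk,
      finsum_fib_coprod (isCoprod_sum A B).desc_bijective (desc p q) (toReg 1)
        (fun z => evFiber η z s ⊗ₜ[F] evFiber η z t)]
    simp only [← evFiber_res, h1, h2, h3, h4]
    rfl

theorem AlgBox.toTensor_mk_id (a b : Fiber η) :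
    toTensor η (AlgBox.mk (MulActionHom.id G) a b) = a ⊗ₜ[F] b := by
  change ∑ᶠ z : {z : reg G // z = toReg 1}, _ = _
  rw [finsum_unique]
  change evFiber η (toReg 1) a ⊗ₜ[F] evFiber η (toReg 1) b = _
  exact congrArg₂ _ (evFiber_toReg_one η a) (evFiber_toReg_one η b)

theorem AlgBox.closure_mk_id :
    AddSubgroup.closure (Set.range fun t : ℓ.obj (reg G) × ℓ.obj (reg G) =>
      (AlgBox.mk (MulActionHom.id G) t.1 t.2 : AlgBox.Obj η η (reg G))) = ⊤ := by
  rw [eq_top_iff]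
  intro x _
  induction x using AlgBox.ind with | h Y p a b
  have h := (algBox η η).ev_tr p (toReg 1) (AlgBox.mk (MulActionHom.id G) a b : AlgBox.Obj η η Y)
  rw [ev_one] at h
  have h' : (AlgBox.mk p a b : AlgBox.Obj η η (reg G)) = _ := h
  rw [h']
  refine finsum_induction (· ∈ AddSubgroup.closure _) (zero_mem _) (fun _ _ => add_mem) fun z => ?_
  refine AddSubgroup.subset_closure ⟨(ℓ.ev (z : Y) a, ℓ.ev (z : Y) b), ?_⟩
  exact (AlgBox.res_mk (isPB_id_id (orbitMap (z : Y))).symm a b).symm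

theorem AlgBox.toTensor_mul (x y : AlgBox.Obj η η (reg G)) :
    toTensor η (x * y) = toTensor η x * toTensor η y := by
  have hx : x ∈ AddSubgroup.closure _ := (closure_mk_id η).symm ▸ AddSubgroup.mem_top x
  have hy : y ∈ AddSubgroup.closure _ := (closure_mk_id η).symm ▸ AddSubgroup.mem_top y
  induction hx using AddSubgroup.closure_induction with
  | zero => simp
  | add x x' _ _ h h' => rw [add_mul, map_add, map_add, add_mul, h, h']
  | neg x _ h => rw [neg_mul, map_neg, map_neg, neg_mul, h]
  | mem x hx =>
    obtain ⟨⟨a, b⟩, rfl⟩ := hx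
    induction hy using AddSubgroup.closure_induction with
    | zero => simp
    | add x x' _ _ h h' => rw [mul_add, map_add, map_add, mul_add, h, h']
    | neg x _ h => rw [mul_neg, map_neg, map_neg, mul_neg, h]
    | mem y hy =>
      obtain ⟨⟨c, d⟩, rfl⟩ := hy
      dsimp only
      rw [mk_mul (isPB_id_id (MulActionHom.id G)) (r := MulActionHom.id G) (fun _ => rfl)]
      simp only [ℓ.res_id]
      have h1 := (Algebra.TensorProduct.tmul_mul_tmul (R := F) (A := Fiber η) (B := Fiber η)
        a c b d).symm
      exact (toTensor_mk_id η _ _).trans (h1.trans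
        (congrArg₂ (· * ·) (toTensor_mk_id η a b) (toTensor_mk_id η c d)).symm)

theorem AlgBox.toTensor_surjective : Function.Surjective (toTensor η) := by
  intro t
  induction t using TensorProduct.induction_on with
  | zero => exact ⟨0, map_zero _⟩
  | tmul a b => exact ⟨_, toTensor_mk_id η a b⟩
  | add x y hx hy =>
    obtain ⟨x, rfl⟩ := hx
    obtain ⟨y, rfl⟩ := hy
    exact ⟨x + y, map_add _ _ _⟩

theorem AlgBox.lmul_toTensor (x : AlgBox.Obj η η (reg G)) :
    Algebra.TensorProduct.lmul' F (toTensor η x) = (mulHom η).app (reg G) x := by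
  have hx : x ∈ AddSubgroup.closure _ := (closure_mk_id η).symm ▸ AddSubgroup.mem_top x
  induction hx using AddSubgroup.closure_induction with
  | zero =>
    rw [map_zero, map_zero]
    exact (map_zero ((mulHom η).app (reg G))).symm
  | add x x' _ _ h h' =>
    rw [map_add, map_add, h, h']
    exact (map_add ((mulHom η).app (reg G)) x x').symm
  | neg x _ h =>
    rw [map_neg, map_neg, h]
    exact (map_neg ((mulHom η).app (reg G)) x).symm
  | mem x hx =>
    obtain ⟨⟨a, b⟩, rfl⟩ := hx
    dsimp only
    exact (congrArg _ (toTensor_mk_id η a b)).trans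
      ((Algebra.TensorProduct.lmul'_apply_tmul _ _).trans (ℓ.tr_id (X := reg G) _).symm)

/-- If the genuine Kähler differentials of `ℓ` vanish, then so do the Kähler differentials
of `ℓ(G)`. -/
theorem isIdempotentElem_ideal_fiber (hη : ∀ X, Subsingleton (Kaehler η X)) :
    IsIdempotentElem (KaehlerDifferential.ideal F (Fiber η)) := by
  refine le_antisymm Ideal.mul_le_right fun t ht => ?_
  obtain ⟨x, rfl⟩ := AlgBox.toTensor_surjective η t
  have hmem : ∀ x : (algBox η η).obj (reg G), x ∈ (mulHom η).ker.carrier (reg G) ↔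
      AlgBox.toTensor η x ∈ KaehlerDifferential.ideal F (Fiber η) := by
    intro x
    rw [KaehlerDifferential.ideal, RingHom.mem_ker]
    exact (Iff.of_eq (congrArg (· = (0 : Fiber η)) (AlgBox.lmul_toTensor η x))).symm
  have h1 : (mulHom η).ker.carrier (reg G) ≤ (mulHom η).ker.gtOne.carrier (reg G) := by
    rw [← Submodule.comap_subtype_eq_top]
    exact Submodule.Quotient.subsingleton_iff.1 (hη (reg G))
  have h2 : x ∈ (mulHom η).ker.carrier (reg G) ^ 2 :=
    TIdeal.gtOne_reg_le _ (h1 ((hmem x).2 ht))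
  rw [pow_two] at h2
  refine Submodule.mul_induction_on (C := fun x : (algBox η η).obj (reg G) =>
    AlgBox.toTensor η x ∈ KaehlerDifferential.ideal F (Fiber η) *
      KaehlerDifferential.ideal F (Fiber η)) h2 (fun a ha b hb => ?_) (fun a b ha hb => ?_)
  · have := AlgBox.toTensor_mul η a b
    refine (congrArg (· ∈ _) this).mpr ?_
    exact Ideal.mul_mem_mul ((hmem a).1 ha) ((hmem b).1 hb)
  · have := map_add (AlgBox.toTensor η) a b
    exact (congrArg (· ∈ _) this).mpr (add_mem ha hb)

/-- The fibre of a finite algebra with vanishing Kähler differentials is a finite product of copies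
of the ground field. -/
theorem fiber_isFiniteSplit [IsAlgClosed F] (hη : ∀ X, Subsingleton (Kaehler η X))
    (hfin : η.IsFinite) : Algebra.IsFiniteSplit F (Fiber η) := by
  have := finite_fiber η hfin
  have : Algebra.FormallyUnramified F (Fiber η) :=
    ⟨(Ideal.cotangent_subsingleton_iff _).2 (isIdempotentElem_ideal_fiber η hη)⟩
  have : Algebra.FormallyEtale F (Fiber η) := .of_formallyUnramified_of_field F (Fiber η)
  infer_instance

/-- A finite split algebra over a field is the algebra of functions on its set of points. -/
theorem _root_.Algebra.IsFiniteSplit.eval_bijective {K : Type v} {A : Type w} [Field K]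
    [CommRing A] [Algebra K A] [Algebra.IsFiniteSplit K A] :
    Function.Bijective fun (a : A) (y : A →ₐ[K] K) => y a := by
  classical
  obtain ⟨n, ⟨e⟩⟩ := Algebra.IsFiniteSplit.nonempty_algEquiv_fun K A
  let y : Fin n → (A →ₐ[K] K) := fun i => (Pi.evalAlgHom K (fun _ : Fin n => K) i).comp e.toAlgHom
  have hy : ∀ i a, y i a = e a i := fun _ _ => rfl
  constructor
  · intro a b h
    apply e.injective
    funext i
    exact congrFun h (y i)
  · intro c
    refine ⟨e.symm fun i => c (y i), funext fun z => ?_⟩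
    have h1 : ∑ i, z (e.symm (Pi.single i 1)) = 1 := by
      rw [← map_sum, ← map_sum, Finset.univ_sum_single (fun _ : Fin n => (1 : K))]
      exact (congrArg z (map_one e.symm)).trans (map_one z)
    obtain ⟨i, -, hi⟩ := Finset.exists_ne_zero_of_sum_ne_zero (h1.trans_ne one_ne_zero)
    have h2 : ∀ a : A, z a = y i a := by
      intro a
      refine mul_right_cancel₀ hi ?_
      rw [← map_mul]
      have : a * e.symm (Pi.single i 1) = y i a • e.symm (Pi.single i 1) := by
        apply e.injective
        rw [map_mul, map_smul, e.apply_symm_apply, hy]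
        funext j
        by_cases h : j = i
        · subst h; simp
        · simp [Pi.single_eq_of_ne h]
      rw [this, map_smul, smul_eq_mul]
    have h3 : z = y i := AlgHom.ext h2
    dsimp only
    rw [h3, hy, e.apply_symm_apply]

end TambaraFunctor

namespace TambaraFunctor

variable {G : Type u} [Group G] [Finite G] {F : Type v} [Field F]
  {ℓ : TambaraFunctor.{u, max u v} G} (η : Hom (const.{u, v} G F) ℓ)

/-- The points of the fibre at the orbit `G`. -/
abbrev Point : Type (max u v) := Fiber η →ₐ[F] F

variable {η}

/-- The right action of the group on the points of the fibre. -/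
noncomputable def Point.act (y : Point η) (g : G) : Point η := y.comp (actFiber η g)

theorem Point.act_one (y : Point η) : y.act 1 = y :=
  AlgHom.ext fun a => congrArg y (actFiber_one η a)

theorem Point.act_act (y : Point η) (g h : G) : (y.act g).act h = y.act (g * h) :=
  AlgHom.ext fun a => congrArg y (actFiber_mul η g h a).symm

/-- The stabilizer of a point. -/
noncomputable def Point.stab (y : Point η) : Subgroup G where
  carrier := {h | y.act h = y}
  mul_mem' {a b} ha hb := by
    change y.act a = y at ha
    change y.act b = y at hb
    change y.act (a * b) = y
    rw [← Point.act_act, ha, hb]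
  one_mem' := y.act_one
  inv_mem' {a} ha := by
    change y.act a = y at ha
    change y.act a⁻¹ = y
    conv_lhs => rw [← ha]
    rw [Point.act_act, mul_inv_cancel, Point.act_one]

theorem Point.mul_inv_mem_stab {y : Point η} {a b : G} (h : y.act a = y.act b) :
    a * b⁻¹ ∈ y.stab := by
  change y.act (a * b⁻¹) = y
  rw [← Point.act_act, h, Point.act_act, mul_inv_cancel, Point.act_one]

/-- Evaluation at a point, as a morphism to a coinduced algebra. -/
noncomputable def Point.hom (y : Point η) :
    Hom ℓ (coind y.stab (const.{u, v} y.stab F)) where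
  app X :=
    { toFun := fun z => ⟨fun x : X => y (evFiber η x z), fun h (x : X) => by
        change y (evFiber η ((h : G) • x) z) = _
        rw [evFiber_smul]
        exact congrArg (fun y : Point η => y (evFiber η x z)) h.2⟩
      map_one' := Subtype.ext (funext fun x : X => by
        change y (evFiber η x 1) = 1
        rw [map_one, map_one])
      map_mul' := fun a b => Subtype.ext (funext fun x : X => by
        change y (evFiber η x (a * b)) = y (evFiber η x a) * y (evFiber η x b)
        rw [map_mul, map_mul])
      map_zero' := Subtype.ext (funext fun x : X => by
        change y (evFiber η x 0) = 0
        rw [map_zero, map_zero])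
      map_add' := fun a b => Subtype.ext (funext fun x : X => by
        change y (evFiber η x (a + b)) = y (evFiber η x a) + y (evFiber η x b)
        rw [map_add, map_add]) }
  app_res {X Y} f z := Subtype.ext (funext fun x : X => congrArg y (evFiber_res η f x z))
  app_tr {X Y} f z := Subtype.ext (funext fun t : Y =>
    (congrArg y (evFiber_tr η f t z)).trans (map_finsum y (Set.toFinite _)))
  app_nm {X Y} f z := Subtype.ext (funext fun t : Y =>
    (congrArg y (evFiber_nm η f t z)).trans
      (map_finprod (y : Fiber η →* F) (Set.toFinite _)))

theorem Point.hom_comp (y : Point η) : y.hom.comp η = constToCoind G F y.stab := by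
  have h : ∀ (φ ψ : Hom (const.{u, v} G F) (coind y.stab (const.{u, v} y.stab F))),
      (∀ X c, φ.app X c = ψ.app X c) → φ = ψ := by
    rintro ⟨a, _, _, _⟩ ⟨b, _, _, _⟩ h
    congr
    exact funext fun X => RingHom.ext (h X)
  refine h _ _ fun X c => Subtype.ext (funext fun x : X => ?_)
  exact (congrArg y (evFiber_app η x c)).trans (y.commutes _)

/-- Representatives of the orbits of points. -/
theorem exists_orbit_representatives [Module.Finite F (Fiber η)] :
    ∃ (n : ℕ) (y : Fin n → Point η), (∀ z, ∃ i g, (y i).act g = z) ∧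
      ∀ i j a b, (y i).act a = (y j).act b → i = j := by
  let s : Setoid (Point η) :=
    { r := fun y z => ∃ g, y.act g = z
      iseqv :=
        { refl := fun y => ⟨1, y.act_one⟩
          symm := by
            rintro y _ ⟨g, rfl⟩
            exact ⟨g⁻¹, by rw [Point.act_act, mul_inv_cancel, Point.act_one]⟩
          trans := by
            rintro y _ _ ⟨g, rfl⟩ ⟨h, rfl⟩
            exact ⟨g * h, (Point.act_act _ _ _).symm⟩ } }
  obtain ⟨n, ⟨e⟩⟩ := Finite.exists_equiv_fin (Quotient s)
  refine ⟨n, fun i => (e.symm i).out, fun z => ⟨e ⟦z⟧, ?_⟩, fun i j a b h => ?_⟩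
  · change ∃ g, (e.symm (e ⟦z⟧)).out.act g = z
    rw [e.symm_apply_apply]
    exact Quotient.mk_out z
  · apply e.symm.injective
    rw [← Quotient.out_equiv_out]
    refine ⟨a * b⁻¹, ?_⟩
    rw [← Point.act_act, h, Point.act_act, mul_inv_cancel, Point.act_one]

theorem isIso_toPi_hom [Algebra.IsFiniteSplit F (Fiber η)] (hη : η.toMod.IsFlat) {n : ℕ}
    (y : Fin n → Point η) (hy : ∀ z, ∃ i g, (y i).act g = z)
    (hy' : ∀ i j a b, (y i).act a = (y j).act b → i = j) :
    (Hom.toPi fun i => (y i).hom).IsIso := by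
  have happ : ∀ {X : FinGSet.{u} G} (z : ℓ.obj X) (i : Fin n) (x : X),
      ((Hom.toPi fun i => (y i).hom).app X z i).1 x = y i (evFiber η x z) := fun _ _ _ => rfl
  have hbij := Algebra.IsFiniteSplit.eval_bijective (K := F) (A := Fiber η)
  intro X
  constructor
  · intro z z' h
    refine ext_of_isFlat η hη fun x => hbij.1 (funext fun p => ?_)
    obtain ⟨i, g, rfl⟩ := hy p
    have h1 : y i (evFiber η (g • x) z) = y i (evFiber η (g • x) z') :=
      congrFun (congrArg Subtype.val (congrFun h i)) (g • x)
    rw [evFiber_smul, evFiber_smul] at h1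
    exact h1
  · intro c
    have hc : ∀ i j a b, (y i).act a = (y j).act b → ∀ x : X,
        (c i).1 (a • x : X) = (c j).1 (b • x : X) := by
      intro i j a b h x
      obtain rfl := hy' i j a b h
      have h1 : (c i).1 ((a * b⁻¹) • b • x : X) = (c i).1 (b • x : X) :=
        (c i).2 ⟨a * b⁻¹, Point.mul_inv_mem_stab h⟩ (b • x : X)
      rw [← h1, smul_smul, inv_mul_cancel_right]
    choose I γ hγ using hy
    choose a ha using fun x : X => hbij.2 fun p => (c (I p)).1 (γ p • x : X)
    have ha' : ∀ x p, p (a x) = (c (I p)).1 (γ p • x : X) := fun x p => congrFun (ha x) p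
    obtain ⟨z, hz⟩ := exists_of_isFlat η hη a (by
      intro g x
      refine hbij.1 (funext fun p => ?_)
      change Point.act p g (a x) = p (a (g • x))
      rw [ha', ha', smul_smul]
      refine hc _ _ _ _ ?_ x
      rw [hγ, ← Point.act_act, hγ])
    refine ⟨z, funext fun i => Subtype.ext (funext fun x : X => ?_)⟩
    change y i (evFiber η x z) = _
    rw [show evFiber η x z = a x from hz x, ha']
    refine (hc _ i _ 1 ?_ x).trans (by rw [one_smul])
    rw [hγ, Point.act_one]

theorem exists_isIso_of_isEtale [IsAlgClosed F] (hfin : η.IsFinite) (h : η.IsFormallyEtale) :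
    ∃ (n : ℕ) (H : Fin n → Subgroup G)
        (φ : Hom ℓ (pi fun i => coind (H i) (const.{u, v} (H i) F))),
        φ.IsIso ∧ φ.comp η = Hom.toPi fun i => constToCoind G F (H i) := by
  have := finite_fiber η hfin
  have := fiber_isFiniteSplit η h.1 hfin
  obtain ⟨n, y, hy, hy'⟩ := exists_orbit_representatives (η := η)
  refine ⟨n, fun i => (y i).stab, Hom.toPi fun i => (y i).hom, isIso_toPi_hom h.2 y hy hy', ?_⟩
  exact congrArg (fun φ : ∀ i, Hom (const.{u, v} G F) (coind (y i).stab (const.{u, v} (y i).stab F))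
    => Hom.toPi φ) (funext fun i => (y i).hom_comp)

end TambaraFunctor

namespace FinGSet

variable (G : Type u) [Group G]

/-- Isomorphism classes of finite `G`-sets are represented by actions on the sets `Fin n`. -/
abbrev Skeleton : Type u := Σ n : ℕ, MulAction G (ULift.{u} (Fin n))

variable {G}

/-- The finite `G`-set defined by an action on `Fin n`. -/
def Skeleton.toFinGSet (j : Skeleton G) : FinGSet.{u} G where
  carrier := ULift.{u} (Fin j.1)
  action := j.2

theorem exists_skeleton (X : FinGSet.{u} G) : ∃ (j : Skeleton G) (e : X →[G] j.toFinGSet)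
    (e' : j.toFinGSet →[G] X), (∀ x, e' (e x) = x) ∧ ∀ x, e (e' x) = x := by
  obtain ⟨n, ⟨e⟩⟩ := Finite.exists_equiv_fin X
  let e' : X ≃ ULift.{u} (Fin n) := e.trans Equiv.ulift.symm
  let act : MulAction G (ULift.{u} (Fin n)) :=
    { smul := fun g x => e' (g • e'.symm x)
      one_smul := fun x => by
        change e' ((1 : G) • e'.symm x) = x
        rw [one_smul, e'.apply_symm_apply]
      mul_smul := fun g h x => by
        change e' ((g * h) • e'.symm x) = e' (g • e'.symm (e' (h • e'.symm x)))
        rw [mul_smul, e'.symm_apply_apply] }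
  refine ⟨⟨n, act⟩, ⟨e', fun g x => ?_⟩, ⟨e'.symm, fun g x => ?_⟩, e'.symm_apply_apply,
    e'.apply_symm_apply⟩
  · change e' (g • x) = e' (g • e'.symm (e' x))
    rw [e'.symm_apply_apply]
  · exact e'.symm_apply_apply (g • e'.symm x)

/-- The representative of a finite `G`-set. -/
noncomputable def skel (X : FinGSet.{u} G) : Skeleton G := (exists_skeleton X).choose

/-- The isomorphism to the representative. -/
noncomputable def toSkel (X : FinGSet.{u} G) : X →[G] X.skel.toFinGSet :=
  (exists_skeleton X).choose_spec.choose

/-- The isomorphism from the representative. -/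
noncomputable def ofSkel (X : FinGSet.{u} G) : X.skel.toFinGSet →[G] X :=
  (exists_skeleton X).choose_spec.choose_spec.choose

theorem ofSkel_toSkel (X : FinGSet.{u} G) (x : X) : X.ofSkel (X.toSkel x) = x :=
  (exists_skeleton X).choose_spec.choose_spec.choose_spec.1 x

theorem toSkel_ofSkel (X : FinGSet.{u} G) (x : X.skel.toFinGSet) : X.toSkel (X.ofSkel x) = x :=
  (exists_skeleton X).choose_spec.choose_spec.choose_spec.2 x

end FinGSet

namespace TambaraFunctor

variable {G : Type u} [Group G]

/-- Products of Tambara functors, indexed by a type in any universe. -/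
def product {ι : Type v} (T : ι → TambaraFunctor.{u, w} G) : TambaraFunctor.{u, max v w} G where
  obj X := ∀ i, (T i).obj X
  res f := RingHom.pi fun i => ((T i).res f).comp (Pi.evalRingHom _ i)
  tr f := AddMonoidHom.pi fun i => ((T i).tr f).comp (Pi.evalAddMonoidHom _ i)
  nm f := MonoidHom.pi fun i => ((T i).nm f).comp (Pi.evalMonoidHom _ i)
  res_id x := funext fun i => (T i).res_id (x i)
  tr_id x := funext fun i => (T i).tr_id (x i)
  nm_id x := funext fun i => (T i).nm_id (x i)
  res_comp g f x := funext fun i => (T i).res_comp g f (x i)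
  tr_comp g f x := funext fun i => (T i).tr_comp g f (x i)
  nm_comp g f x := funext fun i => (T i).nm_comp g f (x i)
  empty X h := ⟨fun x y => funext fun i => ((T i).empty X h).elim (x i) (y i)⟩
  coprod {X Y Z i j} h := by
    constructor
    · intro x y hxy
      funext k
      refine ((T k).coprod h).1 (Prod.ext ?_ ?_)
      · exact congrFun (congrArg Prod.fst hxy) k
      · exact congrFun (congrArg Prod.snd hxy) k
    · intro ⟨x, y⟩
      choose z hz using fun k => ((T k).coprod h).2 (x k, y k)
      refine ⟨z, Prod.ext ?_ ?_⟩
      · exact funext fun k => congrArg Prod.fst (hz k)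
      · exact funext fun k => congrArg Prod.snd (hz k)
  res_tr h x := funext fun i => (T i).res_tr h (x i)
  res_nm h x := funext fun i => (T i).res_nm h (x i)
  nm_tr h x := funext fun i => (T i).nm_tr h (x i)
  tr_mul_res f x y := funext fun i => (T i).tr_mul_res f (x i) (y i)

section Induced

variable (T : TambaraFunctor.{u, w'} G)

/-- A family of rings, embedded into a Tambara functor with image closed under restrictions,
transfers and norms. -/
structure Embedded where
  obj : FinGSet.{u} G → Type w
  [ring : ∀ X, CommRing (obj X)]
  incl : ∀ X, obj X →+* T.obj X
  inj : ∀ X, Function.Injective (incl X)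
  res_mem : ∀ {X Y : FinGSet.{u} G} (f : X →[G] Y) (z : obj Y), ∃ t, incl X t = T.res f (incl Y z)
  tr_mem : ∀ {X Y : FinGSet.{u} G} (f : X →[G] Y) (z : obj X), ∃ t, incl Y t = T.tr f (incl X z)
  nm_mem : ∀ {X Y : FinGSet.{u} G} (f : X →[G] Y) (z : obj X), ∃ t, incl Y t = T.nm f (incl X z)

attribute [instance] Embedded.ring

variable {T}

/-- Restrictions of an embedded family of rings. -/
noncomputable def Embedded.res (E : Embedded.{u, w, w'} T) {X Y : FinGSet.{u} G} (f : X →[G] Y) :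
    E.obj Y →+* E.obj X :=
  have h z : E.incl X (E.res_mem f z).choose = T.res f (E.incl Y z) := (E.res_mem f z).choose_spec
  { toFun := fun z => (E.res_mem f z).choose
    map_one' := E.inj _ (by rw [h, map_one, map_one, map_one])
    map_mul' := fun a b => E.inj _ (by rw [h, map_mul, map_mul, map_mul, h, h])
    map_zero' := E.inj _ (by rw [h, map_zero, map_zero, map_zero])
    map_add' := fun a b => E.inj _ (by rw [h, map_add, map_add, map_add, h, h]) }

/-- Transfers of an embedded family of rings. -/
noncomputable def Embedded.tr (E : Embedded.{u, w, w'} T) {X Y : FinGSet.{u} G} (f : X →[G] Y) :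
    E.obj X →+ E.obj Y :=
  have h z : E.incl Y (E.tr_mem f z).choose = T.tr f (E.incl X z) := (E.tr_mem f z).choose_spec
  { toFun := fun z => (E.tr_mem f z).choose
    map_zero' := E.inj _ (by rw [h, map_zero, map_zero, map_zero])
    map_add' := fun a b => E.inj _ (by rw [h, map_add, map_add, map_add, h, h]) }

/-- Norms of an embedded family of rings. -/
noncomputable def Embedded.nm (E : Embedded.{u, w, w'} T) {X Y : FinGSet.{u} G} (f : X →[G] Y) :
    E.obj X →* E.obj Y :=
  have h z : E.incl Y (E.nm_mem f z).choose = T.nm f (E.incl X z) := (E.nm_mem f z).choose_spec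
  { toFun := fun z => (E.nm_mem f z).choose
    map_one' := E.inj _ (by rw [h, map_one, map_one, map_one])
    map_mul' := fun a b => E.inj _ (by rw [h, map_mul, map_mul, map_mul, h, h]) }

theorem Embedded.incl_res (E : Embedded.{u, w, w'} T) {X Y : FinGSet.{u} G} (f : X →[G] Y)
    (z : E.obj Y) : E.incl X (E.res f z) = T.res f (E.incl Y z) :=
  (E.res_mem f z).choose_spec

theorem Embedded.incl_tr (E : Embedded.{u, w, w'} T) {X Y : FinGSet.{u} G} (f : X →[G] Y)
    (z : E.obj X) : E.incl Y (E.tr f z) = T.tr f (E.incl X z) :=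
  (E.tr_mem f z).choose_spec

theorem Embedded.incl_nm (E : Embedded.{u, w, w'} T) {X Y : FinGSet.{u} G} (f : X →[G] Y)
    (z : E.obj X) : E.incl Y (E.nm f z) = T.nm f (E.incl X z) :=
  (E.nm_mem f z).choose_spec

/-- The Tambara functor defined by an embedded family of rings. -/
noncomputable def Embedded.toTambara (E : Embedded.{u, w, w'} T) : TambaraFunctor.{u, w} G where
  obj := E.obj
  res := E.res
  tr := E.tr
  nm := E.nm
  res_id x := E.inj _ (by rw [E.incl_res, T.res_id])
  tr_id x := E.inj _ (by rw [E.incl_tr, T.tr_id])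
  nm_id x := E.inj _ (by rw [E.incl_nm, T.nm_id])
  res_comp g f x := E.inj _ (by rw [E.incl_res, E.incl_res, E.incl_res, T.res_comp])
  tr_comp g f x := E.inj _ (by rw [E.incl_tr, E.incl_tr, E.incl_tr, T.tr_comp])
  nm_comp g f x := E.inj _ (by rw [E.incl_nm, E.incl_nm, E.incl_nm, T.nm_comp])
  empty X hX := ⟨fun x y => E.inj _ ((T.empty X hX).elim _ _)⟩
  coprod {X Y Z i j} h := by
    constructor
    · intro x y hxy
      have h1 : E.res i x = E.res i y := congrArg Prod.fst hxy
      have h2 : E.res j x = E.res j y := congrArg Prod.snd hxy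
      refine E.inj _ (T.obj_ext h ?_ ?_)
      · rw [← E.incl_res, h1, E.incl_res]
      · rw [← E.incl_res, h2, E.incl_res]
    · rintro ⟨x, y⟩
      refine ⟨E.tr i x + E.tr j y, Prod.ext (E.inj _ ?_) (E.inj _ ?_)⟩
      · rw [E.incl_res, map_add, E.incl_tr, E.incl_tr, map_add, T.res_tr_inj h.inj_left,
          T.res_tr_disj h.symm, add_zero]
      · rw [E.incl_res, map_add, E.incl_tr, E.incl_tr, map_add, T.res_tr_inj h.inj_right,
          T.res_tr_disj h, zero_add]
  res_tr h x := E.inj _ (by rw [E.incl_res, E.incl_tr, E.incl_tr, E.incl_res, T.res_tr h])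
  res_nm h x := E.inj _ (by rw [E.incl_res, E.incl_nm, E.incl_nm, E.incl_res, T.res_nm h])
  nm_tr h x := E.inj _ (by
    rw [E.incl_nm, E.incl_tr, E.incl_tr, E.incl_nm, E.incl_res, T.nm_tr h])
  tr_mul_res f x y := E.inj _ (by
    rw [E.incl_tr, map_mul, map_mul (E.incl _) (E.tr f x), E.incl_tr, E.incl_res, T.tr_mul_res])

end Induced

section Free

variable {k : TambaraFunctor.{u, max u w} G} {n : ℕ} {L : Fin n → FinGSet.{u} G}

variable (k L) in
/-- Polynomials over `k`, in the operations of Tambara functors. -/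
inductive Term : Skeleton G → Type (max u w)
  | gen (i : Fin n) : Term (L i).skel
  | coe {j : Skeleton G} (c : k.obj j.toFinGSet) : Term j
  | add {j : Skeleton G} (a b : Term j) : Term j
  | mul {j : Skeleton G} (a b : Term j) : Term j
  | neg {j : Skeleton G} (a : Term j) : Term j
  | res {i j : Skeleton G} (f : i.toFinGSet →[G] j.toFinGSet) (a : Term j) : Term i
  | tr {i j : Skeleton G} (f : i.toFinGSet →[G] j.toFinGSet) (a : Term i) : Term j
  | nm {i j : Skeleton G} (f : i.toFinGSet →[G] j.toFinGSet) (a : Term i) : Term j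

variable (k L) in
/-- `k`-algebras with elements in given levels. -/
structure MarkedAlg where
  alg : TambaraFunctor.{u, max u w} G
  unit : Hom k alg
  elt : ∀ i, alg.obj (L i)

/-- The interpretation of polynomials. -/
noncomputable def MarkedAlg.interp (A : MarkedAlg k L) :
    ∀ {j : Skeleton G}, Term k L j → A.alg.obj j.toFinGSet
  | _, .gen i => A.alg.res (L i).ofSkel (A.elt i)
  | _, .coe c => A.unit.app _ c
  | _, .add a b => A.interp a + A.interp b
  | _, .mul a b => A.interp a * A.interp b
  | _, .neg a => - A.interp a
  | _, .res f a => A.alg.res f (A.interp a)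
  | _, .tr f a => A.alg.tr f (A.interp a)
  | _, .nm f a => A.alg.nm f (A.interp a)

variable (k L) in
/-- The product of all marked algebras. -/
def markedProduct := product fun A : MarkedAlg k L => A.alg

/-- The value of a polynomial in all marked algebras. -/
noncomputable def Term.val {X : FinGSet.{u} G} (t : Term k L X.skel) : (markedProduct k L).obj X :=
  fun A => A.alg.res X.toSkel (A.interp t)

variable (k L) in
/-- The ring of values of polynomials. -/
noncomputable def termRing (X : FinGSet.{u} G) : Subring ((markedProduct k L).obj X) where
  carrier := Set.range (Term.val (k := k) (L := L) (X := X))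
  mul_mem' := by
    rintro _ _ ⟨s, rfl⟩ ⟨t, rfl⟩
    exact ⟨s.mul t, funext fun A => map_mul (A.alg.res X.toSkel) _ _⟩
  add_mem' := by
    rintro _ _ ⟨s, rfl⟩ ⟨t, rfl⟩
    exact ⟨s.add t, funext fun A => map_add (A.alg.res X.toSkel) _ _⟩
  neg_mem' := by
    rintro _ ⟨s, rfl⟩
    exact ⟨s.neg, funext fun A => map_neg (A.alg.res X.toSkel) _⟩
  zero_mem' := ⟨.coe 0, funext fun A =>
    (congrArg (A.alg.res X.toSkel) (map_zero (A.unit.app _))).trans (map_zero _)⟩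
  one_mem' := ⟨.coe 1, funext fun A =>
    (congrArg (A.alg.res X.toSkel) (map_one (A.unit.app _))).trans (map_one _)⟩

instance (X : FinGSet.{u} G) : Small.{max u w} (termRing k L X) :=
  small_of_surjective (f := fun t : Term k L X.skel =>
    (⟨t.val, t, rfl⟩ : termRing k L X)) fun ⟨_, t, ht⟩ => ⟨t, Subtype.ext ht⟩

theorem exists_term {X : FinGSet.{u} G} (z : Shrink.{max u w} (termRing k L X)) :
    ∃ t : Term k L X.skel, t.val = ((Shrink.ringEquiv _ z : termRing k L X) :
      (markedProduct k L).obj X) :=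
  (Shrink.ringEquiv _ z : termRing k L X).2

theorem exists_shrink {X : FinGSet.{u} G} (t : Term k L X.skel) :
    ∃ z : Shrink.{max u w} (termRing k L X), ((Shrink.ringEquiv _ z : termRing k L X) :
      (markedProduct k L).obj X) = t.val :=
  ⟨(Shrink.ringEquiv _).symm ⟨t.val, t, rfl⟩,
    congrArg Subtype.val ((Shrink.ringEquiv (termRing k L X)).apply_symm_apply _)⟩

variable (k L) in
/-- The values of polynomials, as an embedded family of rings. -/
noncomputable def termEmbedded : Embedded.{u, max u w} (markedProduct k L) where
  obj X := Shrink.{max u w} (termRing k L X)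
  incl X := (termRing k L X).subtype.comp (Shrink.ringEquiv (termRing k L X)).toRingHom
  inj X := Subtype.val_injective.comp (Shrink.ringEquiv (termRing k L X)).injective
  res_mem {X Y} f z := by
    obtain ⟨t, ht⟩ := exists_term z
    obtain ⟨z', hz'⟩ := exists_shrink (.res (Y.toSkel.comp (f.comp X.ofSkel)) t)
    refine ⟨z', hz'.trans ?_⟩
    refine Eq.trans (funext fun A => ?_) (congrArg ((markedProduct k L).res f) ht)
    change A.alg.res X.toSkel (A.alg.res (Y.toSkel.comp (f.comp X.ofSkel)) (A.interp t)) =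
      A.alg.res f (A.alg.res Y.toSkel (A.interp t))
    rw [← A.alg.res_comp, ← A.alg.res_comp]
    refine congrArg (fun f => A.alg.res f _) (MulActionHom.ext fun x => ?_)
    exact congrArg (fun x => Y.toSkel (f x)) (X.ofSkel_toSkel x)
  tr_mem {X Y} f z := by
    obtain ⟨t, ht⟩ := exists_term z
    obtain ⟨z', hz'⟩ := exists_shrink (.tr (Y.toSkel.comp (f.comp X.ofSkel)) t)
    refine ⟨z', hz'.trans ?_⟩
    refine Eq.trans (funext fun A => ?_) (congrArg ((markedProduct k L).tr f) ht)
    change A.alg.res Y.toSkel (A.alg.tr (Y.toSkel.comp (f.comp X.ofSkel)) (A.interp t)) =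
      A.alg.tr f (A.alg.res X.toSkel (A.interp t))
    rw [A.alg.tr_comp, A.alg.tr_comp, A.alg.tr_inverse X.ofSkel_toSkel X.toSkel_ofSkel,
      A.alg.tr_inverse Y.toSkel_ofSkel Y.ofSkel_toSkel, ← A.alg.res_comp]
    exact A.alg.res_id' _ Y.ofSkel_toSkel _
  nm_mem {X Y} f z := by
    obtain ⟨t, ht⟩ := exists_term z
    obtain ⟨z', hz'⟩ := exists_shrink (.nm (Y.toSkel.comp (f.comp X.ofSkel)) t)
    refine ⟨z', hz'.trans ?_⟩
    refine Eq.trans (funext fun A => ?_) (congrArg ((markedProduct k L).nm f) ht)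
    change A.alg.res Y.toSkel (A.alg.nm (Y.toSkel.comp (f.comp X.ofSkel)) (A.interp t)) =
      A.alg.nm f (A.alg.res X.toSkel (A.interp t))
    rw [A.alg.nm_comp, A.alg.nm_comp, A.alg.nm_inverse X.ofSkel_toSkel X.toSkel_ofSkel,
      A.alg.nm_inverse Y.toSkel_ofSkel Y.ofSkel_toSkel, ← A.alg.res_comp]
    exact A.alg.res_id' _ Y.ofSkel_toSkel _

variable (k L) in
/-- The free polynomial `k`-algebra on generators in given levels. -/
noncomputable def free : TambaraFunctor.{u, max u w} G := (termEmbedded k L).toTambara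

/-- The value of an element of the free algebra in a marked algebra. -/
noncomputable def MarkedAlg.hom (A : MarkedAlg k L) : Hom (free k L) A.alg where
  app X := (Pi.evalRingHom (fun A : MarkedAlg k L => A.alg.obj X) A).comp
    ((termEmbedded k L).incl X)
  app_res f x := congrFun ((termEmbedded k L).incl_res f x) A
  app_tr f x := congrFun ((termEmbedded k L).incl_tr f x) A
  app_nm f x := congrFun ((termEmbedded k L).incl_nm f x) A

theorem free_ext {X : FinGSet.{u} G} {z z' : (free k L).obj X}
    (h : ∀ A : MarkedAlg k L, A.hom.app X z = A.hom.app X z') : z = z' :=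
  (termEmbedded k L).inj X (funext h)

theorem exists_free {X : FinGSet.{u} G} (t : Term k L X.skel) : ∃ z : (free k L).obj X,
    ∀ A : MarkedAlg k L, A.hom.app X z = A.alg.res X.toSkel (A.interp t) := by
  obtain ⟨z, hz⟩ := exists_shrink t
  exact ⟨z, fun A => congrFun hz A⟩

theorem exists_free_const {X : FinGSet.{u} G} (c : k.obj X) : ∃ z : (free k L).obj X,
    ∀ A : MarkedAlg k L, A.hom.app X z = A.unit.app X c := by
  obtain ⟨z, hz⟩ := exists_free (L := L) (.coe (k.res X.ofSkel c))
  refine ⟨z, fun A => (hz A).trans ?_⟩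
  change A.alg.res X.toSkel (A.unit.app _ (k.res X.ofSkel c)) = _
  rw [A.unit.app_res, ← A.alg.res_comp]
  exact A.alg.res_id' _ X.ofSkel_toSkel _

theorem exists_free_gen (i : Fin n) : ∃ z : (free k L).obj (L i),
    ∀ A : MarkedAlg k L, A.hom.app (L i) z = A.elt i := by
  obtain ⟨z, hz⟩ := exists_free (k := k) (L := L) (X := L i) (.gen i)
  refine ⟨z, fun A => (hz A).trans ?_⟩
  change A.alg.res (L i).toSkel (A.alg.res (L i).ofSkel (A.elt i)) = _
  rw [← A.alg.res_comp]
  exact A.alg.res_id' _ (L i).ofSkel_toSkel _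

variable (k L) in
/-- The unit of the free algebra. -/
noncomputable def freeUnit : Hom k (free k L) :=
  have h {X : FinGSet.{u} G} (c : k.obj X) (A : MarkedAlg k L) :
      A.hom.app X (exists_free_const (L := L) c).choose = A.unit.app X c :=
    (exists_free_const c).choose_spec A
  { app := fun X =>
      { toFun := fun c => (exists_free_const (L := L) c).choose
        map_one' := free_ext fun A => by rw [h, map_one, map_one]
        map_mul' := fun a b => free_ext fun A => by rw [h, map_mul, map_mul, h, h]
        map_zero' := free_ext fun A => by rw [h, map_zero, map_zero]
        map_add' := fun a b => free_ext fun A => by rw [h, map_add, map_add, h, h] }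
    app_res := fun f x => free_ext fun A =>
      (h _ A).trans (by rw [A.hom.app_res, A.unit.app_res]; exact congrArg _ (h _ A).symm)
    app_tr := fun f x => free_ext fun A =>
      (h _ A).trans (by rw [A.hom.app_tr, A.unit.app_tr]; exact congrArg _ (h _ A).symm)
    app_nm := fun f x => free_ext fun A =>
      (h _ A).trans (by rw [A.hom.app_nm, A.unit.app_nm]; exact congrArg _ (h _ A).symm) }

theorem hom_freeUnit (A : MarkedAlg k L) {X : FinGSet.{u} G} (c : k.obj X) :
    A.hom.app X ((freeUnit k L).app X c) = A.unit.app X c :=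
  (exists_free_const c).choose_spec A

variable (k L) in
/-- The generators of the free algebra. -/
noncomputable def freeGen (i : Fin n) : (free k L).obj (L i) := (exists_free_gen i).choose

theorem hom_freeGen (A : MarkedAlg k L) (i : Fin n) : A.hom.app (L i) (freeGen k L i) = A.elt i :=
  (exists_free_gen i).choose_spec A

theorem Hom.ext_app {S : TambaraFunctor.{u, v} G} {T : TambaraFunctor.{u, w'} G} {φ ψ : Hom S T}
    (h : ∀ X z, φ.app X z = ψ.app X z) : φ = ψ := by
  obtain ⟨a, _, _, _⟩ := φ
  obtain ⟨b, _, _, _⟩ := ψ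
  congr
  exact funext fun X => RingHom.ext (h X)

theorem Hom.app_eq {S : TambaraFunctor.{u, v} G} {T : TambaraFunctor.{u, w'} G} {φ ψ : Hom S T}
    (h : φ = ψ) {X : FinGSet.{u} G} (z : S.obj X) : φ.app X z = ψ.app X z := by
  rw [h]

/-- Every polynomial defines an element of the free algebra, which every morphism sends to the
value of the polynomial. -/
theorem exists_free_term {j : Skeleton G} (t : Term k L j) : ∃ z : (free k L).obj j.toFinGSet,
    ∀ (A : MarkedAlg k L) (φ : Hom (free k L) A.alg), φ.comp (freeUnit k L) = A.unit →
      (∀ i, φ.app (L i) (freeGen k L i) = A.elt i) → φ.app _ z = A.interp t := by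
  induction t with
  | gen i =>
    refine ⟨(free k L).res (L i).ofSkel (freeGen k L i), fun A φ _ h => ?_⟩
    rw [φ.app_res, h]
    rfl
  | coe c => exact ⟨(freeUnit k L).app _ c, fun A φ h _ => Hom.app_eq h c⟩
  | add a b iha ihb =>
    obtain ⟨z, hz⟩ := iha
    obtain ⟨z', hz'⟩ := ihb
    exact ⟨z + z', fun A φ h h' => by rw [map_add, hz A φ h h', hz' A φ h h']; rfl⟩
  | mul a b iha ihb =>
    obtain ⟨z, hz⟩ := iha
    obtain ⟨z', hz'⟩ := ihb
    exact ⟨z * z', fun A φ h h' => by rw [map_mul, hz A φ h h', hz' A φ h h']; rfl⟩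
  | neg a iha =>
    obtain ⟨z, hz⟩ := iha
    exact ⟨-z, fun A φ h h' => by rw [map_neg, hz A φ h h']; rfl⟩
  | res f a iha =>
    obtain ⟨z, hz⟩ := iha
    exact ⟨(free k L).res f z, fun A φ h h' => by rw [φ.app_res, hz A φ h h']; rfl⟩
  | tr f a iha =>
    obtain ⟨z, hz⟩ := iha
    exact ⟨(free k L).tr f z, fun A φ h h' => by rw [φ.app_tr, hz A φ h h']; rfl⟩
  | nm f a iha =>
    obtain ⟨z, hz⟩ := iha
    exact ⟨(free k L).nm f z, fun A φ h h' => by rw [φ.app_nm, hz A φ h h']; rfl⟩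

theorem hom_comp_freeUnit (A : MarkedAlg k L) : A.hom.comp (freeUnit k L) = A.unit :=
  Hom.ext_app fun _ c => hom_freeUnit A c

theorem isFreeOn_freeUnit : (freeUnit k L).IsFreeOn L (freeGen k L) := by
  intro S σ s
  let A : MarkedAlg k L := ⟨S, σ, s⟩
  refine ⟨A.hom, ⟨hom_comp_freeUnit A, hom_freeGen A⟩, ?_⟩
  rintro φ ⟨h, h'⟩
  refine Hom.ext_app fun X z => ?_
  obtain ⟨t, ht⟩ := exists_term (k := k) (L := L) z
  obtain ⟨z', hz'⟩ := exists_free_term t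
  have hz : z = (free k L).res X.toSkel z' := by
    refine free_ext fun B => ?_
    rw [B.hom.app_res, hz' B B.hom (hom_comp_freeUnit B) (hom_freeGen B)]
    exact (congrFun ht B).symm
  rw [hz, φ.app_res, A.hom.app_res, hz' A φ h h', hz' A A.hom (hom_comp_freeUnit A) (hom_freeGen A)]

end Free

end TambaraFunctor

namespace TambaraFunctor

variable {G : Type u} [Group G]

/-- An isomorphism of a `k`-algebra with the coinduced algebra `k(- × Y)`. -/
structure Splitting {k ℓ : TambaraFunctor.{u, w} G} (η : Hom k ℓ) (Y : FinGSet.{u} G) where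
  app : ∀ X, ℓ.obj X →+* k.obj (prod X Y)
  bij : ∀ X, Function.Bijective (app X)
  app_res : ∀ {X X' : FinGSet.{u} G} (f : X →[G] X') (z : ℓ.obj X'),
    app X (ℓ.res f z) = k.res (prodMap f Y) (app X' z)
  app_tr : ∀ {X X' : FinGSet.{u} G} (f : X →[G] X') (z : ℓ.obj X),
    app X' (ℓ.tr f z) = k.tr (prodMap f Y) (app X z)
  app_nm : ∀ {X X' : FinGSet.{u} G} (f : X →[G] X') (z : ℓ.obj X),
    app X' (ℓ.nm f z) = k.nm (prodMap f Y) (app X z)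
  app_unit : ∀ {X : FinGSet.{u} G} (c : k.obj X), app X (η.app X c) = k.res (prodFst X Y) c

theorem fib_prodMap_bijective {X X' : FinGSet.{u} G} (f : X →[G] X') (Y : FinGSet.{u} G) (x' : X')
    (y : Y) : Function.Bijective fun x : {x // f x = x'} =>
      (⟨(x, y), Prod.ext x.2 rfl⟩ : {t // prodMap f Y t = (x', y)}) := by
  constructor
  · intro a b h
    exact Subtype.ext (congrArg (fun t : {t // prodMap f Y t = (x', y)} => t.1.1) h)
  · rintro ⟨⟨x, y'⟩, h⟩
    have h1 : f x = x' := congrArg (fun t : X' × Y => t.1) h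
    obtain rfl : y' = y := congrArg (fun t : X' × Y => t.2) h
    exact ⟨⟨x, h1⟩, rfl⟩

section Coinduced

variable [Finite G] {F : Type v} [CommRing F] {n : ℕ} (H : Fin n → Subgroup G)

/-- The disjoint union of the orbits `G/Hᵢ`. -/
def orbits : FinGSet.{u} G where
  carrier := Σ i, G ⧸ H i

/-- The base points of the orbits `G/Hᵢ`. -/
def orbitsOne (i : Fin n) : orbits H := ⟨i, ((1 : G) : G ⧸ H i)⟩

theorem exists_smul_orbitsOne (y : orbits H) : ∃ i, ∃ g : G, y = g • orbitsOne H i := by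
  obtain ⟨i, y⟩ := y
  obtain ⟨g, rfl⟩ := QuotientGroup.mk_surjective y
  refine ⟨i, g, ?_⟩
  exact congrArg (fun t : G ⧸ H i => (⟨i, t⟩ : Σ i, G ⧸ H i))
    (congrArg (fun t : G => (t : G ⧸ H i)) (mul_one g).symm)

variable {H} in
theorem const_prod_orbits_ext {X : FinGSet.{u} G} {φ ψ : (const.{u, v} G F).obj (prod X (orbits H))}
    (h : ∀ (x : X) i, φ.1 (x, orbitsOne H i) = ψ.1 (x, orbitsOne H i)) : φ = ψ := by
  refine Subtype.ext (funext ?_)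
  rintro ⟨x, y⟩
  obtain ⟨i, g, rfl⟩ := exists_smul_orbitsOne H y
  have e : ((x, g • orbitsOne H i) : prod X (orbits H)) =
      g • (show prod X (orbits H) from (g⁻¹ • x, orbitsOne H i)) :=
    Prod.ext (smul_inv_smul g x).symm rfl
  rw [e]
  exact (φ.2 g _).trans ((h _ _).trans (ψ.2 g _).symm)

/-- The function on `X × ⨿ G/Hᵢ` defined by `Hᵢ`-invariant functions on `X`. -/
def orbitsFun {X : FinGSet.{u} G} (c : ∀ i, (coind (H i) (const.{u, v} (H i) F)).obj X) :
    (const.{u, v} G F).obj (prod X (orbits H)) :=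
  ⟨fun t : X × (Σ i, G ⧸ H i) => Quotient.liftOn' t.2.2
      (fun g => (c t.2.1).1 (g⁻¹ • t.1 : X)) fun a b hab => by
        have h := (c t.2.1).2 ⟨_, QuotientGroup.leftRel_apply.1 hab⟩ (b⁻¹ • t.1 : X)
        refine Eq.trans ?_ h
        refine congrArg (c t.2.1).1 ?_
        change a⁻¹ • t.1 = (a⁻¹ * b) • b⁻¹ • t.1
        rw [smul_smul, mul_inv_cancel_right], by
    rintro g ⟨x, ⟨i, y⟩⟩
    obtain ⟨a, rfl⟩ := QuotientGroup.mk_surjective y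
    change (c i).1 ((g * a)⁻¹ • g • x : X) = (c i).1 (a⁻¹ • x : X)
    rw [smul_smul, mul_inv_rev, inv_mul_cancel_right]⟩

theorem orbitsFun_one {X : FinGSet.{u} G}
    (c : ∀ i, (coind (H i) (const.{u, v} (H i) F)).obj X) (x : X) (i : Fin n) :
    (orbitsFun H c).1 (x, orbitsOne H i) = (c i).1 x := by
  change (c i).1 ((1 : G)⁻¹ • x : X) = _
  rw [inv_one, one_smul]

theorem orbitsFun_bijective (X : FinGSet.{u} G) : Function.Bijective
    (orbitsFun H : (∀ i, (coind (H i) (const.{u, v} (H i) F)).obj X) → _) := by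
  constructor
  · intro c c' h
    funext i
    refine Subtype.ext (funext fun x : X => ?_)
    rw [← orbitsFun_one, ← orbitsFun_one, h]
  · intro ψ
    refine ⟨fun i => ⟨fun x : X => ψ.1 (x, orbitsOne H i), fun h (x : X) => ?_⟩, ?_⟩
    · refine Eq.trans ?_ (ψ.2 (h : G) (x, orbitsOne H i))
      refine congrArg ψ.1 (Prod.ext rfl ?_)
      refine congrArg (Sigma.mk i) ?_
      refine QuotientGroup.eq.2 ?_
      change (1 : G)⁻¹ * ((h : G) * 1) ∈ H i
      simp
    · exact const_prod_orbits_ext fun x i => orbitsFun_one H _ x i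

variable {ℓ : TambaraFunctor.{u, max u v} G} {η : Hom (const.{u, v} G F) ℓ} {H}

/-- An isomorphism with a product of coinduced constant algebras defines a splitting. -/
noncomputable def Splitting.ofIsIso
    (φ : Hom ℓ (pi fun i => coind (H i) (const.{u, v} (H i) F))) (hφ : φ.IsIso)
    (hη : φ.comp η = Hom.toPi fun i => constToCoind G F (H i)) : Splitting η (orbits H) where
  app X :=
    { toFun := fun z => orbitsFun H (φ.app X z)
      map_one' := const_prod_orbits_ext fun x i =>
        (orbitsFun_one H (φ.app X _) x i).trans
          (congrArg (fun c : (pi fun i => coind (H i) (const.{u, v} (H i) F)).obj X => (c i).1 x)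
            (map_one (φ.app X)))
      map_mul' := fun a b => const_prod_orbits_ext fun x i =>
        (orbitsFun_one H (φ.app X _) x i).trans
          ((congrArg (fun c : (pi fun i => coind (H i) (const.{u, v} (H i) F)).obj X => (c i).1 x)
            (map_mul (φ.app X) a b)).trans
            (congrArg₂ (· * ·) (orbitsFun_one H (φ.app X a) x i)
              (orbitsFun_one H (φ.app X b) x i)).symm)
      map_zero' := const_prod_orbits_ext fun x i =>
        (orbitsFun_one H (φ.app X _) x i).trans
          (congrArg (fun c : (pi fun i => coind (H i) (const.{u, v} (H i) F)).obj X => (c i).1 x)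
            (map_zero (φ.app X)))
      map_add' := fun a b => const_prod_orbits_ext fun x i =>
        (orbitsFun_one H (φ.app X _) x i).trans
          ((congrArg (fun c : (pi fun i => coind (H i) (const.{u, v} (H i) F)).obj X => (c i).1 x)
            (map_add (φ.app X) a b)).trans
            (congrArg₂ (· + ·) (orbitsFun_one H (φ.app X a) x i)
              (orbitsFun_one H (φ.app X b) x i)).symm) }
  bij X := (orbitsFun_bijective H X).comp (hφ X)
  app_res {X X'} f z := const_prod_orbits_ext fun x i => by
    refine (orbitsFun_one H _ x i).trans ?_
    rw [φ.app_res]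
    exact (orbitsFun_one H (φ.app X' z) (f x) i).symm
  app_tr {X X'} f z := const_prod_orbits_ext fun x i => by
    refine (orbitsFun_one H _ x i).trans ?_
    rw [φ.app_tr]
    exact finsum_eq_of_bijective _ (fib_prodMap_bijective f (orbits H) x (orbitsOne H i))
      fun t => (orbitsFun_one H (φ.app X z) t.1 i).symm
  app_nm {X X'} f z := const_prod_orbits_ext fun x i => by
    refine (orbitsFun_one H _ x i).trans ?_
    rw [φ.app_nm]
    exact finprod_eq_of_bijective _ (fib_prodMap_bijective f (orbits H) x (orbitsOne H i))
      fun t => (orbitsFun_one H (φ.app X z) t.1 i).symm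
  app_unit {X} c := const_prod_orbits_ext fun x i => by
    refine (orbitsFun_one H _ x i).trans ?_
    have h : φ.app X (η.app X c) = _ := Hom.app_eq hη c
    rw [h]
    rfl

end Coinduced

end TambaraFunctor

namespace FinGSet

variable {G : Type u} [Group G]

/-- The diagonal. -/
def diag (Y : FinGSet.{u} G) : Y →[G] prod Y Y :=
  prodLift (MulActionHom.id G) (MulActionHom.id G)

/-- The graph of the second projection. -/
def graph (X Y : FinGSet.{u} G) : prod X Y →[G] prod (prod X Y) Y :=
  prodLift (MulActionHom.id G) (prodSnd X Y)

theorem isPB_graph (X Y : FinGSet.{u} G) :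
    IsPB (prodSnd X Y) (graph X Y) (diag Y) (prodMap (prodSnd X Y) Y) where
  comm _ := rfl
  inj _ _ _ e := congrArg (fun t : (X × Y) × Y => t.1) e
  surj := by
    rintro y ⟨⟨x, y'⟩, y''⟩ e
    obtain rfl : y = y' := congrArg (fun t : Y × Y => t.1) e
    obtain rfl : y = y'' := congrArg (fun t : Y × Y => t.2) e
    exact ⟨(x, y), rfl, rfl⟩

/-- The section of `X × Y → X` over the fibres of `f : X → X'` which is constant with value
`y : Y`. -/
def constSection {X X' : FinGSet.{u} G} (f : X →[G] X') (Y : FinGSet.{u} G) :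
    prod X' Y →[G] dprod f (prodFst X Y) :=
  ⟨fun t => ⟨(t.1, {a | f a.1 = t.1 ∧ a.2 = t.2}), fun a h => h.1, fun x hx =>
      ⟨(x, t.2), ⟨⟨hx, rfl⟩, rfl⟩, fun _ h => Prod.ext h.2 h.1.2⟩⟩, fun g t => by
    refine Subtype.ext (Prod.ext rfl (Set.ext fun a => ?_))
    change f a.1 = g • t.1 ∧ a.2 = g • t.2 ↔ f (g⁻¹ • a.1) = t.1 ∧ g⁻¹ • a.2 = t.2
    rw [map_smul, inv_smul_eq_iff, inv_smul_eq_iff]⟩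

/-- The map to the evaluation set of constant sections. -/
def constSectionEv {X X' : FinGSet.{u} G} (f : X →[G] X') (Y : FinGSet.{u} G) :
    prod X Y →[G] dprodEv f (prodFst X Y) :=
  ⟨fun t => ⟨(t, constSection f Y (prodMap f Y t)), ⟨rfl, rfl⟩⟩, fun g t =>
    Subtype.ext (Prod.ext rfl
      (show constSection f Y (prodMap f Y (g • t)) = g • constSection f Y (prodMap f Y t) by
        rw [map_smul, map_smul]))⟩

theorem isPB_constSection {X X' : FinGSet.{u} G} (f : X →[G] X') (Y : FinGSet.{u} G) :
    IsPB (constSectionEv f Y) (prodMap f Y) (dprodR f (prodFst X Y)) (constSection f Y) where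
  comm _ := rfl
  inj _ _ e _ := congrArg (fun z : dprodEv f (prodFst X Y) => z.1.1) e
  surj := by
    rintro ⟨⟨a, t⟩, ha⟩ ⟨x', y⟩ e
    obtain rfl : t = constSection f Y (x', y) := e
    obtain ⟨h1, h2⟩ : f a.1 = x' ∧ a.2 = y := ha
    subst h1 h2
    exact ⟨a, rfl, rfl⟩

end FinGSet

namespace TambaraFunctor

variable {G : Type u} [Group G] {Y : FinGSet.{u} G}

section Partition

variable (S : TambaraFunctor.{u, w} G) (s : S.obj Y)

/-- An element of `S(Y)` is orthogonal if its restrictions along the two projections of `Y × Y` have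
the product supported on the diagonal. -/
def IsOrthogonal : Prop := S.res (prodFst Y Y) s * S.res (prodSnd Y Y) s = S.tr (diag Y) s

/-- The norm along `f` of an orthogonal element is supported on constant sections. -/
def IsNormConst {X X' : FinGSet.{u} G} (f : X →[G] X') : Prop :=
  S.nm (dprodR f (prodFst X Y)) (S.res (dprodE f (prodFst X Y)) (S.res (prodSnd X Y) s)) =
    S.tr (constSection f Y) (S.res (prodSnd X' Y) s)

variable {S s}

theorem IsOrthogonal.graph (hs : IsOrthogonal S s) (X : FinGSet.{u} G) :
    S.res (prodFst (prod X Y) Y) (S.res (prodSnd X Y) s) *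
      S.res (prodMap (prodFst X Y) Y) (S.res (prodSnd X Y) s) =
    S.tr (graph X Y) (S.res (prodSnd X Y) s) := by
  have h := congrArg (S.res (prodMap (prodSnd X Y) Y)) hs
  rw [map_mul, S.res_tr (isPB_graph X Y), ← S.res_comp, ← S.res_comp] at h
  rw [← S.res_comp, ← S.res_comp]
  exact h

theorem IsOrthogonal.mul_self (hs : IsOrthogonal S s) (X : FinGSet.{u} G) :
    S.res (prodSnd X Y) s * S.res (prodSnd X Y) s = S.res (prodSnd X Y) s := by
  have hinj : Function.Injective (FinGSet.graph X Y) := fun _ _ e =>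
    congrArg (fun t : (X × Y) × Y => t.1) e
  have h := congrArg (S.res (FinGSet.graph X Y)) (hs.graph X)
  rw [map_mul, S.res_tr_inj hinj, S.res_res _ _ (MulActionHom.id G) (fun _ => rfl),
    S.res_res (prodMap (prodFst X Y) Y) _ (MulActionHom.id G) (fun _ => rfl), S.res_id] at h
  exact h

/-- The transfer of `aε · bε` restricted to two copies of `Y`. -/
theorem IsOrthogonal.tr_mul_tr (hs : IsOrthogonal S s) {X : FinGSet.{u} G}
    (a b : S.obj (prod X Y)) :
    (a * S.res (prodSnd X Y) s) * S.res (prodFst X Y) (S.tr (prodFst X Y)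
      (b * S.res (prodSnd X Y) s)) = a * b * S.res (prodSnd X Y) s := by
  set ε := S.res (prodSnd X Y) s with hε
  have h : S.res (prodMap (prodFst X Y) Y) (b * ε) * S.res (prodFst (prod X Y) Y) (a * ε) =
      S.tr (FinGSet.graph X Y) (a * b * ε) := by
    have h1 : S.res (FinGSet.graph X Y) (S.res (prodFst (prod X Y) Y) a *
        S.res (prodMap (prodFst X Y) Y) b) = a * b := by
      rw [map_mul, S.res_res _ _ (MulActionHom.id G) (fun _ => rfl),
        S.res_res (prodMap (prodFst X Y) Y) _ (MulActionHom.id G) (fun _ => rfl), S.res_id,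
        S.res_id]
    rw [← h1, mul_comm (S.res (FinGSet.graph X Y) _) ε, S.tr_mul_res, hε, ← hs.graph, map_mul,
      map_mul]
    ring
  rw [S.res_tr (isPB_prodFst (prodFst X Y) Y).symm, mul_comm, ← S.tr_mul_res, h,
    S.tr_tr _ _ (MulActionHom.id G) (fun _ => rfl), S.tr_id]

end Partition

end TambaraFunctor

namespace TambaraFunctor

variable {G : Type u} [Group G] {Y : FinGSet.{u} G}

theorem TIdeal.mul_mem_gtOne {T : TambaraFunctor.{u, w} G} {I : TIdeal T} {X : FinGSet.{u} G}
    {x y : T.obj X} (hx : x ∈ I.carrier X) (hy : y ∈ I.carrier X) :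
    x * y ∈ I.gtOne.carrier X := by
  simp only [gtOne, Submodule.mem_iInf]
  exact fun J hJ => hJ.1 X x y hx hy

namespace Splitting

section General

variable {k ℓ : TambaraFunctor.{u, w} G} {η : Hom k ℓ}

theorem isFlat (θ : Splitting η Y) : η.toMod.IsFlat :=
  Mod.isFlat_of_shift (Z := Y)
    { app := fun X =>
        { toFun := fun z => θ.app X z
          map_add' := fun a b => map_add (θ.app X) a b
          map_smul' := fun c z =>
            (map_mul (θ.app X) (η.app X c) z).trans (congrArg (· * θ.app X z) (θ.app_unit c)) }
      app_res := fun f z => θ.app_res f z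
      app_tr := fun f z => θ.app_tr f z } θ.bij

/-- The element which corresponds to the indicator function of the diagonal. -/
theorem exists_idem (θ : Splitting η Y) : ∃ s : ℓ.obj Y, θ.app Y s = k.tr (diag Y) 1 :=
  (θ.bij Y).2 _

variable {θ : Splitting η Y} {s : ℓ.obj Y}

theorem app_res_snd (hs : θ.app Y s = k.tr (diag Y) 1) (X : FinGSet.{u} G) :
    θ.app (prod X Y) (ℓ.res (prodSnd X Y) s) = k.tr (graph X Y) 1 := by
  rw [θ.app_res, hs, k.res_tr (isPB_graph X Y), map_one]

theorem tr_unit_mul (hs : θ.app Y s = k.tr (diag Y) 1) {X : FinGSet.{u} G}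
    (z : ℓ.obj X) :
    ℓ.tr (prodFst X Y) (η.app _ (θ.app X z) * ℓ.res (prodSnd X Y) s) = z := by
  apply (θ.bij X).1
  rw [θ.app_tr, map_mul, θ.app_unit, app_res_snd hs, mul_comm, ← k.tr_mul_res, one_mul,
    k.tr_tr _ _ (MulActionHom.id G) (fun _ => rfl), k.tr_id,
    k.res_res _ _ (MulActionHom.id G) (fun _ => rfl), k.res_id]

theorem tr_toPt (hs : θ.app Y s = k.tr (diag Y) 1) : ℓ.tr (toPt Y) s = 1 := by
  apply (θ.bij _).1
  let g : prod (pt G) Y →[G] Y := prodSnd (pt G) Y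
  rw [θ.app_tr, hs, map_one (θ.app _),
    k.tr_tr _ _ (prodLift (toPt Y) (MulActionHom.id G)) (fun _ => rfl),
    k.tr_inverse (g := g) (fun _ => rfl) (fun _ => rfl), map_one]

theorem isOrthogonal (hs : θ.app Y s = k.tr (diag Y) 1) : IsOrthogonal ℓ s := by
  have e : ∀ t : prod Y Y, prodMap (prodFst Y Y) Y (graph Y Y t) = t := fun _ => rfl
  have hpb : IsPB (diag Y) (diag Y) (graph Y Y) (prodMap (diag Y) Y) :=
    { comm := fun _ => rfl
      inj := fun _ _ h _ => congrArg (fun t : Y × Y => t.1) h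
      surj := by
        rintro ⟨y₁, y₂⟩ ⟨y, y'⟩ h
        obtain rfl : y₁ = y := congrArg (fun t : (Y × Y) × Y => t.1.1) h
        obtain rfl : y₂ = y₁ := congrArg (fun t : (Y × Y) × Y => t.1.2) h
        obtain rfl : y₂ = y' := congrArg (fun t : (Y × Y) × Y => t.2) h
        exact ⟨y₂, rfl, rfl⟩ }
  have h1 : k.res (graph Y Y) (θ.app _ (ℓ.res (prodFst Y Y) s)) = k.tr (diag Y) 1 := by
    rw [θ.app_res, hs, k.res_res _ _ (MulActionHom.id G) (fun _ => rfl), k.res_id]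
  apply (θ.bij _).1
  rw [map_mul, app_res_snd hs, mul_comm, ← one_mul (k.tr (graph Y Y) 1)]
  rw [one_mul, ← k.tr_mul_res, h1, one_mul, θ.app_tr, hs, ← k.tr_comp, ← k.tr_comp]
  rfl

/-- The box square is generated by the elements `tr (m ⊗ ε)`. -/
theorem exists_eq_mk (hs : θ.app Y s = k.tr (diag Y) 1) {X : FinGSet.{u} G}
    (x : AlgBox.Obj η η X) : ∃ m : ℓ.obj (prod X Y),
    x = AlgBox.mk (prodFst X Y) m (ℓ.res (prodSnd X Y) s) := by
  induction x using AlgBox.ind with | h Z p a b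
  refine ⟨ℓ.tr (prodMap p Y) (η.app _ (θ.app Z b) * ℓ.res (prodFst Z Y) a), ?_⟩
  rw [AlgBox.mk_left, ← ℓ.res_comp]
  conv_lhs => rw [← tr_unit_mul hs b]
  rw [AlgBox.mk_right, ← AlgBox.mk_smul]
  rfl

theorem subsingleton_kaehler (hs : θ.app Y s = k.tr (diag Y) 1) (X : FinGSet.{u} G) :
    Subsingleton (Kaehler η X) := by
  refine Submodule.Quotient.subsingleton_iff.2 ?_
  rw [Submodule.comap_subtype_eq_top]
  intro (x : AlgBox.Obj η η X) hx
  obtain ⟨m, rfl⟩ := exists_eq_mk hs x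
  set ε := ℓ.res (prodSnd X Y) s with hε
  have horth := isOrthogonal hs
  have hεε : ε * ε = ε := horth.mul_self X
  have hx' : ℓ.tr (prodFst X Y) (m * ε) = 0 := hx
  have hm : m * ε = 0 := by
    have h := horth.tr_mul_tr (1 : ℓ.obj (prod X Y)) m
    rw [← hε, hx', map_zero, mul_zero, one_mul] at h
    exact h.symm
  let y : AlgBox.Obj η η X := AlgBox.mk (prodFst X Y) (1 - ε) ε
  have hy : (mulHom η).app X y = 0 := by
    change ℓ.tr (prodFst X Y) ((1 - ε) * ε) = 0
    rw [sub_mul, hεε, one_mul, sub_self, map_zero]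
  have hxy : (AlgBox.mk (prodFst X Y) m ε * y : AlgBox.Obj η η X) =
      AlgBox.mk (prodFst X Y) m ε := by
    rw [AlgBox.mk_mul (isPB_prodFst (prodFst X Y) Y)
      (r := (prodFst X Y).comp (prodFst (prod X Y) Y)) (fun _ => rfl), horth.graph X,
      AlgBox.mk_right, map_mul, ℓ.res_res _ _ (MulActionHom.id G) (fun _ => rfl),
      ℓ.res_res (prodMap (prodFst X Y) Y) _ (MulActionHom.id G) (fun _ => rfl), ℓ.res_id, ℓ.res_id,
      mul_sub, hm, mul_one, sub_zero]
    rfl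
  have h := TIdeal.mul_mem_gtOne (T := algBox η η) hx hy
  exact hxy ▸ h

end General

end Splitting

section ConstNorm

variable {F : Type v} [CommRing F]

theorem const_tr_apply {X Z : FinGSet.{u} G} {f : X →[G] Z} (hf : Function.Injective f)
    (φ : (const.{u, v} G F).obj X) (x : X) : ((const.{u, v} G F).tr f φ).1 (f x) = φ.1 x :=
  congrFun (congrArg Subtype.val ((const.{u, v} G F).res_tr_inj hf φ)) x

theorem const_tr_apply_of_notMem {X Z : FinGSet.{u} G} {f : X →[G] Z} {z : Z} (h : ∀ x, f x ≠ z)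
    (φ : (const.{u, v} G F).obj X) : ((const.{u, v} G F).tr f φ).1 z = 0 := by
  have : IsEmpty {x // f x = z} := ⟨fun x => h x x.2⟩
  exact finsum_of_isEmpty _

theorem const_tr_diag_self (Y : FinGSet.{u} G) (y : Y) :
    ((const.{u, v} G F).tr (diag Y) 1).1 (y, y) = 1 :=
  const_tr_apply (f := diag Y) (fun _ _ e => congrArg (fun t : Y × Y => t.1) e) 1 y

theorem const_tr_diag_of_ne {Y : FinGSet.{u} G} {y y' : Y} (h : y ≠ y') :
    ((const.{u, v} G F).tr (diag Y) 1).1 (y, y') = 0 :=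
  const_tr_apply_of_notMem (fun _ e => h ((congrArg (fun t : Y × Y => t.1) e).symm.trans
    (congrArg (fun t : Y × Y => t.2) e))) 1

/-- The norm of the indicator function of the diagonal is the indicator function of the constant
sections. -/
theorem Splitting.isNormConst {ℓ : TambaraFunctor.{u, max u v} G} {η : Hom (const.{u, v} G F) ℓ}
    {θ : Splitting η Y} {s : ℓ.obj Y} (hs : θ.app Y s = (const.{u, v} G F).tr (diag Y) 1)
    {X X' : FinGSet.{u} G} (f : X →[G] X') :
    IsNormConst ℓ s f := by
  classical
  apply (θ.bij _).1
  rw [θ.app_nm, θ.app_tr, θ.app_res, app_res_snd hs, app_res_snd hs,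
    ← (const.{u, v} G F).tr_comp, ← app_res_snd hs, θ.app_res, hs,
    ← (const.{u, v} G F).res_comp]
  refine Subtype.ext (funext ?_)
  rintro ⟨t, y⟩
  have hinj : Function.Injective ((prodMap (constSection f Y) Y).comp (graph X' Y)) := by
    rintro ⟨a, b⟩ ⟨a', b'⟩ e
    have h1 : a = a' := congrArg (fun q : dprod f (prodFst X Y) × Y => q.1.1.1) e
    have h2 : b = b' := congrArg (fun q : dprod f (prodFst X Y) × Y => q.2) e
    rw [h1, h2]
  by_cases ht : constSection f Y (t.1.1, y) = t
  · have e : ((t, y) : prod (dprod f (prodFst X Y)) Y) =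
        ((prodMap (constSection f Y) Y).comp (graph X' Y))
          (show prod X' Y from (t.1.1, y)) := Prod.ext ht.symm rfl
    have hR : ((const.{u, v} G F).tr ((prodMap (constSection f Y) Y).comp (graph X' Y)) 1).1
        (show prod (dprod f (prodFst X Y)) Y from (t, y)) = 1 := by
      rw [e]
      exact const_tr_apply hinj 1 _
    refine Eq.trans ?_ hR.symm
    refine finprod_eq_one_of_forall_eq_one ?_
    rintro ⟨⟨⟨⟨a, t'⟩, ha⟩, y'⟩, hz⟩
    obtain rfl : t' = t := congrArg (fun q : dprod f (prodFst X Y) × Y => q.1) hz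
    obtain rfl : y' = y := congrArg (fun q : dprod f (prodFst X Y) × Y => q.2) hz
    rw [← ht] at ha
    have ha' : a.2 = y' := ha.2
    change ((const.{u, v} G F).tr (diag Y) 1).1 (a.2, y') = 1
    rw [ha']
    exact const_tr_diag_self Y y'
  · have hR : ((const.{u, v} G F).tr ((prodMap (constSection f Y) Y).comp (graph X' Y)) 1).1
        (show prod (dprod f (prodFst X Y)) Y from (t, y)) = 0 := by
      refine const_tr_apply_of_notMem ?_ 1
      rintro ⟨x', y'⟩ e
      have h1 : constSection f Y (x', y') = t :=
        congrArg (fun q : dprod f (prodFst X Y) × Y => q.1) e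
      obtain rfl : y' = y := congrArg (fun q : dprod f (prodFst X Y) × Y => q.2) e
      refine ht ?_
      rw [← h1]
      rfl
    refine Eq.trans ?_ hR.symm
    have hne : ∃ a : X × Y, a ∈ t.1.2 ∧ a.2 ≠ y := by
      by_contra! hall
      refine ht (Subtype.ext (Prod.ext rfl (Set.ext fun a => ⟨?_, fun ha => ?_⟩)))
      · rintro ⟨h1, h2⟩
        change f a.1 = t.1.1 at h1
        change a.2 = y at h2
        obtain ⟨b, ⟨hb, hb'⟩, -⟩ := t.2.2 a.1 h1
        have hba : b = a := Prod.ext hb' ((hall b hb).trans h2.symm)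
        rw [← hba]
        exact hb
      · exact ⟨t.2.1 a ha, hall a ha⟩
    obtain ⟨a, ha, hay⟩ := hne
    let z : {z // prodMap (dprodR f (prodFst X Y)) Y z = (t, y)} := ⟨(⟨(a, t), ha⟩, y), rfl⟩
    refine finprod_eq_zero _ z ?_ (Set.toFinite _)
    exact const_tr_diag_of_ne hay

end ConstNorm

end TambaraFunctor

namespace FinGSet

variable {G : Type u} [Group G]

theorem isPB_toPt (X Y : FinGSet.{u} G) :
    IsPB (prodSnd X Y) (prodFst X Y) (toPt Y) (toPt X) where
  comm _ := rfl
  inj _ _ e e' := Prod.ext e' e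
  surj y x _ := ⟨(x, y), rfl, rfl⟩

end FinGSet

namespace TambaraFunctor

variable {G : Type u} [Group G] {Y : FinGSet.{u} G}

section Partition

variable {S : TambaraFunctor.{u, w} G} {s : S.obj Y}

theorem tr_res_snd (h : S.tr (toPt Y) s = 1) (X : FinGSet.{u} G) :
    S.tr (prodFst X Y) (S.res (prodSnd X Y) s) = 1 := by
  rw [← S.res_tr (isPB_toPt X Y), h, map_one]

theorem IsNormConst.nm_tr {X X' : FinGSet.{u} G} {f : X →[G] X'} (h : IsNormConst S s f)
    (a : S.obj (prod X Y)) :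
    S.nm f (S.tr (prodFst X Y) (a * S.res (prodSnd X Y) s)) =
      S.tr (prodFst X' Y) (S.nm (prodMap f Y) a * S.res (prodSnd X' Y) s) := by
  rw [S.nm_tr (isExp_dprod f (prodFst X Y)), map_mul (S.res _), map_mul (S.nm _), h, mul_comm,
    ← S.tr_mul_res, S.res_nm (isPB_constSection f Y), ← S.tr_comp,
    S.res_res _ _ (MulActionHom.id G) (fun _ => rfl), S.res_id, mul_comm]
  rfl

end Partition

namespace Splitting

variable {k ℓ S : TambaraFunctor.{u, w} G} {η : Hom k ℓ}

theorem hom_ext {θ : Splitting η Y} {s : ℓ.obj Y} (hs : θ.app Y s = k.tr (diag Y) 1)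
    {ψ ψ' : Hom ℓ S}
    (h : ψ.comp η = ψ'.comp η) (h' : ψ.app Y s = ψ'.app Y s) : ψ = ψ' := by
  refine Hom.ext_app fun X z => ?_
  have e : ∀ c, ψ.app (prod X Y) (η.app _ c) = ψ'.app (prod X Y) (η.app _ c) := fun c =>
    Hom.app_eq h c
  rw [← tr_unit_mul hs z, ψ.app_tr, ψ'.app_tr, map_mul (ψ.app _), map_mul (ψ'.app _), ψ.app_res,
    ψ'.app_res, h', e]

variable [Finite G] (θ : Splitting η Y) (σ : Hom k S) {s' : S.obj Y}

/-- The morphism out of a split algebra defined by a partition of unity. -/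
noncomputable def lift (h1 : S.tr (toPt Y) s' = 1) (h2 : IsOrthogonal S s')
    (h3 : ∀ (K H : Subgroup G) (f : quot K →[G] quot H), IsNormConst S s' f) : Hom ℓ S :=
  let ψ (X : FinGSet.{u} G) : ℓ.obj X →+* S.obj X :=
    { toFun := fun z => S.tr (prodFst X Y) (σ.app _ (θ.app X z) * S.res (prodSnd X Y) s')
      map_one' := by rw [map_one, map_one, one_mul, tr_res_snd h1]
      map_mul' := fun a b => by
        rw [← S.tr_mul_res, h2.tr_mul_tr, map_mul (θ.app X), map_mul (σ.app _)]
      map_zero' := by rw [map_zero, map_zero, zero_mul, map_zero]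
      map_add' := fun a b => by rw [map_add, map_add, add_mul, map_add] }
  have hres {X X' : FinGSet.{u} G} (f : X →[G] X') (z : ℓ.obj X') :
      ψ X (ℓ.res f z) = S.res f (ψ X' z) := by
    change S.tr _ _ = S.res f (S.tr _ _)
    rw [S.res_tr (isPB_prodFst f Y).symm, θ.app_res, σ.app_res, map_mul (S.res _), ← S.res_comp]
    rfl
  { app := ψ
    app_res := hres
    app_tr := fun {X X'} f z => by
      change S.tr _ _ = S.tr f (S.tr _ _)
      rw [θ.app_tr, σ.app_tr, ← S.tr_mul_res, ← S.tr_comp, ← S.tr_comp, ← S.res_comp]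
      rfl
    app_nm := fun {X X'} f z => nm_compat_of_orbits ℓ S ψ hres (fun K H f z => by
      change S.tr _ _ = S.nm f (S.tr _ _)
      rw [θ.app_nm, σ.app_nm, (h3 K H f).nm_tr]) f z }

theorem lift_app (h1 : S.tr (toPt Y) s' = 1) (h2 : IsOrthogonal S s')
    (h3 : ∀ (K H : Subgroup G) (f : quot K →[G] quot H), IsNormConst S s' f) {X : FinGSet.{u} G}
    (z : ℓ.obj X) : (θ.lift σ h1 h2 h3).app X z =
      S.tr (prodFst X Y) (σ.app _ (θ.app X z) * S.res (prodSnd X Y) s') :=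
  rfl

theorem lift_comp (h1 : S.tr (toPt Y) s' = 1) (h2 : IsOrthogonal S s')
    (h3 : ∀ (K H : Subgroup G) (f : quot K →[G] quot H), IsNormConst S s' f) :
    (θ.lift σ h1 h2 h3).comp η = σ := by
  refine Hom.ext_app fun X c => ?_
  change S.tr _ (σ.app _ (θ.app X (η.app X c)) * _) = _
  rw [θ.app_unit, σ.app_res, mul_comm, S.tr_mul_res, tr_res_snd h1, one_mul]

theorem lift_idem (h1 : S.tr (toPt Y) s' = 1) (h2 : IsOrthogonal S s')
    (h3 : ∀ (K H : Subgroup G) (f : quot K →[G] quot H), IsNormConst S s' f) {s : ℓ.obj Y}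
    (hs : θ.app Y s = k.tr (diag Y) 1) : (θ.lift σ h1 h2 h3).app Y s = s' := by
  rw [lift_app, hs, σ.app_tr, map_one, ← S.tr_mul_res, one_mul,
    S.res_res _ _ (MulActionHom.id G) (fun _ => rfl), S.res_id,
    S.tr_tr _ _ (MulActionHom.id G) (fun _ => rfl), S.tr_id]

end Splitting

variable [Finite G]

section Relations

variable (Y) in
/-- The defining relations of a split algebra. -/
abbrev RelIndex : Type u :=
  Option (Option (Σ K : Subgroup G, Σ H : Subgroup G, quot K →[G] quot H))

instance {X X' : FinGSet.{u} G} : Finite (X →[G] X') :=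
  Finite.of_injective (fun f : X →[G] X' => (f : X → X')) DFunLike.coe_injective

variable (Y) in
/-- The levels of the relations. -/
def relLevel : RelIndex (G := G) → FinGSet.{u} G
  | none => pt G
  | some none => prod Y Y
  | some (some ⟨_, _, f⟩) => dprod f (prodFst _ Y)

/-- The left hand sides of the relations. -/
def relLeft (S : TambaraFunctor.{u, w} G) (s : S.obj Y) : ∀ i, S.obj (relLevel Y i)
  | none => S.tr (toPt Y) s
  | some none => S.res (prodFst Y Y) s * S.res (prodSnd Y Y) s
  | some (some ⟨_, _, f⟩) =>
    S.nm (dprodR f (prodFst _ Y)) (S.res (dprodE f (prodFst _ Y)) (S.res (prodSnd _ Y) s))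

/-- The right hand sides of the relations. -/
def relRight (S : TambaraFunctor.{u, w} G) (s : S.obj Y) : ∀ i, S.obj (relLevel Y i)
  | none => 1
  | some none => S.tr (diag Y) s
  | some (some ⟨_, _, f⟩) => S.tr (constSection f Y) (S.res (prodSnd _ Y) s)

theorem map_relLeft {S : TambaraFunctor.{u, w} G} {T : TambaraFunctor.{u, w'} G} (φ : Hom S T)
    (s : S.obj Y) (i : RelIndex) : φ.app _ (relLeft S s i) = relLeft T (φ.app Y s) i := by
  rcases i with _ | _ | ⟨K, H, f⟩
  · exact φ.app_tr _ _
  · change φ.app (prod Y Y) (S.res _ s * S.res _ s) = T.res _ _ * T.res _ _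
    rw [map_mul, φ.app_res, φ.app_res]
  · change φ.app (dprod f (prodFst _ Y)) (S.nm _ (S.res _ (S.res _ s))) =
      T.nm _ (T.res _ (T.res _ _))
    rw [φ.app_nm, φ.app_res, φ.app_res]

theorem map_relRight {S : TambaraFunctor.{u, w} G} {T : TambaraFunctor.{u, w'} G} (φ : Hom S T)
    (s : S.obj Y) (i : RelIndex) : φ.app _ (relRight S s i) = relRight T (φ.app Y s) i := by
  rcases i with _ | _ | ⟨K, H, f⟩
  · exact map_one (φ.app (pt G))
  · exact φ.app_tr _ _
  · change φ.app (dprod f (prodFst _ Y)) (S.tr _ (S.res _ s)) = T.tr _ (T.res _ _)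
    rw [φ.app_tr, φ.app_res]

theorem Splitting.isFinPres {k ℓ : TambaraFunctor.{u, max u w} G} {η : Hom k ℓ}
    {θ : Splitting η Y} {s : ℓ.obj Y} (hs : θ.app Y s = k.tr (diag Y) 1)
    (hN : ∀ (K H : Subgroup G) (f : quot K →[G] quot H), IsNormConst ℓ s f) : η.IsFinPres := by
  obtain ⟨m, ⟨e⟩⟩ := Finite.exists_equiv_fin (RelIndex (G := G))
  let L : Fin m → FinGSet.{u} G := fun i => relLevel Y (e.symm i)
  let M : Fin 1 → FinGSet.{u} G := fun _ => Y
  let P := free k M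
  let Q := free k L
  let x : P.obj Y := freeGen k M 0
  let A : MarkedAlg k L := ⟨P, freeUnit k M, fun i => relLeft P x (e.symm i)⟩
  let B : MarkedAlg k L := ⟨P, freeUnit k M, fun i => relRight P x (e.symm i)⟩
  let C : MarkedAlg k M := ⟨ℓ, η, fun _ => s⟩
  have hA : A.hom.comp (freeUnit k L) = freeUnit k M := hom_comp_freeUnit A
  have hB : B.hom.comp (freeUnit k L) = freeUnit k M := hom_comp_freeUnit B
  have hC : C.hom.comp (freeUnit k M) = η := hom_comp_freeUnit C
  have hCx : C.hom.app Y x = s := hom_freeGen C 0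
  have hrel : ∀ i, relLeft ℓ s i = relRight ℓ s i := by
    rintro (_ | _ | ⟨K, H, f⟩)
    · exact tr_toPt hs
    · exact isOrthogonal hs
    · exact hN K H f
  refine ⟨Q, P, freeUnit k L, freeUnit k M, m, L, freeGen k L, 1, M, freeGen k M, A.hom, B.hom,
    C.hom, isFreeOn_freeUnit, isFreeOn_freeUnit, hA, hB, hC, ?_, ?_⟩
  · refine (isFreeOn_freeUnit (k := k) (L := L) ℓ η fun i => relLeft ℓ s (e.symm i)).unique
      ⟨?_, fun i => ?_⟩ ⟨?_, fun i => ?_⟩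
    · exact (congrArg C.hom.comp hA).trans hC
    · change C.hom.app _ (A.hom.app (L i) _) = _
      rw [hom_freeGen]
      refine (map_relLeft C.hom x _).trans ?_
      rw [hCx]
    · exact (congrArg C.hom.comp hB).trans hC
    · change C.hom.app _ (B.hom.app (L i) _) = _
      rw [hom_freeGen]
      refine (map_relRight C.hom x _).trans ?_
      rw [hCx, hrel]
  · intro S σ φ hφ hAB
    have hrel' : ∀ i, relLeft S (φ.app Y x) i = relRight S (φ.app Y x) i := by
      intro i
      have h : φ.app _ (A.hom.app (L (e i)) (freeGen k L (e i))) =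
          φ.app _ (B.hom.app (L (e i)) (freeGen k L (e i))) := Hom.app_eq hAB _
      rw [hom_freeGen, hom_freeGen] at h
      have h' := ((map_relLeft φ x (e.symm (e i))).symm.trans h).trans
        (map_relRight φ x (e.symm (e i)))
      rwa [e.symm_apply_apply] at h'
    have h1 : S.tr (toPt Y) (φ.app Y x) = 1 := hrel' none
    have h2 : IsOrthogonal S (φ.app Y x) := hrel' (some none)
    have h3 : ∀ (K H : Subgroup G) (f : quot K →[G] quot H), IsNormConst S (φ.app Y x) f :=
      fun K H f => hrel' (some (some ⟨K, H, f⟩))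
    refine ⟨θ.lift σ h1 h2 h3, ⟨θ.lift_comp σ h1 h2 h3, ?_⟩, ?_⟩
    · refine (isFreeOn_freeUnit (k := k) (L := M) S σ fun _ => φ.app Y x).unique
        ⟨?_, fun i => ?_⟩ ⟨hφ, fun i => ?_⟩
      · exact (congrArg (θ.lift σ h1 h2 h3).comp hC).trans (θ.lift_comp σ h1 h2 h3)
      · obtain rfl : i = 0 := Subsingleton.elim _ _
        exact (congrArg ((θ.lift σ h1 h2 h3).app Y) hCx).trans (θ.lift_idem σ h1 h2 h3 hs)
      · obtain rfl : i = 0 := Subsingleton.elim _ _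
        rfl
    · rintro ψ ⟨hψ, hψ'⟩
      refine hom_ext hs (hψ.trans (θ.lift_comp σ h1 h2 h3).symm) ?_
      rw [θ.lift_idem σ h1 h2 h3 hs, ← hψ', ← hCx]
      rfl

end Relations

theorem isEtale_of_isIso {F : Type v} [Field F] {ℓ : TambaraFunctor.{u, max u v} G}
    {η : Hom (const.{u, v} G F) ℓ} {n : ℕ} {H : Fin n → Subgroup G}
    (φ : Hom ℓ (pi fun i => coind (H i) (const.{u, v} (H i) F))) (hφ : φ.IsIso)
    (hη : φ.comp η = Hom.toPi fun i => constToCoind G F (H i)) : η.IsEtale := by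
  let θ := Splitting.ofIsIso φ hφ hη
  obtain ⟨s, hs⟩ := θ.exists_idem
  exact ⟨⟨Splitting.subsingleton_kaehler hs, θ.isFlat⟩,
    Splitting.isFinPres.{u, v} hs fun _ _ f => Splitting.isNormConst hs f⟩

end TambaraFunctor

theorem theorem5 {G : Type u} [Group G] [Finite G] {F : Type v} [Field F] [IsAlgClosed F]
    (ℓ : TambaraFunctor.{u, max u v} G)
    (η : TambaraFunctor.Hom (TambaraFunctor.const.{u, v} G F) ℓ) (hfin : η.IsFinite) :
    η.IsEtale ↔
      ∃ (n : ℕ) (H : Fin n → Subgroup G)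
        (φ : TambaraFunctor.Hom ℓ (TambaraFunctor.pi fun i =>
          TambaraFunctor.coind (H i) (TambaraFunctor.const.{u, v} (H i) F))),
        φ.IsIso ∧
          φ.comp η = TambaraFunctor.Hom.toPi fun i => TambaraFunctor.constToCoind G F (H i) := by
  constructor
  · exact fun h => TambaraFunctor.exists_isIso_of_isEtale hfin h.1
  · rintro ⟨n, H, φ, hφ, hη⟩
    exact TambaraFunctor.isEtale_of_isIso φ hφ hη
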